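/- Let $\mathbb T^2=\mathbb R^2/\mathbb Z^2$, let $g,\nu,\mu,\kappa>0$ and $\alpha$ be real constants, and let $C>0$, $\gamma>0$, $\beta\ge 1$. **Spaces.** $H^s=H^s(\mathbb T^2)$ are the Sobolev spaces, with $\|f\|_{H^s}^2=\sum_{k\in\mathbb Z^2}(1+4\pi^2|k|^2)^s|\hat f(k)|^2$. $H$ is the closure in $L^2(\mathbb T^2)^2$ of the divergence-free trigonometric polynomial vector fields with zero average, $P_\sigma$ is the Leray–Helmholtz projection onto $H$, and $V=H\cap H^1$. **Calming functions.** A family $(\zeta^\epsilon)_{\epsilon>0}$ of functions $\mathbb R\to\mathbb R$ is a calming family if every $\zeta^\epsilon$ is Lipschitz, $|\zeta^\epsilon(x)|+|(\zeta^\epsilon)'(x)|\le M_\epsilon$ (wherever the derivative exists) with $M_\epsilon\to\infty$ as $\epsilon\to0^+$, and $|x-\zeta^\epsilon(x)|\le C\epsilon^\gamma|x|^\beta$ for all $x\in\mathbb R$. **Systems.** The original MHD–Boussinesq system with Ohmic heating is, with $Q(r)=r^2$, $$\partial_tU-\nu\Delta U+P_\sigma[(U\cdot\nabla)U]=P_\sigma[(B\cdot\nabla)B+g\Theta\vec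 e_2],$$ $$\partial_tB-\mu\Delta B+P_\sigma[(U\cdot\nabla)B]=P_\sigma[(B\cdot\nabla)U],$$ $$\partial_t\Theta-\kappa\Delta\Theta+(U\cdot\nabla)\Theta=\alpha\mu\,Q(|\nabla\times B|),\qquad \nabla\cdot U=0=\nabla\cdot B .$$ The calmed system for $(u,b,\theta)$ is the same with $Q(r)=\zeta^\epsilon(r)\,r$. A solution on $[0,T]$ of the original system with data $(U_0,B_0,\Theta_0)$ means here: $U,B\in C([0,T];H^2\cap V)\cap L^2(0,T;H^3\cap V)$ with $\partial_tU,\partial_tB\in L^2(0,T;H)$; $\Theta\in C([0,T];H^2)\cap L^2(0,T;H^3)$ with $\partial_t\Theta\in L^2(0,T;L^2)$; the equations hold in $L^2(0,T;H)\times L^2(0,T;H)\times L^2(0,T;L^2)$; and $(U,B,\Theta)(0)=(U_0,B_0,\Theta_0)$. A strong solution on $[0,T]$ of the calmed system means: $u,b\in C([0,T];H^2\cap V)\cap L^2(0,T;H^3\cap V)$ with $\partial_tu,\partial_tb\in L^2(0,T;H)$; $\theta\in C([0,T];L^2)\cap L^\infty(0,T;H^2)\cap L^2(0,T;H^3)$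 with $\partial_t\theta\in L^2(0,T;H^{-1})$; the equations hold in $L^2(0,T;H)\times L^2(0,T;H)\times L^2(0,T;H^{-1})$; and the initial data are attained. **Theorem.** (1) There is a constant $K>0$, depending only on $g,\nu,\mu,\kappa,\alpha,C,\gamma,\beta$, such that for all $T>0$ and $M\ge1$ there is $\epsilon_0>0$, depending only on these quantities, $T$ and $M$, with the following property. Let $(\zeta^\epsilon)$ be a calming family, let $U_0,B_0\in H^2\cap V$, $\Theta_0\in H^2$, let $(U,B,\Theta)$ be a solution of the original system on $[0,T]$ with these data such that $$\|U(t)\|_{H^2}+\|B(t)\|_{H^2}+\|\Theta(t)\|_{H^1}\le M\qquad(0\le t\le T),$$ let $0<\epsilon<\epsilon_0$, and let $(u,b,\theta)$ be a strong solution of the calmed system on $[0,T]$ with the same data. Then for all $t\in[0,T]$ $$\|U(t)-u(t)\|_{H^1}^2+\|B(t)-b(t)\|_{H^1}^2+\|\Theta(t)-\theta(t)\|_{L^2}^2\le c_1\epsilon^{2\gamma},$$ $$\int_0^T\Big(\|U-u\|_{H^2}^2+\|B-b\|_{H^2}^2+\|\Theta-\theta\|_{H^1}^2\Big)dt\le c_2\epsilon^{2\gamma},$$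 where $c_1=K M^{2+2\beta}e^{K(M^{4/3}+M^2)T}$ and $c_2=K M^{2+2\beta}\big(e^{K(M^{4/3}+M^2)T}+T\big)$. (2) In particular, if $(U,B,\Theta)$ is a solution of the original system on $[0,T]$ with data in $(H^2\cap V)\times(H^2\cap V)\times H^2$ and, for every $\epsilon>0$, $(u^\epsilon,b^\epsilon,\theta^\epsilon)$ is a strong solution of the calmed system on $[0,T]$ with the same data, then $$\sup_{0\le t\le T}\Big(\|U(t)-u^\epsilon(t)\|_{H^1}+\|B(t)-b^\epsilon(t)\|_{H^1}+\|\Theta(t)-\theta^\epsilon(t)\|_{L^2}\Big)\to0\quad\text{as }\epsilon\to0^+.$$ -/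

import Mathlib

open MeasureTheory Set Filter Topology
open scoped ENNReal NNReal

noncomputable section

namespace MHDB

/-! ## The torus, Fourier coefficients and Sobolev norms -/

/-- The periodic domain `ℝ² / ℤ²`. -/
abbrev T2 : Type := UnitAddTorus (Fin 2)

/-- The Lebesgue measure `dx` on `ℝ² / ℤ²`, of total mass one. -/
abbrev dx : Measure T2 := Measure.pi fun _ => (AddCircle.haarAddCircle : Measure UnitAddCircle)

/-- Scalar fields: the real Hilbert space `L²(T2)`. -/
abbrev L2 : Type := Lp ℝ 2 dx

/-- Vector fields in `L²(T2)²`, given by their two components. The component with index `0`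
is the one along `x₁`, the component with index `1` the one along `x₂`. -/
abbrev VF : Type := Fin 2 → L2

/-- Families of Fourier coefficients. A periodic distribution is identified with the family of
its Fourier coefficients. -/
abbrev Coeffs : Type := (Fin 2 → ℤ) → ℂ

/-- The Fourier coefficients `∫ F(x) exp(- 2 π i k · x) dx` of a real function on the torus. -/
def fc (F : T2 → ℝ) : Coeffs :=
  fun k => UnitAddTorus.mFourierCoeff (fun x => (F x : ℂ)) k

/-- The eigenvalue `4 π² |k|²` of `-Δ` on `exp(2 π i k · x)`. -/
def lam (k : Fin 2 → ℤ) : ℝ := 4 * Real.pi ^ 2 * ((k 0 : ℝ) ^ 2 + (k 1 : ℝ) ^ 2)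

/-- The square of the `H^s` norm, `∑ₖ (1 + 4 π² |k|²)^s |aₖ|²`, with value `∞` outside `H^s`. -/
def hSq (s : ℤ) (a : Coeffs) : ℝ≥0∞ :=
  ∑' k, ENNReal.ofReal ((1 + lam k) ^ s * ‖a k‖ ^ 2)

/-- The square of the `H^s` norm of a scalar field. -/
def sSq (s : ℤ) (f : L2) : ℝ≥0∞ := hSq s (fc f)

/-- The square of the `H^s` norm of a vector field. -/
def vSq (s : ℤ) (v : VF) : ℝ≥0∞ := ∑ j, sSq s (v j)

/-- The `H^s` norm of a scalar field. -/
def sNorm (s : ℤ) (f : L2) : ℝ≥0∞ := sSq s f ^ (1 / 2 : ℝ)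

/-- The `H^s` norm of a vector field. -/
def vNorm (s : ℤ) (v : VF) : ℝ≥0∞ := vSq s v ^ (1 / 2 : ℝ)

/-- `g` is the weak derivative of `f` in the direction `x_j`, tested against the exponentials
`exp(- 2 π i k · x)`, whose span is the space of trigonometric polynomials. -/
def IsPartial (j : Fin 2) (f g : L2) : Prop :=
  ∀ k : Fin 2 → ℤ, fc g k = 2 * Real.pi * Complex.I * (k j : ℂ) * fc f k

open Classical in
/-- The weak derivative `∂_j f`, for a field `f` that has one in `L²` (it is then unique). -/
def pd (j : Fin 2) (f : L2) : L2 :=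
  if h : ∃ g : L2, IsPartial j f g then h.choose else 0

/-- The family of coefficients of a vector field is divergence free with zero average. -/
def SolenoidalCoeffs (a : Fin 2 → Coeffs) : Prop :=
  (∀ j, a j 0 = 0) ∧ ∀ k : Fin 2 → ℤ, ∑ j, (k j : ℂ) * a j k = 0

/-- Membership in `H`, the `L²` closure of the divergence free trigonometric polynomials with
zero average. The space `V` is the intersection of `H` and `H¹`. -/
def InH (v : VF) : Prop := SolenoidalCoeffs (fun j => fc (v j))

/-- The Leray-Helmholtz projection onto divergence free fields with zero average,
in Fourier coefficients: `0` for `k = 0` and `a(k) - k (k · a(k)) / |k|²` for `k ≠ 0`. -/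
def leray (a : Fin 2 → Coeffs) : Fin 2 → Coeffs :=
  fun j k =>
    if k = 0 then 0
    else a j k - (k j : ℂ) * (∑ i, (k i : ℂ) * a i k) / (∑ i, (k i : ℂ) ^ 2)

/-! ## Spaces of time-dependent fields -/

/-- `f ∈ C([0,T]; H^s)`. -/
def ContH (s : ℤ) (T : ℝ) (f : ℝ → L2) : Prop :=
  (∀ t ∈ Icc 0 T, sSq s (f t) < ∞) ∧
    ∀ t₀ ∈ Icc 0 T, Tendsto (fun t => sSq s (f t - f t₀)) (𝓝[Icc 0 T] t₀) (𝓝 0)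

/-- `f ∈ L²(0,T; H^s)`. -/
def L2H (s : ℤ) (T : ℝ) (f : ℝ → L2) : Prop :=
  AEStronglyMeasurable f (volume.restrict (Ioo 0 T)) ∧
    ∫⁻ t in Ioo 0 T, sSq s (f t) < ∞

/-- `f ∈ L^∞(0,T; H^s)`. -/
def LinfH (s : ℤ) (T : ℝ) (f : ℝ → L2) : Prop :=
  AEStronglyMeasurable f (volume.restrict (Ioo 0 T)) ∧
    ∃ R : ℝ≥0, ∀ᵐ t ∂(volume.restrict (Ioo 0 T)), sSq s (f t) ≤ R

/-- `f` has the time derivative `f' ∈ L²(0,T; H^s)`: an `H^s`-valued, square integrable function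
whose integral from `0` to `t` is `f(t) - f(0)`. -/
def TimeDerivL2H (s : ℤ) (T : ℝ) (f : ℝ → L2) (f' : ℝ → Coeffs) : Prop :=
  (∀ k, AEStronglyMeasurable (fun t => f' t k) (volume.restrict (Ioo 0 T))) ∧
    ∫⁻ t in Ioo 0 T, hSq s (f' t) < ∞ ∧
    ∀ t ∈ Icc 0 T, ∀ k, fc (f t) k = fc (f 0) k + ∫ τ in (0 : ℝ)..t, f' τ k

/-! ## The equations -/

/-- The physical constants. -/
structure Params where
  /-- the buoyancy constant -/
  g : ℝ
  /-- the fluid viscosity -/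
  ν : ℝ
  /-- the magnetic resistivity -/
  μ : ℝ
  /-- the thermal diffusion -/
  κ : ℝ
  /-- the coefficient of the Ohmic heating -/
  α : ℝ

/-- The advection `(v · ∇) f` of a scalar field `f` by a vector field `v`. -/
def adv (v : VF) (f : L2) : T2 → ℝ := fun x => ∑ i, v i x * pd i f x

/-- The scalar curl `∇ × b = ∂₁ b₂ - ∂₂ b₁`. -/
def curl (b : VF) : T2 → ℝ := fun x => pd 0 (b 1) x - pd 1 (b 0) x

/-- The equations at one instant, with `u'`, `b'`, `θ'` for the time derivatives and with the
heating term `α μ Q(|∇ × b|)`. The first two equations are those in `H`, that is, after the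
Leray-Helmholtz projection (which removes the pressure gradient and the average). All three are
written coefficient by coefficient. -/
def Equations (p : Params) (Q : ℝ → ℝ) (u b : VF) (θ : L2)
    (u' b' : Fin 2 → Coeffs) (θ' : Coeffs) : Prop :=
  (∀ j k, u' j k + p.ν * lam k * fc (u j) k + leray (fun i => fc (adv u (u i))) j k
      = leray (fun i => fc (adv b (b i))) j k
        + p.g * leray (fun i l => if i = 1 then fc θ l else 0) j k) ∧
  (∀ j k, b' j k + p.μ * lam k * fc (b j) k + leray (fun i => fc (adv u (b i))) j k
      = leray (fun i => fc (adv b (u i))) j k) ∧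
  (∀ k, θ' k + p.κ * lam k * fc θ k + fc (adv u θ) k
      = p.α * p.μ * fc (fun x => Q |curl b x|) k)

/-- The equations hold on `(0,T)`, the first two in `L²(0,T; H)` and the third one in
`L²(0,T; H^s)`, where the time derivatives lie in these spaces. -/
def Solves (s : ℤ) (p : Params) (Q : ℝ → ℝ) (T : ℝ) (u b : ℝ → VF) (θ : ℝ → L2) : Prop :=
  ∃ (u' b' : ℝ → Fin 2 → Coeffs) (θ' : ℝ → Coeffs),
    (∀ j, TimeDerivL2H 0 T (fun t => u t j) (fun t => u' t j)) ∧
    (∀ j, TimeDerivL2H 0 T (fun t => b t j) (fun t => b' t j)) ∧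
    TimeDerivL2H s T θ θ' ∧
    ∀ᵐ t ∂(volume.restrict (Ioo 0 T)),
      SolenoidalCoeffs (u' t) ∧ SolenoidalCoeffs (b' t) ∧
        Equations p Q (u t) (b t) (θ t) (u' t) (b' t) (θ' t)

/-- Semi-strong solutions on `[0,T]` of the calmed system, whose heating term is
`α μ ζ(|∇ × b|) |∇ × b|`, with initial data `u₀`, `b₀`, `θ₀`. -/
structure IsSemiStrongSolution (p : Params) (ζ : ℝ → ℝ) (T : ℝ) (u₀ b₀ : VF) (θ₀ : L2)
    (u b : ℝ → VF) (θ : ℝ → L2) : Prop where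
  init_u : u 0 = u₀
  init_b : b 0 = b₀
  init_θ : θ 0 = θ₀
  u_mem : ∀ t ∈ Icc 0 T, InH (u t)
  b_mem : ∀ t ∈ Icc 0 T, InH (b t)
  u_cont : ∀ j, ContH 1 T (fun t => u t j)
  b_cont : ∀ j, ContH 1 T (fun t => b t j)
  θ_cont : ContH 0 T θ
  u_L2H2 : ∀ j, L2H 2 T (fun t => u t j)
  b_L2H2 : ∀ j, L2H 2 T (fun t => b t j)
  θ_L2H1 : L2H 1 T θ
  solves : Solves (-1) p (fun r => ζ r * r) T u b θ

/-- Strong solutions on `[0,T]` of the calmed system. -/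
structure IsStrongSolution (p : Params) (ζ : ℝ → ℝ) (T : ℝ) (u₀ b₀ : VF) (θ₀ : L2)
    (u b : ℝ → VF) (θ : ℝ → L2) : Prop
    extends IsSemiStrongSolution p ζ T u₀ b₀ θ₀ u b θ where
  u_contH2 : ∀ j, ContH 2 T (fun t => u t j)
  b_contH2 : ∀ j, ContH 2 T (fun t => b t j)
  u_L2H3 : ∀ j, L2H 3 T (fun t => u t j)
  b_L2H3 : ∀ j, L2H 3 T (fun t => b t j)
  θ_LinfH2 : LinfH 2 T θ
  θ_L2H3 : L2H 3 T θ

/-- Strong solutions on `[0,T]` of the original system, whose heating term is `α μ |∇ × B|²`,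
with initial data `U₀`, `B₀`, `Θ₀`. -/
structure IsOriginalSolution (p : Params) (T : ℝ) (U₀ B₀ : VF) (Θ₀ : L2)
    (U B : ℝ → VF) (Θ : ℝ → L2) : Prop where
  init_U : U 0 = U₀
  init_B : B 0 = B₀
  init_Θ : Θ 0 = Θ₀
  U_mem : ∀ t ∈ Icc 0 T, InH (U t)
  B_mem : ∀ t ∈ Icc 0 T, InH (B t)
  U_contH2 : ∀ j, ContH 2 T (fun t => U t j)
  B_contH2 : ∀ j, ContH 2 T (fun t => B t j)
  Θ_contH2 : ContH 2 T Θ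
  U_L2H3 : ∀ j, L2H 3 T (fun t => U t j)
  B_L2H3 : ∀ j, L2H 3 T (fun t => B t j)
  Θ_L2H3 : L2H 3 T Θ
  solves : Solves 0 p (fun r => r ^ 2) T U B Θ

/-- A family `ζ ε`, `ε > 0`, of calming functions with constant `C`, rate `γ` and exponent `β`.
The bound on the derivative is asked for where the Lipschitz function `ζ ε` is differentiable
(`deriv` is zero elsewhere). -/
structure IsCalmingFamily (C γ β : ℝ) (ζ : ℝ → ℝ → ℝ) : Prop where
  lipschitz : ∀ ε > 0, ∃ L : ℝ≥0, LipschitzWith L (ζ ε)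
  bounded : ∃ Mb : ℝ → ℝ, Tendsto Mb (𝓝[>] 0) atTop ∧
    ∀ ε > 0, ∀ x, |ζ ε x| + |deriv (ζ ε) x| ≤ Mb ε
  approx : ∀ ε > 0, ∀ x, |x - ζ ε x| ≤ C * ε ^ γ * |x| ^ β

end MHDB

end

/-! Put v = U - u, w = B - b, η = Θ - θ and m = C ε^γ. These differences vanish at time 0 and solve
heat equations in which every forcing term carries a factor v, w or η, except for one source: the
calming error.

The velocities and magnetic fields are compared in H², one order above what is claimed. There the
dissipation gains H³, so the forcing is only needed in H¹, and `H² · H¹ ⊂ H¹` on the two-dimensional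
torus controls every advection term without any cancellation (`exists_hSq_forcing_le`). Moreover the
curls J of B and j of b lie in H¹, hence in every L^q with q finite, and J² - ζ(|j|)|j| = (J - j)(J
+ j) + (|j| - ζ(|j|))|j|. The first term is in `H¹ · H¹ ⊂ L²`; the second is at most m |j|^(β+1), so
its L² norm is at most a constant times m times the power β+1 of the H² norm of b
(`exists_hSq_heating_sub_le`).

These bounds need b and u to be bounded in H², which is not assumed with any constant. It holds,
with squared norms at most 4M², as long as the squared H² norms of v and w add up to at most 1. For
such times, E = ‖v‖² + ‖w‖² + A ‖η‖² (norms in H², H², L²) satisfies E + c ∫ dissipation ≤ ∫ (C M² E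
+ C m² M^(2+2β)) (`exists_energy_inequality`). Grönwall gives E ≤ m² M^(2β) exp(C M² T), which is
below 1 for small ε; since E is continuous and starts at 0, the threshold is never reached
(`gronwall_bootstrap`).

All analysis is carried out on Fourier coefficients. Products become convolutions, estimated in
weighted ℓ² by Cauchy-Schwarz (`exists_hR_cv_le`); the embedding of H¹ into L^(2n) follows from
these product estimates. The energy identity is proved for each mode, an absolutely continuous
function of time (`IsMode.energy_le`), and summed by Tonelli in [0,∞], so no pairing of the equation
with a solution has to be justified. -/

noncomputable section

namespace MHDB

/-! ## Fourier coefficients of square integrable functions -/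

/-- The Fourier coefficients of a complex function on the torus. -/
def fcC (F : T2 → ℂ) : Coeffs := fun k => UnitAddTorus.mFourierCoeff F k

lemma fcC_eq (F : T2 → ℂ) (k : Fin 2 → ℤ) :
    fcC F k = ∫ x, UnitAddTorus.mFourier (-k) x * F x ∂dx := rfl

lemma fc_eq_fcC (F : T2 → ℝ) : fc F = fcC (fun x => (F x : ℂ)) := rfl

lemma fcC_congr {F G : T2 → ℂ} (h : F =ᵐ[dx] G) : fcC F = fcC G := by
  funext k
  rw [fcC_eq, fcC_eq]
  refine integral_congr_ae ?_
  filter_upwards [h] with x hx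
  rw [hx]

lemma fc_congr {F G : T2 → ℝ} (h : F =ᵐ[dx] G) : fc F = fc G := by
  refine fcC_congr ?_
  filter_upwards [h] with x hx
  rw [hx]

lemma norm_mFourier_apply (k : Fin 2 → ℤ) (x : T2) : ‖UnitAddTorus.mFourier k x‖ = 1 := by
  simp only [UnitAddTorus.mFourier, fourier_apply, ContinuousMap.coe_mk, norm_prod,
    Circle.norm_coe, Finset.prod_const_one]

lemma integrable_mFourier_mul {F : T2 → ℂ} (hF : Integrable F dx) (k : Fin 2 → ℤ) :
    Integrable (fun x => UnitAddTorus.mFourier k x * F x) dx := by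
  refine hF.bdd_mul (c := 1) ?_ ?_
  · exact (UnitAddTorus.mFourier k).continuous.aestronglyMeasurable
  · exact Eventually.of_forall fun x => (norm_mFourier_apply k x).le

lemma fcC_add {F G : T2 → ℂ} (hF : Integrable F dx) (hG : Integrable G dx) (k : Fin 2 → ℤ) :
    fcC (fun x => F x + G x) k = fcC F k + fcC G k := by
  simp only [fcC_eq, mul_add]
  exact integral_add (integrable_mFourier_mul hF _) (integrable_mFourier_mul hG _)

lemma fc_add {F G : T2 → ℝ} (hF : Integrable F dx) (hG : Integrable G dx) (k : Fin 2 → ℤ) :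
    fc (fun x => F x + G x) k = fc F k + fc G k := by
  simp only [fc_eq_fcC, Complex.ofReal_add]
  exact fcC_add hF.ofReal hG.ofReal k

lemma fc_sub {F G : T2 → ℝ} (hF : Integrable F dx) (hG : Integrable G dx) (k : Fin 2 → ℤ) :
    fc (fun x => F x - G x) k = fc F k - fc G k := by
  have h := fc_add (F := fun x => F x - G x) (hF.sub hG) hG k
  simp only [sub_add_cancel] at h
  rw [h]; ring

/-- Parseval's identity. -/
lemma tsum_enorm_fcC_sq {F : T2 → ℂ} (hF : MemLp F 2 dx) :
    ∑' k, ‖fcC F k‖ₑ ^ 2 = ∫⁻ x, ‖F x‖ₑ ^ 2 ∂dx := by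
  have h := UnitAddTorus.hasSum_sq_mFourierCoeff (d := Fin 2) (hF.toLp F)
  have e : ∀ k, UnitAddTorus.mFourierCoeff (hF.toLp F : T2 → ℂ) k = fcC F k :=
    fun k => congrFun (fcC_congr hF.coeFn_toLp) k
  simp only [e] at h
  have h2 : ∑' k, ‖fcC F k‖ₑ ^ 2 = ∑' k, ENNReal.ofReal (‖fcC F k‖ ^ 2) := by
    refine tsum_congr fun k => ?_
    rw [ENNReal.ofReal_pow (norm_nonneg _), ofReal_norm]
  rw [h2, ← ENNReal.ofReal_tsum_of_nonneg (fun k => sq_nonneg _) h.summable, h.tsum_eq]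
  have hi : Integrable (fun x => ‖(hF.toLp F : T2 → ℂ) x‖ ^ 2) dx := (Lp.memLp _).integrable_norm_pow (by norm_num)
  refine (ofReal_integral_eq_lintegral_ofReal hi (Eventually.of_forall fun x => sq_nonneg _)).trans ?_
  refine lintegral_congr_ae ?_
  filter_upwards [hF.coeFn_toLp] with x hx
  rw [hx, ENNReal.ofReal_pow (norm_nonneg _), ofReal_norm]

/-- Square summable families are families of Fourier coefficients. -/
lemma exists_fcC_eq {a : Coeffs} (ha : ∑' k, ‖a k‖ₑ ^ 2 ≠ ∞) :
    ∃ F : Lp ℂ 2 dx, ∀ k, fcC F k = a k := by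
  have hm : Memℓp a 2 := by
    refine memℓp_gen ?_
    have h2 : ∑' k, ENNReal.ofReal (‖a k‖ ^ 2) ≠ ∞ := by
      convert! ha using 4 with k
      rw [ENNReal.ofReal_pow (norm_nonneg _), ofReal_norm]
    have := ENNReal.summable_toReal h2
    simpa [ENNReal.toReal_ofReal (sq_nonneg _)] using this
  refine ⟨UnitAddTorus.mFourierBasis.repr.symm ⟨a, hm⟩, fun k => ?_⟩
  have := UnitAddTorus.mFourierBasis_repr (UnitAddTorus.mFourierBasis.repr.symm ⟨a, hm⟩) k
  rw [LinearIsometryEquiv.apply_symm_apply] at this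
  exact this.symm

lemma memLp_ofReal (f : L2) : MemLp (fun x => (f x : ℂ)) 2 dx := (Lp.memLp f).ofReal

lemma integrable_L2 (f : L2) : Integrable f dx := (Lp.memLp f).integrable (by norm_num)

lemma integrable_mul_L2 (f g : L2) : Integrable (fun x => f x * g x) dx :=
  (Lp.memLp f).integrable_mul (Lp.memLp g)

lemma fc_L2_add (f g : L2) (k : Fin 2 → ℤ) : fc ⇑(f + g) k = fc f k + fc g k := by
  rw [← fc_add (integrable_L2 f) (integrable_L2 g)]
  exact congrFun (fc_congr (Lp.coeFn_add f g)) k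

lemma fc_L2_sub (f g : L2) (k : Fin 2 → ℤ) : fc ⇑(f - g) k = fc f k - fc g k := by
  rw [← fc_sub (integrable_L2 f) (integrable_L2 g)]
  exact congrFun (fc_congr (Lp.coeFn_sub f g)) k

lemma tsum_enorm_fc_sq {F : T2 → ℝ} (hF : MemLp F 2 dx) :
    ∑' k, ‖fc F k‖ₑ ^ 2 = ∫⁻ x, ‖F x‖ₑ ^ 2 ∂dx := by
  have h := tsum_enorm_fcC_sq hF.ofReal
  have e : ∀ x, ‖((F x : ℝ) : ℂ)‖ₑ = ‖F x‖ₑ := fun x => by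
    rw [← ofReal_norm, ← ofReal_norm, Complex.norm_real]
  simp only [RCLike.ofReal_eq_complex_ofReal, e] at h
  exact h

/-- A field is determined by its Fourier coefficients. -/
lemma L2_ext_fc {f g : L2} (h : ∀ k, fc f k = fc g k) : f = g := by
  have h0 : ∫⁻ x, ‖(f - g : L2) x‖ₑ ^ 2 ∂dx = 0 := by
    rw [← tsum_enorm_fc_sq (Lp.memLp _)]
    refine ENNReal.tsum_eq_zero.2 fun k => ?_
    rw [fc_L2_sub, h]
    simp
  rw [lintegral_eq_zero_iff' ((Lp.aestronglyMeasurable _).enorm.pow_const _)] at h0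
  rw [← sub_eq_zero]
  refine (Lp.eq_zero_iff_ae_eq_zero).2 ?_
  filter_upwards [h0] with x hx
  simpa using hx

/-- The coefficients of a product are bounded by the convolution of the coefficients. -/
lemma enorm_fcC_mul_le {F G : T2 → ℂ} (hF : MemLp F 2 dx) (hG : MemLp G 2 dx) (k : Fin 2 → ℤ) :
    ‖fcC (fun x => F x * G x) k‖ₑ ≤ ∑' l, ‖fcC F l‖ₑ * ‖fcC G (k - l)‖ₑ := by
  -- Parseval is applied to F and conj(G) e_k: their inner product is the coefficient of F G at k,
  -- and the coefficient of conj(G) e_k at l is the conjugate of that of G at k - l.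
  have hH : MemLp (fun x => (starRingEnd ℂ) (G x) * UnitAddTorus.mFourier k x) 2 dx := by
    have h1 : MemLp (fun x => (starRingEnd ℂ) (G x)) 2 dx := hG.star
    refine MemLp.mul' (p := 2) (q := ∞) ?_ h1
    refine memLp_top_of_bound (UnitAddTorus.mFourier k).continuous.aestronglyMeasurable 1 ?_
    exact Eventually.of_forall fun x => (norm_mFourier_apply k x).le
  have h := UnitAddTorus.hasSum_prod_mFourierCoeff (d := Fin 2) (hH.toLp _) (hF.toLp F)
  have e1 : ∀ l, UnitAddTorus.mFourierCoeff (hF.toLp F : T2 → ℂ) l = fcC F l :=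
    fun l => congrFun (fcC_congr hF.coeFn_toLp) l
  have e2 : ∀ l, (starRingEnd ℂ) (UnitAddTorus.mFourierCoeff (hH.toLp _ : T2 → ℂ) l)
      = fcC G (k - l) := by
    intro l
    have : UnitAddTorus.mFourierCoeff (hH.toLp _ : T2 → ℂ) l = fcC _ l :=
      congrFun (fcC_congr hH.coeFn_toLp) l
    rw [this, fcC_eq, fcC_eq, ← integral_conj]
    refine integral_congr_ae (Eventually.of_forall fun x => ?_)
    simp only [map_mul, Complex.conj_conj]
    rw [UnitAddTorus.mFourier_neg, Complex.conj_conj, ← UnitAddTorus.mFourier_neg,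
      show -(k - l) = l + -k by abel, UnitAddTorus.mFourier_add]
    ring
  have e3 : ∫ t, (starRingEnd ℂ) ((hH.toLp _ : T2 → ℂ) t) * (hF.toLp F : T2 → ℂ) t ∂dx
      = fcC (fun x => F x * G x) k := by
    rw [fcC_eq]
    refine integral_congr_ae ?_
    filter_upwards [hH.coeFn_toLp, hF.coeFn_toLp] with x h1 h2
    rw [h1, h2]
    simp only [map_mul, Complex.conj_conj]
    rw [UnitAddTorus.mFourier_neg]
    ring
  simp only [e1, e2] at h
  have h' : HasSum (fun i => fcC G (k - i) * fcC F i) (fcC (fun x => F x * G x) k) := by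
    rw [← e3]; exact h
  rw [← h'.tsum_eq]
  refine (enorm_tsum_le_tsum_enorm).trans (ENNReal.tsum_le_tsum fun l => ?_)
  rw [enorm_mul, mul_comm]

lemma enorm_fc_mul_le (f g : L2) (k : Fin 2 → ℤ) :
    ‖fc (fun x => f x * g x) k‖ₑ ≤ ∑' l, ‖fc f l‖ₑ * ‖fc g (k - l)‖ₑ := by
  have := enorm_fcC_mul_le (memLp_ofReal f) (memLp_ofReal g) k
  simp only [fc_eq_fcC, Complex.ofReal_mul]
  exact this

lemma fc_neg_eq_conj (F : T2 → ℝ) (k : Fin 2 → ℤ) : fc F (-k) = (starRingEnd ℂ) (fc F k) := by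
  rw [fc_eq_fcC, fcC_eq, fcC_eq, ← integral_conj]
  refine integral_congr_ae (Eventually.of_forall fun x => ?_)
  simp only [map_mul, Complex.conj_ofReal]
  rw [UnitAddTorus.mFourier_neg]

/-- Square summable, conjugate symmetric families are the coefficients of real fields. -/
lemma exists_fc_eq {a : Coeffs} (ha : ∑' k, ‖a k‖ₑ ^ 2 ≠ ∞)
    (hs : ∀ k, a (-k) = (starRingEnd ℂ) (a k)) : ∃ f : L2, ∀ k, fc f k = a k := by
  obtain ⟨F, hF⟩ := exists_fcC_eq ha
  -- The real part (F + conj F)/2 works: by the symmetry `hs`, conj F has the same coefficients as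
  -- F.
  have hm : MemLp (fun x => (F x).re) 2 dx := (Lp.memLp F).re
  refine ⟨hm.toLp _, fun k => ?_⟩
  rw [congrFun (fc_congr hm.coeFn_toLp) k, fc_eq_fcC]
  have hI : Integrable F dx := (Lp.memLp F).integrable (by norm_num)
  have h2 : Integrable (fun x => (starRingEnd ℂ) (F x)) dx :=
    ((Lp.memLp F).star : MemLp (fun x => (starRingEnd ℂ) (F x)) 2 dx).integrable (by norm_num)
  have hc : fcC (fun x => (starRingEnd ℂ) (F x)) k = a k := by
    have : fcC (fun x => (starRingEnd ℂ) (F x)) k = (starRingEnd ℂ) (fcC F (-k)) := by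
      rw [fcC_eq, fcC_eq, ← integral_conj]
      refine integral_congr_ae (Eventually.of_forall fun x => ?_)
      simp only [map_mul]
      rw [← UnitAddTorus.mFourier_neg, neg_neg]
    rw [this, hF, hs, Complex.conj_conj]
  have h3 : fcC (fun x => F x + (starRingEnd ℂ) (F x)) k = 2 * a k := by
    rw [fcC_add hI h2, hF, hc]; ring
  have h4 : fcC (fun x => F x + (starRingEnd ℂ) (F x)) k
      = 2 * fcC (fun x => ((F x).re : ℂ)) k := by
    rw [fcC_eq, fcC_eq, ← integral_const_mul]
    refine integral_congr_ae (Eventually.of_forall fun x => ?_)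
    simp only [Complex.add_conj]
    push_cast
    ring
  rw [h4] at h3
  exact mul_left_cancel₀ two_ne_zero h3

/-! ## Weighted sequences and convolutions -/

/-- The weight `1 + 4 π² |k|²` of the Sobolev norms. -/
def om (k : Fin 2 → ℤ) : ℝ := 1 + lam k

lemma lam_nonneg (k : Fin 2 → ℤ) : 0 ≤ lam k := by unfold lam; positivity

lemma one_le_om (k : Fin 2 → ℤ) : 1 ≤ om k := by
  have := lam_nonneg k
  unfold om; linarith

lemma om_pos (k : Fin 2 → ℤ) : 0 < om k := zero_lt_one.trans_le (one_le_om k)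

lemma om_add_le (l m : Fin 2 → ℤ) : om (l + m) ≤ 2 * (om l + om m) := by
  have h : (0 : ℝ) ≤ 4 * Real.pi ^ 2 := by positivity
  have h2 : ((l 0 + m 0 : ℝ)) ^ 2 + (l 1 + m 1 : ℝ) ^ 2
      ≤ 2 * (((l 0 : ℝ) ^ 2 + (l 1 : ℝ) ^ 2) + ((m 0 : ℝ) ^ 2 + (m 1 : ℝ) ^ 2)) := by
    nlinarith [sq_nonneg ((l 0 : ℝ) - m 0), sq_nonneg ((l 1 : ℝ) - m 1)]
  have h3 := mul_le_mul_of_nonneg_left h2 h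
  simp only [om, lam, Pi.add_apply, Int.cast_add]
  linarith

lemma norm_sq_le_om (k : Fin 2 → ℤ) : ‖k‖ ^ 2 ≤ om k := by
  have h1 : ‖k‖ ^ 2 ≤ (k 0 : ℝ) ^ 2 + (k 1 : ℝ) ^ 2 := by
    have h2 : ‖k‖ ≤ Real.sqrt ((k 0 : ℝ) ^ 2 + (k 1 : ℝ) ^ 2) := by
      refine (pi_norm_le_iff_of_nonneg (Real.sqrt_nonneg _)).2 fun i => ?_
      refine Real.le_sqrt_of_sq_le ?_
      fin_cases i
      · simp [Int.norm_eq_abs, sq_nonneg]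
      · simp [Int.norm_eq_abs, sq_nonneg]
    calc ‖k‖ ^ 2 ≤ Real.sqrt ((k 0 : ℝ) ^ 2 + (k 1 : ℝ) ^ 2) ^ 2 := by gcongr
      _ = _ := Real.sq_sqrt (by positivity)
  have h4 : (1 : ℝ) ≤ 4 * Real.pi ^ 2 := by nlinarith [Real.pi_gt_three]
  have h5 : (0 : ℝ) ≤ (k 0 : ℝ) ^ 2 + (k 1 : ℝ) ^ 2 := by positivity
  unfold om lam
  nlinarith

/-- Comparison with the lattice sum of ‖k‖^(-2p) over ℤ². This is where the dimension enters: the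
threshold 1 = d/2 reappears in every product estimate. -/
lemma summable_om_rpow {p : ℝ} (hp : 1 < p) : Summable fun k => om k ^ (-p) := by
  have h := EisensteinSeries.summable_one_div_norm_rpow (k := 2 * p) (by linarith)
  refine Summable.of_norm_bounded_eventually h ?_
  filter_upwards [(Set.finite_singleton (0 : Fin 2 → ℤ)).compl_mem_cofinite] with k hk
  have hk0 : 0 < ‖k‖ := norm_pos_iff.2 hk
  rw [Real.norm_of_nonneg (Real.rpow_nonneg (om_pos k).le _)]
  calc om k ^ (-p) ≤ (‖k‖ ^ 2) ^ (-p) :=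
        Real.rpow_le_rpow_of_nonpos (by positivity) (norm_sq_le_om k) (by linarith)
    _ = ‖k‖ ^ (-(2 * p)) := by
        rw [← Real.rpow_natCast, ← Real.rpow_mul hk0.le]; congr 1; push_cast; ring

/-- The square of the weighted `ℓ²` norm with the weights `om k ^ s`. -/
def hR (s : ℝ) (a : (Fin 2 → ℤ) → ℝ≥0∞) : ℝ≥0∞ :=
  ∑' k, ENNReal.ofReal (om k ^ s) * a k ^ 2

/-- Real orders are needed because the embedding of H¹ into L^(2n) passes through the orders 1 -
j/n. -/
lemma hSq_eq_hR (s : ℤ) (a : Coeffs) : hSq s a = hR s (fun k => ‖a k‖ₑ) := by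
  refine tsum_congr fun k => ?_
  change ENNReal.ofReal (om k ^ s * ‖a k‖ ^ 2) = _
  rw [ENNReal.ofReal_mul (zpow_nonneg (om_pos k).le _), ENNReal.ofReal_pow (norm_nonneg _),
    ofReal_norm, ← Real.rpow_intCast]

lemma hR_mono {s : ℝ} {a b : (Fin 2 → ℤ) → ℝ≥0∞} (h : ∀ k, a k ≤ b k) : hR s a ≤ hR s b :=
  ENNReal.tsum_le_tsum fun k => by gcongr; exact h k

lemma hR_mono_exponent {s t : ℝ} (h : s ≤ t) (a : (Fin 2 → ℤ) → ℝ≥0∞) : hR s a ≤ hR t a :=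
  ENNReal.tsum_le_tsum fun k => by
    gcongr
    exact one_le_om k

lemma hR_add_le (s : ℝ) (a b : (Fin 2 → ℤ) → ℝ≥0∞) :
    hR s (fun k => a k + b k) ≤ 2 * (hR s a + hR s b) := by
  unfold hR
  rw [← ENNReal.tsum_add, ← ENNReal.tsum_mul_left]
  refine ENNReal.tsum_le_tsum fun k => ?_
  have h : (a k + b k) ^ 2 ≤ 2 * (a k ^ 2 + b k ^ 2) := by
    have := ENNReal.rpow_add_le_mul_rpow_add_rpow (a k) (b k) (p := 2) (by norm_num)
    have e : (2 : ℝ≥0∞) ^ ((2 : ℝ) - 1) = 2 := by norm_num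
    rw [e] at this
    exact_mod_cast this
  calc ENNReal.ofReal (om k ^ s) * (a k + b k) ^ 2
      ≤ ENNReal.ofReal (om k ^ s) * (2 * (a k ^ 2 + b k ^ 2)) := by gcongr
    _ = _ := by ring

lemma hR_const_mul (s : ℝ) (c : ℝ≥0∞) (a : (Fin 2 → ℤ) → ℝ≥0∞) :
    hR s (fun k => c * a k) = c ^ 2 * hR s a := by
  unfold hR
  rw [← ENNReal.tsum_mul_left]
  refine tsum_congr fun k => ?_
  ring

/-- The convolution of two families of nonnegative numbers. -/
def cv (f g : (Fin 2 → ℤ) → ℝ≥0∞) (k : Fin 2 → ℤ) : ℝ≥0∞ := ∑' l, f l * g (k - l)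

lemma tsum_mul_sq_le {ι : Type*} (f g : ι → ℝ≥0∞) :
    (∑' i, f i * g i) ^ 2 ≤ (∑' i, f i ^ 2) * ∑' i, g i ^ 2 := by
  let _ : MeasurableSpace ι := ⊤
  have h := ENNReal.lintegral_mul_le_Lp_mul_Lq (Measure.count : Measure ι)
    (Real.HolderConjugate.two_two) (f := f) (g := g)
    (measurable_from_top.aemeasurable) (measurable_from_top.aemeasurable)
  simp only [lintegral_count, Pi.mul_apply] at h
  have h2 := pow_le_pow_left' h 2
  refine h2.trans_eq ?_
  rw [mul_pow, ← ENNReal.rpow_natCast, ← ENNReal.rpow_natCast, ← ENNReal.rpow_mul,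
    ← ENNReal.rpow_mul]
  norm_num

/-- Cauchy-Schwarz in l, after multiplying and dividing by the square root of A(l) B(k-l). The sum
over l of w(k) / (A(l) B(k-l)) is at most 2c ∑ G, uniformly in k; the remaining double sum
factorizes by Tonelli. -/
lemma tsum_weight_mul_cv_sq_le {w A B G : (Fin 2 → ℤ) → ℝ} {c : ℝ} (hc : 0 ≤ c)
    (hw : ∀ k, 0 ≤ w k)
    (hA : ∀ k, 0 < A k) (hB : ∀ k, 0 < B k) (hG : ∀ k, 0 ≤ G k)
    (h : ∀ l m, w (l + m) ≤ c * (G l + G m) * (A l * B m)) (f g : (Fin 2 → ℤ) → ℝ≥0∞) :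
    ∑' k, ENNReal.ofReal (w k) * cv f g k ^ 2 ≤
      ENNReal.ofReal (2 * c) * (∑' k, ENNReal.ofReal (G k)) *
        ((∑' k, ENNReal.ofReal (A k) * f k ^ 2) * ∑' k, ENNReal.ofReal (B k) * g k ^ 2) := by
  set S := ∑' k, ENNReal.ofReal (G k) with hS
  have shift : ∀ (k : Fin 2 → ℤ) (F : (Fin 2 → ℤ) → ℝ≥0∞), ∑' l, F (k - l) = ∑' l, F l :=
    fun k F => (Equiv.subLeft k).tsum_eq F
  have key : ∀ k, ENNReal.ofReal (w k) * cv f g k ^ 2 ≤ ENNReal.ofReal (2 * c) * S *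
      ∑' l, (ENNReal.ofReal (A l) * f l ^ 2) * (ENNReal.ofReal (B (k - l)) * g (k - l) ^ 2) := by
    intro k
    set p : (Fin 2 → ℤ) → ℝ≥0∞ := fun l => ENNReal.ofReal (Real.sqrt (w k / (A l * B (k - l))))
    set q : (Fin 2 → ℤ) → ℝ≥0∞ := fun l =>
      ENNReal.ofReal (Real.sqrt (A l * B (k - l))) * (f l * g (k - l))
    have hpq : ENNReal.ofReal (Real.sqrt (w k)) * cv f g k = ∑' l, p l * q l := by
      unfold cv
      rw [← ENNReal.tsum_mul_left]
      refine tsum_congr fun l => ?_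
      have hAB : 0 < A l * B (k - l) := mul_pos (hA _) (hB _)
      simp only [p, q]
      rw [← mul_assoc (ENNReal.ofReal (Real.sqrt (w k / _))),
        ← ENNReal.ofReal_mul (Real.sqrt_nonneg _),
        ← Real.sqrt_mul' _ hAB.le, div_mul_cancel₀ _ hAB.ne']
    have hp : ∑' l, p l ^ 2 ≤ ENNReal.ofReal (2 * c) * S := by
      have : ∀ l, p l ^ 2 ≤ ENNReal.ofReal c * (ENNReal.ofReal (G l) + ENNReal.ofReal (G (k - l))) := by
        intro l
        have hAB : 0 < A l * B (k - l) := mul_pos (hA _) (hB _)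
        simp only [p]
        rw [← ENNReal.ofReal_pow (Real.sqrt_nonneg _), Real.sq_sqrt (div_nonneg (hw _) hAB.le),
          ← ENNReal.ofReal_add (hG _) (hG _), ← ENNReal.ofReal_mul hc]
        refine ENNReal.ofReal_le_ofReal ?_
        rw [div_le_iff₀ hAB]
        have := h l (k - l)
        rwa [add_sub_cancel] at this
      refine (ENNReal.tsum_le_tsum this).trans_eq ?_
      rw [ENNReal.tsum_mul_left, ENNReal.tsum_add, shift k (fun l => ENNReal.ofReal (G l)), ← hS,
        ENNReal.ofReal_mul (by norm_num), ENNReal.ofReal_ofNat]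
      ring
    have hq : ∑' l, q l ^ 2 = ∑' l, (ENNReal.ofReal (A l) * f l ^ 2) *
        (ENNReal.ofReal (B (k - l)) * g (k - l) ^ 2) := by
      refine tsum_congr fun l => ?_
      have hAB : 0 < A l * B (k - l) := mul_pos (hA _) (hB _)
      simp only [q]
      rw [mul_pow, ← ENNReal.ofReal_pow (Real.sqrt_nonneg _), Real.sq_sqrt hAB.le,
        ENNReal.ofReal_mul (hA _).le]
      ring
    calc ENNReal.ofReal (w k) * cv f g k ^ 2
        = (ENNReal.ofReal (Real.sqrt (w k)) * cv f g k) ^ 2 := by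
          rw [mul_pow, ← ENNReal.ofReal_pow (Real.sqrt_nonneg _), Real.sq_sqrt (hw k)]
      _ ≤ (∑' l, p l ^ 2) * ∑' l, q l ^ 2 := by rw [hpq]; exact tsum_mul_sq_le p q
      _ ≤ _ := by rw [hq]; gcongr
  refine (ENNReal.tsum_le_tsum key).trans_eq ?_
  rw [ENNReal.tsum_mul_left, ENNReal.tsum_comm]
  congr 1
  rw [← ENNReal.tsum_mul_right]
  refine tsum_congr fun l => ?_
  rw [ENNReal.tsum_mul_left]
  congr 1
  exact (Equiv.subRight l).tsum_eq fun m => ENNReal.ofReal (B m) * g m ^ 2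

/-- The larger of the two frequencies carries the r derivatives, since `om (l + m)` is at most four
times the larger weight. Its spare power, s - r or a - r, is nonnegative and is handed over to the
smaller frequency, which collects the total decay a + s - r. -/
lemma om_rpow_add_le {a s r : ℝ} (hr : 0 ≤ r) (ha : r ≤ a) (hs : r ≤ s) (l m : Fin 2 → ℤ) :
    om (l + m) ^ r ≤ 4 ^ r * (om l ^ (-(a + s - r)) + om m ^ (-(a + s - r))) *
      (om l ^ a * om m ^ s) := by
  have hl := one_le_om l
  have hm := one_le_om m
  have hl0 := om_pos l
  have hm0 := om_pos m
  have hadd := om_add_le l m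
  rw [mul_assoc]
  rcases le_total (om l) (om m) with h | h
  · calc om (l + m) ^ r ≤ (4 * om m) ^ r :=
          Real.rpow_le_rpow (om_pos _).le (by linarith) hr
      _ = 4 ^ r * om m ^ r := Real.mul_rpow (by norm_num) hm0.le
      _ ≤ 4 ^ r * (om l ^ (-(a + s - r)) * (om l ^ a * om m ^ s)) := by
          gcongr
          rw [← mul_assoc, ← Real.rpow_add hl0,
            show -(a + s - r) + a = -(s - r) by ring]
          calc om m ^ r = om m ^ (-(s - r)) * om m ^ s := by
                rw [← Real.rpow_add hm0]; congr 1; ring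
            _ ≤ _ := by
              gcongr ?_ * _
              exact Real.rpow_le_rpow_of_nonpos hl0 h (by linarith)
      _ ≤ _ := by
          gcongr
          exact le_add_of_nonneg_right (Real.rpow_nonneg hm0.le _)
  · calc om (l + m) ^ r ≤ (4 * om l) ^ r :=
          Real.rpow_le_rpow (om_pos _).le (by linarith) hr
      _ = 4 ^ r * om l ^ r := Real.mul_rpow (by norm_num) hl0.le
      _ ≤ 4 ^ r * (om m ^ (-(a + s - r)) * (om l ^ a * om m ^ s)) := by
          gcongr
          rw [mul_left_comm, ← Real.rpow_add hm0,
            show -(a + s - r) + s = -(a - r) by ring]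
          calc om l ^ r = om l ^ a * om l ^ (-(a - r)) := by
                rw [← Real.rpow_add hl0]; congr 1; ring
            _ ≤ _ := by
              gcongr _ * ?_
              exact Real.rpow_le_rpow_of_nonpos hm0 h (by linarith)
      _ ≤ _ := by
          gcongr
          exact le_add_of_nonneg_left (Real.rpow_nonneg hl0.le _)

/-- The product estimate `H^a · H^s ⊂ H^r`, for convolutions of coefficients. -/
theorem exists_hR_cv_le {a s r : ℝ} (hr : 0 ≤ r) (ha : r ≤ a) (hs : r ≤ s)
    (h : 1 < a + s - r) : ∃ C : ℝ≥0, 1 ≤ C ∧ ∀ f g, hR r (cv f g) ≤ C * (hR a f * hR s g) := by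
  have hsum := summable_om_rpow h
  have hne : ENNReal.ofReal (2 * 4 ^ r) * ∑' k, ENNReal.ofReal (om k ^ (-(a + s - r))) ≠ ∞ :=
    ENNReal.mul_ne_top ENNReal.ofReal_ne_top hsum.tsum_ofReal_ne_top
  refine ⟨max 1 (ENNReal.toNNReal (ENNReal.ofReal (2 * 4 ^ r) *
    ∑' k, ENNReal.ofReal (om k ^ (-(a + s - r))))), le_max_left _ _, fun f g => ?_⟩
  have := tsum_weight_mul_cv_sq_le (w := fun k => om k ^ r) (A := fun k => om k ^ a)
    (B := fun k => om k ^ s) (G := fun k => om k ^ (-(a + s - r))) (c := 4 ^ r) (by positivity)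
    (fun k => Real.rpow_nonneg (om_pos k).le _) (fun k => Real.rpow_pos_of_pos (om_pos k) _)
    (fun k => Real.rpow_pos_of_pos (om_pos k) _) (fun k => Real.rpow_nonneg (om_pos k).le _)
    (om_rpow_add_le hr ha hs) f g
  refine this.trans ?_
  change _ ≤ _ * ((∑' k, _) * ∑' k, _)
  gcongr
  rw [ENNReal.coe_max, ENNReal.coe_toNNReal hne]
  exact le_max_right _ _

/-! ## The embedding of `H¹` into the Lebesgue spaces -/

lemma memLp_continuousMap (P : C(T2, ℂ)) (p : ℝ≥0∞) : MemLp P p dx :=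
  P.continuous.memLp_of_hasCompactSupport (HasCompactSupport.of_compactSpace P)

lemma fcC_mFourier (l k : Fin 2 → ℤ) :
    fcC (UnitAddTorus.mFourier l) k = if k = l then 1 else 0 := by
  have h := UnitAddTorus.mFourierBasis_repr (UnitAddTorus.mFourierLp 2 l) k
  have h2 := UnitAddTorus.mFourierCoeff_toLp (UnitAddTorus.mFourier l) k
  have h3 : fcC (UnitAddTorus.mFourier l) k =
      UnitAddTorus.mFourierBasis.repr (UnitAddTorus.mFourierLp 2 l) k := (h.trans h2).symm
  rw [h3, ← UnitAddTorus.coe_mFourierBasis, HilbertBasis.repr_self, lp.single_apply,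
    Pi.single_apply]

/-- The trigonometric polynomial with the coefficients `a` on the finite set `S`. -/
def trigPoly (S : Finset (Fin 2 → ℤ)) (a : Coeffs) : C(T2, ℂ) :=
  ∑ k ∈ S, a k • UnitAddTorus.mFourier k

lemma fcC_trigPoly (S : Finset (Fin 2 → ℤ)) (a : Coeffs) (k : Fin 2 → ℤ) :
    fcC (trigPoly S a) k = if k ∈ S then a k else 0 := by
  have h : fcC (trigPoly S a) k = ∑ l ∈ S, a l * fcC (UnitAddTorus.mFourier l) k := by
    simp only [fcC_eq, ← integral_const_mul]
    rw [← integral_finsetSum]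
    · refine integral_congr_ae (Eventually.of_forall fun x => ?_)
      simp only [trigPoly, ContinuousMap.coe_sum, Finset.sum_apply, ContinuousMap.coe_smul,
        Pi.smul_apply, smul_eq_mul, Finset.mul_sum]
      refine Finset.sum_congr rfl fun l _ => ?_
      ring
    · intro l _
      exact (integrable_mFourier_mul
        ((memLp_continuousMap (UnitAddTorus.mFourier l) 1).integrable le_rfl) _).const_mul _
  rw [h]
  simp [fcC_mFourier]

/-- Each multiplication by P is allowed to lower the order by 1/n, which is exactly the margin by
which the product estimate then exceeds its threshold. After n - 1 multiplications the order is 1/n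
≥ 0. -/
lemma exists_hR_pow_le {n : ℕ} (hn : 1 ≤ n) : ∃ C : ℝ≥0, ∀ P : C(T2, ℂ),
    hR 0 (fun k => ‖fcC (fun x => P x ^ n) k‖ₑ) ≤ C * hR 1 (fun k => ‖fcC P k‖ₑ) ^ n := by
  have hn0 : (0 : ℝ) < n := by exact_mod_cast hn
  have main : ∀ j : ℕ, j + 1 ≤ n → ∃ C : ℝ≥0, ∀ P : C(T2, ℂ),
      hR (1 - j / n) (fun k => ‖fcC (fun x => P x ^ (j + 1)) k‖ₑ)
        ≤ C * hR 1 (fun k => ‖fcC P k‖ₑ) ^ (j + 1) := by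
    intro j
    induction j with
    | zero =>
      intro _
      refine ⟨1, fun P => ?_⟩
      simp
    | succ j ih =>
      intro hj
      obtain ⟨C, hC⟩ := ih (by omega)
      have hj' : ((j : ℝ) + 1 + 1) ≤ n := by exact_mod_cast hj
      have e : (1 : ℝ) - ((j + 1 : ℕ) : ℝ) / n = 1 - j / n - 1 / n := by push_cast; ring
      have hd : 0 < 1 / (n : ℝ) := by positivity
      have hr : (0 : ℝ) ≤ 1 - ((j + 1 : ℕ) : ℝ) / n := by
        rw [sub_nonneg, div_le_one hn0]; push_cast; linarith
      have hj0 : 0 ≤ (j : ℝ) / n := by positivity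
      obtain ⟨C', -, hC'⟩ := exists_hR_cv_le (a := 1) (s := 1 - j / n)
        (r := 1 - ((j + 1 : ℕ) : ℝ) / n) hr (by rw [e]; linarith) (by rw [e]; linarith)
        (by rw [e]; linarith)
      refine ⟨C' * C, fun P => ?_⟩
      have h1 : ∀ k, ‖fcC (fun x => P x ^ (j + 1 + 1)) k‖ₑ ≤
          cv (fun k => ‖fcC P k‖ₑ) (fun k => ‖fcC (fun x => P x ^ (j + 1)) k‖ₑ) k := by
        intro k
        have := enorm_fcC_mul_le (memLp_continuousMap P 2) (memLp_continuousMap (P ^ (j + 1)) 2) k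
        simp only [ContinuousMap.coe_pow, Pi.pow_apply, ← pow_succ'] at this
        exact this
      calc _ ≤ _ := hR_mono h1
        _ ≤ C' * (hR 1 (fun k => ‖fcC P k‖ₑ) * (C * hR 1 (fun k => ‖fcC P k‖ₑ) ^ (j + 1))) := by
          refine (hC' _ _).trans ?_
          gcongr
          exact hC P
        _ = _ := by push_cast; ring
  obtain ⟨C, hC⟩ := main (n - 1) (by omega)
  refine ⟨C, fun P => ?_⟩
  have h := hC P
  rw [Nat.sub_add_cancel hn] at h
  refine (hR_mono_exponent ?_ _).trans h
  rw [sub_nonneg, div_le_one hn0]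
  exact_mod_cast Nat.sub_le n 1

/-- `H¹ ⊂ L^{2n}`. -/
theorem exists_lintegral_pow_le {n : ℕ} (hn : 1 ≤ n) : ∃ C : ℝ≥0, ∀ f : L2,
    ∫⁻ x, ‖f x‖ₑ ^ (2 * n) ∂dx ≤ C * sSq 1 f ^ n := by
  obtain ⟨C, hC⟩ := exists_hR_pow_le hn
  refine ⟨C, fun f => ?_⟩
  set F : Lp ℂ 2 dx := (memLp_ofReal f).toLp _ with hF
  have hFf : F =ᵐ[dx] fun x => (f x : ℂ) := (memLp_ofReal f).coeFn_toLp
  have hFc : ∀ k, UnitAddTorus.mFourierCoeff (F : T2 → ℂ) k = fc f k :=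
    fun k => congrFun (fcC_congr hFf) k
  have hs := UnitAddTorus.hasSum_mFourier_series_L2 (d := Fin 2) F
  simp only [hFc] at hs
  obtain ⟨S, hS⟩ := exists_seq_tendsto (atTop : Filter (Finset (Fin 2 → ℤ)))
  have hlim : Tendsto (fun i => ((memLp_continuousMap (trigPoly (S i) (fc f)) 2).toLp _ :
      Lp ℂ 2 dx)) atTop (𝓝 F) := by
    have h2 : Tendsto _ atTop (𝓝 F) := hs.comp hS
    refine h2.congr fun i => ?_
    simp only [Function.comp]
    have e : (ContinuousMap.toLp (E := ℂ) 2 dx ℂ (trigPoly (S i) (fc f)))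
        = ∑ k ∈ S i, fc f k • UnitAddTorus.mFourierLp 2 k := by
      simp only [trigPoly, map_sum, map_smul]
      rfl
    rw [← e]
    rfl
  -- The Fourier series converges almost everywhere along a subsequence; the bound for trigonometric
  -- polynomials then passes to f by Fatou.
  have hmeas := (tendstoInMeasure_of_tendsto_Lp hlim)
  obtain ⟨ns, -, hns⟩ := hmeas.exists_seq_tendsto_ae
  have hae : ∀ᵐ x ∂dx, Tendsto (fun i => trigPoly (S (ns i)) (fc f) x) atTop (𝓝 (f x : ℂ)) := by
    have h3 : ∀ᵐ x ∂dx, ∀ i, ((memLp_continuousMap (trigPoly (S i) (fc f)) 2).toLp _ :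
        Lp ℂ 2 dx) x = trigPoly (S i) (fc f) x :=
      ae_all_iff.2 fun i => MemLp.coeFn_toLp _
    filter_upwards [hns, h3, hFf] with x h1 h2 h4
    rw [← h4]
    exact h1.congr fun i => h2 _
  have hbound : ∀ i, ∫⁻ x, ‖trigPoly (S (ns i)) (fc f) x‖ₑ ^ (2 * n) ∂dx ≤ C * sSq 1 f ^ n := by
    intro i
    set P := trigPoly (S (ns i)) (fc f) with hP
    calc ∫⁻ x, ‖P x‖ₑ ^ (2 * n) ∂dx = ∫⁻ x, ‖P x ^ n‖ₑ ^ 2 ∂dx := by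
          refine lintegral_congr fun x => ?_
          rw [enorm_pow, ← pow_mul, mul_comm]
      _ = hR 0 (fun k => ‖fcC (fun x => P x ^ n) k‖ₑ) := by
          refine (tsum_enorm_fcC_sq (memLp_continuousMap (P ^ n) 2)).symm.trans ?_
          refine tsum_congr fun k => ?_
          rw [Real.rpow_zero, ENNReal.ofReal_one, one_mul]
          rfl
      _ ≤ C * hR 1 (fun k => ‖fcC P k‖ₑ) ^ n := hC P
      _ ≤ _ := by
          rw [sSq, hSq_eq_hR]
          gcongr
          refine (hR_mono (b := fun k => ‖fc f k‖ₑ) fun k => ?_).trans_eq (by norm_num)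
          rw [hP, fcC_trigPoly]
          split_ifs <;> simp
  calc ∫⁻ x, ‖f x‖ₑ ^ (2 * n) ∂dx
      = ∫⁻ x, liminf (fun i => ‖trigPoly (S (ns i)) (fc f) x‖ₑ ^ (2 * n)) atTop ∂dx := by
        refine lintegral_congr_ae ?_
        filter_upwards [hae] with x hx
        have h5 := ((ENNReal.continuous_pow (2 * n)).tendsto _).comp
          ((continuous_enorm.tendsto _).comp hx)
        have h6 : ‖(f x : ℂ)‖ₑ = ‖f x‖ₑ := by
          rw [← ofReal_norm, ← ofReal_norm, Complex.norm_real]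
        rw [h6] at h5
        exact h5.liminf_eq.symm
    _ ≤ liminf (fun i => ∫⁻ x, ‖trigPoly (S (ns i)) (fc f) x‖ₑ ^ (2 * n) ∂dx) atTop :=
        lintegral_liminf_le fun i =>
          ((trigPoly (S (ns i)) (fc f)).continuous.measurable.enorm.pow_const _)
    _ ≤ C * sSq 1 f ^ n := by
        refine (liminf_le_liminf (Eventually.of_forall hbound)).trans_eq ?_
        exact liminf_const _

/-- `H¹ ⊂ L^{2q}`. -/
theorem exists_lintegral_rpow_le {q : ℝ} (hq : 1 ≤ q) : ∃ C : ℝ≥0, ∀ f : L2,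
    ∫⁻ x, (‖f x‖ₑ ^ q) ^ 2 ∂dx ≤ C * sSq 1 f ^ q := by
  have hq0 : 0 < q := by linarith
  set n := ⌈q⌉₊ with hn
  have hn1 : 1 ≤ n := Nat.one_le_ceil_iff.2 hq0
  have hn0 : (0 : ℝ) < n := by exact_mod_cast hn1
  obtain ⟨C, hC⟩ := exists_lintegral_pow_le hn1
  refine ⟨C ^ (q / n), fun f => ?_⟩
  -- The torus has mass one, so the L^(2q) norm is at most the L^(2n) norm for the integer n = ⌈q⌉.
  have h1 := eLpNorm'_le_eLpNorm'_of_exponent_le (μ := dx) (f := f) (p := 2 * q) (q := 2 * n)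
    (by linarith) (by have := Nat.le_ceil q; linarith) (Lp.aestronglyMeasurable f)
  unfold eLpNorm' at h1
  have h2 := ENNReal.rpow_le_rpow h1 (z := 2 * q) (by linarith)
  rw [← ENNReal.rpow_mul, ← ENNReal.rpow_mul, one_div_mul_cancel (by positivity),
    ENNReal.rpow_one, show 1 / (2 * (n : ℝ)) * (2 * q) = q / n by field_simp] at h2
  calc ∫⁻ x, (‖f x‖ₑ ^ q) ^ 2 ∂dx = ∫⁻ x, ‖f x‖ₑ ^ (2 * q) ∂dx := by
        refine lintegral_congr fun x => ?_
        rw [← ENNReal.rpow_natCast, ← ENNReal.rpow_mul]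
        congr 1
        push_cast; ring
    _ ≤ (∫⁻ x, ‖f x‖ₑ ^ (2 * (n : ℝ)) ∂dx) ^ (q / n) := h2
    _ = (∫⁻ x, ‖f x‖ₑ ^ (2 * n) ∂dx) ^ (q / n) := by
        congr 1
        refine lintegral_congr fun x => ?_
        rw [← ENNReal.rpow_natCast]
        congr 1
        push_cast; ring
    _ ≤ (C * sSq 1 f ^ n) ^ (q / n) := ENNReal.rpow_le_rpow (hC f) (by positivity)
    _ = _ := by
        rw [ENNReal.mul_rpow_of_nonneg _ _ (by positivity), ← ENNReal.rpow_natCast,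
          ← ENNReal.rpow_mul, mul_div_cancel₀ _ hn0.ne', ENNReal.coe_rpow_of_nonneg _ (by positivity)]

/-! ## Sobolev norms of fields, derivatives and products -/

lemma hSq_add_le (s : ℤ) (a b : Coeffs) : hSq s (fun k => a k + b k) ≤ 2 * (hSq s a + hSq s b) := by
  simp only [hSq_eq_hR]
  exact (hR_mono fun k => enorm_add_le _ _).trans (hR_add_le _ _ _)

lemma hSq_sub_le (s : ℤ) (a b : Coeffs) : hSq s (fun k => a k - b k) ≤ 2 * (hSq s a + hSq s b) := by
  simp only [hSq_eq_hR]
  exact (hR_mono fun k => enorm_sub_le).trans (hR_add_le _ _ _)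

lemma hSq_mono_exponent {s t : ℤ} (h : s ≤ t) (a : Coeffs) : hSq s a ≤ hSq t a := by
  simp only [hSq_eq_hR]
  exact hR_mono_exponent (by exact_mod_cast h) _

lemma sSq_mono_exponent {s t : ℤ} (h : s ≤ t) (f : L2) : sSq s f ≤ sSq t f :=
  hSq_mono_exponent h _

lemma vSq_mono_exponent {s t : ℤ} (h : s ≤ t) (f : VF) : vSq s f ≤ vSq t f :=
  Finset.sum_le_sum fun _ _ => sSq_mono_exponent h _

lemma sSq_le_vSq (s : ℤ) (v : VF) (j : Fin 2) : sSq s (v j) ≤ vSq s v :=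
  Finset.single_le_sum (f := fun j => sSq s (v j)) (fun _ _ => zero_le) (Finset.mem_univ j)

lemma hSq_const_mul (s : ℤ) (c : ℂ) (a : Coeffs) :
    hSq s (fun k => c * a k) = ‖c‖ₑ ^ 2 * hSq s a := by
  simp only [hSq_eq_hR, enorm_mul]
  exact hR_const_mul _ _ _

lemma fc_L2_sub' (f g : L2) : fc ⇑(f - g) = fun k => fc f k - fc g k := funext (fc_L2_sub f g)

lemma fc_L2_add' (f g : L2) : fc ⇑(f + g) = fun k => fc f k + fc g k := funext (fc_L2_add f g)

lemma sSq_add_le (s : ℤ) (f g : L2) : sSq s (f + g) ≤ 2 * (sSq s f + sSq s g) := by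
  unfold sSq; rw [fc_L2_add']; exact hSq_add_le s _ _

lemma sSq_sub_le (s : ℤ) (f g : L2) : sSq s (f - g) ≤ 2 * (sSq s f + sSq s g) := by
  unfold sSq; rw [fc_L2_sub']; exact hSq_sub_le s _ _

lemma sSq_sub_comm (s : ℤ) (f g : L2) : sSq s (f - g) = sSq s (g - f) := by
  simp only [sSq, hSq_eq_hR, fc_L2_sub]
  congr 1
  funext k
  rw [enorm_sub_rev]

lemma sSq_sub_lt_top {s : ℤ} {f g : L2} (hf : sSq s f < ∞) (hg : sSq s g < ∞) :
    sSq s (f - g) < ∞ :=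
  (sSq_sub_le s f g).trans_lt
    (ENNReal.mul_lt_top (by simp) (ENNReal.add_lt_top.2 ⟨hf, hg⟩))

/-- Minkowski in weighted ℓ². The sharp constant matters: `continuousOn_sSq` derives from it the
continuity of the norm in time, which the factor 2 of `sSq_add_le` would not give. -/
lemma sSq_add_rpow_le (s : ℤ) (f g : L2) :
    sSq s (f + g) ^ (1 / 2 : ℝ) ≤ sSq s f ^ (1 / 2 : ℝ) + sSq s g ^ (1 / 2 : ℝ) := by
  have hR_eq : ∀ a : (Fin 2 → ℤ) → ℝ≥0∞, hR s a =
      ∑' k, (ENNReal.ofReal (om k ^ ((s : ℝ) / 2)) * a k) ^ (2 : ℝ) := by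
    intro a
    refine tsum_congr fun k => ?_
    rw [ENNReal.mul_rpow_of_nonneg _ _ (by norm_num), ENNReal.ofReal_rpow_of_nonneg
      (Real.rpow_nonneg (om_pos k).le _) (by norm_num), ← Real.rpow_mul (om_pos k).le,
      div_mul_cancel₀ _ (by norm_num)]
    norm_num
  let _ : MeasurableSpace (Fin 2 → ℤ) := ⊤
  have h := ENNReal.lintegral_Lp_add_le (μ := Measure.count)
    (f := fun k => ENNReal.ofReal (om k ^ ((s : ℝ) / 2)) * ‖fc f k‖ₑ)
    (g := fun k => ENNReal.ofReal (om k ^ ((s : ℝ) / 2)) * ‖fc g k‖ₑ)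
    (measurable_from_top.aemeasurable) (measurable_from_top.aemeasurable) (p := 2) (by norm_num)
  simp only [lintegral_count, Pi.add_apply, ← mul_add] at h
  rw [← hR_eq (fun k => ‖fc f k‖ₑ), ← hR_eq (fun k => ‖fc g k‖ₑ),
    ← hR_eq (fun k => ‖fc f k‖ₑ + ‖fc g k‖ₑ)] at h
  simp only [sSq, hSq_eq_hR]
  refine (ENNReal.rpow_le_rpow (hR_mono fun k => ?_) (by norm_num)).trans h
  rw [fc_L2_add]
  exact enorm_add_le _ _

lemma continuousOn_sSq {s : ℤ} {T : ℝ} {f : ℝ → L2} (h : ContH s T f) :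
    ContinuousOn (fun t => sSq s (f t)) (Icc 0 T) := by
  have key : ContinuousOn (fun t => sSq s (f t) ^ (1 / 2 : ℝ)) (Icc 0 T) := by
    intro t₀ ht₀
    have hd : Tendsto (fun t => sSq s (f t - f t₀) ^ (1 / 2 : ℝ)) (𝓝[Icc 0 T] t₀) (𝓝 0) := by
      have := (ENNReal.continuous_rpow_const (y := 1 / 2)).tendsto 0
      rw [ENNReal.zero_rpow_of_pos (by norm_num)] at this
      exact this.comp (h.2 t₀ ht₀)
    have hfin : sSq s (f t₀) ^ (1 / 2 : ℝ) ≠ ∞ :=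
      ENNReal.rpow_ne_top_of_nonneg (by norm_num) (h.1 t₀ ht₀).ne
    refine ENNReal.tendsto_nhds_of_Icc fun e he => ?_
    filter_upwards [(ENNReal.tendsto_nhds_zero.1 hd) e he] with t ht
    constructor
    · rw [tsub_le_iff_right]
      have := sSq_add_rpow_le s (f t) (f t₀ - f t)
      rw [add_sub_cancel, sSq_sub_comm] at this
      exact this.trans (by gcongr)
    · have := sSq_add_rpow_le s (f t₀) (f t - f t₀)
      rw [add_sub_cancel] at this
      exact this.trans (by gcongr)
  have h2 := (ENNReal.continuous_rpow_const (y := 2)).comp_continuousOn key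
  refine h2.congr fun t _ => ?_
  simp only [Function.comp]
  rw [← ENNReal.rpow_mul]
  norm_num

lemma ContH.sub {s : ℤ} {T : ℝ} {f g : ℝ → L2} (hf : ContH s T f) (hg : ContH s T g) :
    ContH s T (fun t => f t - g t) := by
  refine ⟨fun t ht => sSq_sub_lt_top (hf.1 t ht) (hg.1 t ht), fun t₀ ht₀ => ?_⟩
  have h := ENNReal.Tendsto.const_mul (a := 2) ((hf.2 t₀ ht₀).add (hg.2 t₀ ht₀)) (Or.inr (by simp))
  rw [add_zero, mul_zero] at h
  refine tendsto_of_tendsto_of_tendsto_of_le_of_le tendsto_const_nhds h (fun _ => zero_le)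
    fun t => ?_
  have e : f t - g t - (f t₀ - g t₀) = (f t - f t₀) - (g t - g t₀) := by abel
  simp only [e]
  exact sSq_sub_le _ _ _

/-! ### Weak derivatives -/

lemma norm_two_pi_mul_sq_le (j : Fin 2) (k : Fin 2 → ℤ) :
    ‖2 * Real.pi * Complex.I * (k j : ℂ)‖ ^ 2 ≤ om k := by
  have h : ‖2 * Real.pi * Complex.I * (k j : ℂ)‖ ^ 2 = 4 * Real.pi ^ 2 * (k j : ℝ) ^ 2 := by
    simp only [norm_mul, Complex.norm_I, mul_one, Complex.norm_real, Complex.norm_intCast,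
      Complex.norm_ofNat, mul_pow, Real.norm_eq_abs, sq_abs]
    norm_num
  rw [h]
  have h1 : (k j : ℝ) ^ 2 ≤ (k 0 : ℝ) ^ 2 + (k 1 : ℝ) ^ 2 := by
    fin_cases j
    · exact le_add_of_nonneg_right (sq_nonneg _)
    · exact le_add_of_nonneg_left (sq_nonneg _)
  have h2 := mul_le_mul_of_nonneg_left h1 (by positivity : (0 : ℝ) ≤ 4 * Real.pi ^ 2)
  unfold om lam
  linarith

lemma hSq_deriv_le (s : ℤ) (j : Fin 2) (a : Coeffs) :
    hSq s (fun k => 2 * Real.pi * Complex.I * (k j : ℂ) * a k) ≤ hSq (s + 1) a := by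
  refine ENNReal.tsum_le_tsum fun k => ENNReal.ofReal_le_ofReal ?_
  rw [norm_mul, mul_pow]
  change om k ^ s * _ ≤ om k ^ (s + 1) * _
  rw [zpow_add₀ (om_pos k).ne', zpow_one, mul_assoc (om k ^ s)]
  exact mul_le_mul_of_nonneg_left
    (mul_le_mul_of_nonneg_right (norm_two_pi_mul_sq_le j k) (sq_nonneg _))
    (zpow_nonneg (om_pos k).le s)

/-- The multiplier 2πi k_j is odd and purely imaginary, so it preserves conjugate symmetry and the
derivative is a real field. Without a weak derivative in L², `pd` takes the default value 0; hence
the finiteness hypotheses in what follows. -/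
lemma isPartial_pd {f : L2} (hf : sSq 1 f < ∞) (j : Fin 2) : IsPartial j f (pd j f) := by
  have hex : ∃ g : L2, IsPartial j f g := by
    refine exists_fc_eq (a := fun k => 2 * Real.pi * Complex.I * (k j : ℂ) * fc f k) ?_ ?_
    · have h := (hSq_deriv_le 0 j (fc f)).trans_lt hf
      rw [hSq_eq_hR] at h
      simpa [hR] using h.ne
    · intro k
      rw [fc_neg_eq_conj]
      simp only [map_mul, Complex.conj_ofReal, Complex.conj_I, Pi.neg_apply, Int.cast_neg,
        map_ofNat, map_intCast]
      ring
  unfold pd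
  rw [dif_pos hex]
  exact hex.choose_spec

lemma sSq_pd_le {f : L2} (hf : sSq 1 f < ∞) (s : ℤ) (j : Fin 2) :
    sSq s (pd j f) ≤ sSq (s + 1) f := by
  unfold sSq
  rw [show fc (pd j f) = _ from funext (isPartial_pd hf j)]
  exact hSq_deriv_le s j _

lemma pd_sub {f g : L2} (hf : sSq 1 f < ∞) (hg : sSq 1 g < ∞) (j : Fin 2) :
    pd j (f - g) = pd j f - pd j g := by
  refine L2_ext_fc fun k => ?_
  rw [isPartial_pd (sSq_sub_lt_top hf hg) j k, fc_L2_sub, fc_L2_sub, isPartial_pd hf j k,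
    isPartial_pd hg j k]
  ring

/-! ### The advection term -/

lemma fc_adv (v : VF) (f : L2) (k : Fin 2 → ℤ) :
    fc (adv v f) k = fc (fun x => v 0 x * pd 0 f x) k + fc (fun x => v 1 x * pd 1 f x) k := by
  rw [← fc_add (integrable_mul_L2 _ _) (integrable_mul_L2 _ _)]
  refine congrFun (congrArg fc (funext fun x => ?_)) k
  exact Fin.sum_univ_two _

lemma fc_mul_sub (u U f F : L2) (k : Fin 2 → ℤ) :
    fc (fun x => U x * F x) k - fc (fun x => u x * f x) k =
      fc (fun x => (U - u : L2) x * F x) k + fc (fun x => u x * (F - f : L2) x) k := by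
  rw [← fc_sub (integrable_mul_L2 _ _) (integrable_mul_L2 _ _),
    ← fc_add (integrable_mul_L2 _ _) (integrable_mul_L2 _ _)]
  refine congrFun (fc_congr ?_) k
  filter_upwards [Lp.coeFn_sub U u, Lp.coeFn_sub F f] with x h1 h2
  rw [h1, h2]
  simp only [Pi.sub_apply]
  ring

/-- The split is chosen so that the factors accompanying the differences are F and u; no size of f
enters the later estimates. -/
lemma fc_adv_sub (u U : VF) {f F : L2} (hf : sSq 1 f < ∞) (hF : sSq 1 F < ∞) (k : Fin 2 → ℤ) :
    fc (adv U F) k - fc (adv u f) k = fc (adv (U - u) F) k + fc (adv u (F - f)) k := by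
  simp only [fc_adv, pd_sub hF hf]
  have h0 := fc_mul_sub (u 0) (U 0) (pd 0 f) (pd 0 F) k
  have h1 := fc_mul_sub (u 1) (U 1) (pd 1 f) (pd 1 F) k
  rw [show (U - u) 0 = U 0 - u 0 from rfl, show (U - u) 1 = U 1 - u 1 from rfl]
  linear_combination h0 + h1

/-- The product estimate `H^a · H^s ⊂ H^r`. -/
lemma exists_hSq_fc_mul_le {a s r : ℤ} (hr : 0 ≤ r) (ha : r ≤ a) (hs : r ≤ s)
    (h : 1 < a + s - r) : ∃ C : ℝ≥0, 1 ≤ C ∧ ∀ f g : L2,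
      hSq r (fc (fun x => f x * g x)) ≤ C * (sSq a f * sSq s g) := by
  obtain ⟨C, h1, hC⟩ := exists_hR_cv_le (a := a) (s := s) (r := r) (by exact_mod_cast hr)
    (by exact_mod_cast ha) (by exact_mod_cast hs) (by exact_mod_cast h)
  refine ⟨C, h1, fun f g => ?_⟩
  simp only [sSq, hSq_eq_hR]
  exact (hR_mono (enorm_fc_mul_le f g)).trans (hC _ _)

/-- H² is a multiplier space of H^s because 2 lies above the threshold 1; the gradient costs one
order. The case s = 1 serves the velocity and magnetic equations, s = 0 the temperature. -/
lemma exists_hSq_fc_adv_le {s : ℤ} (h0 : 0 ≤ s) (h1 : s ≤ 1) : ∃ C : ℝ≥0, 1 ≤ C ∧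
    ∀ (v : VF) (f : L2), sSq 1 f < ∞ →
      hSq s (fc (adv v f)) ≤ C * (vSq 2 v * sSq (s + 1) f) := by
  obtain ⟨C, hC1, hC⟩ := exists_hSq_fc_mul_le (a := 2) (s := s) (r := s) h0 (by omega) le_rfl
    (by omega)
  refine ⟨2 * C, by nlinarith, fun v f hf => ?_⟩
  rw [show fc (adv v f) = _ from funext (fc_adv v f)]
  have h : ∀ j, hSq s (fc (fun x => v j x * pd j f x)) ≤ C * (sSq 2 (v j) * sSq (s + 1) f) :=
    fun j => (hC _ _).trans (by gcongr; exact sSq_pd_le hf s j)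
  refine (hSq_add_le s _ _).trans ?_
  refine (mul_le_mul_right (add_le_add (h 0) (h 1)) _).trans_eq ?_
  rw [vSq, Fin.sum_univ_two]
  push_cast
  ring

/-! ### The Leray projection -/

lemma leray_sub (a b : Fin 2 → Coeffs) (j : Fin 2) (k : Fin 2 → ℤ) :
    leray a j k - leray b j k = leray (fun i k => a i k - b i k) j k := by
  unfold leray
  split_ifs
  · simp
  · simp only [mul_sub, Finset.sum_sub_distrib]
    ring

/-- Both |k_i|² and |k_j|² are at most |k|², hence so is |k_i k_j|. This makes the Leray symbol
bounded. -/
lemma norm_mul_div_sq_le (k : Fin 2 → ℤ) (hk : k ≠ 0) (i j : Fin 2) :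
    ‖(k j : ℂ) * (k i : ℂ) / ∑ i, (k i : ℂ) ^ 2‖ ≤ 1 := by
  have e : (∑ i, (k i : ℂ) ^ 2) = ((∑ i, (k i : ℝ) ^ 2 : ℝ) : ℂ) := by push_cast; rfl
  have hpos : 0 < ∑ i, (k i : ℝ) ^ 2 := by
    obtain ⟨i, hi⟩ := Function.ne_iff.1 hk
    refine Finset.sum_pos' (fun _ _ => sq_nonneg _) ⟨i, Finset.mem_univ _, ?_⟩
    have : (k i : ℝ) ≠ 0 := by exact_mod_cast hi
    positivity
  rw [e, norm_div, norm_mul, Complex.norm_real, Complex.norm_intCast, Complex.norm_intCast,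
    Real.norm_of_nonneg hpos.le, div_le_one hpos]
  have hle : ∀ i, |(k i : ℝ)| ^ 2 ≤ ∑ i, (k i : ℝ) ^ 2 := fun i => by
    rw [sq_abs]
    exact Finset.single_le_sum (f := fun i => (k i : ℝ) ^ 2) (fun _ _ => sq_nonneg _)
      (Finset.mem_univ i)
  nlinarith [hle i, hle j, sq_nonneg (|(k i : ℝ)| - |(k j : ℝ)|)]

lemma enorm_leray_le (a : Fin 2 → Coeffs) (j : Fin 2) (k : Fin 2 → ℤ) :
    ‖leray a j k‖ₑ ≤ 2 * (‖a 0 k‖ₑ + ‖a 1 k‖ₑ) := by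
  unfold leray
  split_ifs with hk
  · simp
  · have h : ∀ i, ‖(k j : ℂ) * (k i : ℂ) / (∑ i, (k i : ℂ) ^ 2) * a i k‖ₑ ≤ ‖a i k‖ₑ := by
      intro i
      rw [enorm_mul]
      refine mul_le_of_le_one_left zero_le ?_
      rw [← ofReal_norm]
      exact ENNReal.ofReal_le_one.2 (norm_mul_div_sq_le k hk i j)
    have h2 : (k j : ℂ) * (∑ i, (k i : ℂ) * a i k) / (∑ i, (k i : ℂ) ^ 2)
        = (k j : ℂ) * (k 0 : ℂ) / (∑ i, (k i : ℂ) ^ 2) * a 0 k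
          + (k j : ℂ) * (k 1 : ℂ) / (∑ i, (k i : ℂ) ^ 2) * a 1 k := by
      rw [Fin.sum_univ_two (fun i => (k i : ℂ) * a i k)]
      ring
    have h3 : ‖a j k‖ₑ ≤ ‖a 0 k‖ₑ + ‖a 1 k‖ₑ := by
      fin_cases j
      · exact le_self_add
      · exact le_add_self
    calc _ ≤ ‖a j k‖ₑ + ‖(k j : ℂ) * (∑ i, (k i : ℂ) * a i k) / (∑ i, (k i : ℂ) ^ 2)‖ₑ :=
          enorm_sub_le
      _ ≤ (‖a 0 k‖ₑ + ‖a 1 k‖ₑ) + (‖a 0 k‖ₑ + ‖a 1 k‖ₑ) := by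
          gcongr
          rw [h2]
          exact (enorm_add_le _ _).trans (add_le_add (h 0) (h 1))
      _ = _ := by ring

lemma hSq_leray_le (s : ℤ) (a : Fin 2 → Coeffs) (j : Fin 2) :
    hSq s (leray a j) ≤ 8 * (hSq s (a 0) + hSq s (a 1)) := by
  simp only [hSq_eq_hR]
  refine (hR_mono (enorm_leray_le a j)).trans ?_
  rw [hR_const_mul]
  refine (mul_le_mul_right (hR_add_le _ _ _) _).trans_eq ?_
  ring

/-! ## Energy estimates for the Fourier modes -/

/-- As f is only integrable, the chain rule for the squared primitive holds almost everywhere;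
absolute continuity allows it to be integrated. -/
lemma sq_intervalIntegral_eq {f : ℝ → ℝ} {t : ℝ} (hf : IntervalIntegrable f volume 0 t) :
    (∫ τ in (0 : ℝ)..t, f τ) ^ 2 = ∫ τ in (0 : ℝ)..t, 2 * ((∫ s in (0 : ℝ)..τ, f s) * f τ) := by
  have hac := hf.absolutelyContinuousOnInterval_intervalIntegral left_mem_uIcc
  have h := hac.integral_deriv_mul_eq_sub hac
  simp only [intervalIntegral.integral_same, mul_zero, sub_zero] at h
  rw [sq, ← h]
  refine intervalIntegral.integral_congr_ae ?_
  filter_upwards [hf.ae_hasDerivAt_integral] with x hx hxt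
  rw [(hx (uIoc_subset_uIcc hxt) 0 left_mem_uIcc).deriv]
  ring

lemma norm_sq_intervalIntegral_eq {f : ℝ → ℂ} {t : ℝ} (ht : 0 ≤ t)
    (hf : IntervalIntegrable f volume 0 t) :
    ‖∫ τ in (0 : ℝ)..t, f τ‖ ^ 2 =
      ∫ τ in (0 : ℝ)..t, 2 * ((starRingEnd ℂ) (∫ s in (0 : ℝ)..τ, f s) * f τ).re := by
  have hre : IntervalIntegrable (fun τ => (f τ).re) volume 0 t := ⟨hf.1.re, hf.2.re⟩
  have him : IntervalIntegrable (fun τ => (f τ).im) volume 0 t := ⟨hf.1.im, hf.2.im⟩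
  have hsub : ∀ τ ∈ Icc 0 t, IntervalIntegrable f volume 0 τ := fun τ hτ =>
    hf.mono_set (by rw [uIcc_of_le hτ.1, uIcc_of_le ht]; exact Icc_subset_Icc_right hτ.2)
  have cre : ∀ τ ∈ Icc 0 t, (∫ s in (0 : ℝ)..τ, f s).re = ∫ s in (0 : ℝ)..τ, (f s).re :=
    fun τ hτ => (Complex.reCLM.intervalIntegral_comp_comm (hsub τ hτ)).symm
  have cim : ∀ τ ∈ Icc 0 t, (∫ s in (0 : ℝ)..τ, f s).im = ∫ s in (0 : ℝ)..τ, (f s).im :=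
    fun τ hτ => (Complex.imCLM.intervalIntegral_comp_comm (hsub τ hτ)).symm
  have hi : ∀ {g : ℝ → ℝ}, IntervalIntegrable g volume 0 t →
      IntervalIntegrable (fun τ => 2 * ((∫ s in (0 : ℝ)..τ, g s) * g τ)) volume 0 t := by
    intro g hg
    refine IntervalIntegrable.const_mul ?_ 2
    refine hg.continuousOn_mul ?_
    exact intervalIntegral.continuousOn_primitive_interval' hg left_mem_uIcc
  rw [← Complex.normSq_eq_norm_sq, Complex.normSq_apply, ← sq, ← sq,
    cre t (right_mem_Icc.2 ht), cim t (right_mem_Icc.2 ht), sq_intervalIntegral_eq hre,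
    sq_intervalIntegral_eq him, ← intervalIntegral.integral_add (hi hre) (hi him)]
  refine intervalIntegral.integral_congr fun τ hτ => ?_
  rw [uIcc_of_le ht] at hτ
  simp only [Complex.mul_re, Complex.conj_re, Complex.conj_im, cre τ hτ, cim τ hτ]
  ring

lemma two_mul_re_conj_mul_le {δ : ℝ} (hδ : 0 < δ) (a b : ℂ) :
    2 * ((starRingEnd ℂ) a * b).re ≤ δ * ‖a‖ ^ 2 + δ⁻¹ * ‖b‖ ^ 2 := by
  have h1 : ((starRingEnd ℂ) a * b).re ≤ ‖a‖ * ‖b‖ := by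
    refine (Complex.re_le_norm _).trans_eq ?_
    rw [norm_mul, Complex.norm_conj]
  have h2 : 2 * (‖a‖ * ‖b‖) ≤ δ * ‖a‖ ^ 2 + δ⁻¹ * ‖b‖ ^ 2 := by
    have h3 : 0 ≤ δ⁻¹ * (δ * ‖a‖ - ‖b‖) ^ 2 := by positivity
    have h4 : δ⁻¹ * (δ * ‖a‖ - ‖b‖) ^ 2 = δ * ‖a‖ ^ 2 + δ⁻¹ * ‖b‖ ^ 2 - 2 * (‖a‖ * ‖b‖) := by
      field_simp
      ring
    linarith
  linarith

lemma lintegral_enorm_sq_eq {f : ℝ → ℂ} {μ : Measure ℝ} (hf : MemLp f 2 μ) :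
    ∫⁻ τ, ‖f τ‖ₑ ^ 2 ∂μ = ENNReal.ofReal (∫ τ, ‖f τ‖ ^ 2 ∂μ) := by
  rw [ofReal_integral_eq_lintegral_ofReal (hf.integrable_norm_pow (by norm_num))
    (Eventually.of_forall fun _ => sq_nonneg _)]
  refine lintegral_congr fun τ => ?_
  rw [ENNReal.ofReal_pow (norm_nonneg _), ofReal_norm]

/-- `d` is the primitive on `[0,T]`, vanishing at `0`, of the square integrable function `d'`. -/
structure IsMode (T : ℝ) (d d' : ℝ → ℂ) : Prop where
  memLp : MemLp d' 2 (volume.restrict (Ioo 0 T))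
  eq_integral : ∀ t ∈ Icc 0 T, d t = ∫ τ in (0 : ℝ)..t, d' τ

lemma intervalIntegrable_of_memLp {T t : ℝ} (ht : t ∈ Icc 0 T) {f : ℝ → ℂ}
    (hf : MemLp f 2 (volume.restrict (Ioo 0 T))) : IntervalIntegrable f volume 0 t := by
  have h : IntegrableOn f (Ioo 0 T) volume := hf.integrable (by norm_num)
  rw [intervalIntegrable_iff_integrableOn_Ioo_of_le ht.1]
  exact h.mono_set (Ioo_subset_Ioo_right ht.2)

lemma IsMode.continuousOn {T : ℝ} {d d' : ℝ → ℂ} (hT : 0 ≤ T) (h : IsMode T d d') :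
    ContinuousOn d (Icc 0 T) := by
  have h1 := intervalIntegral.continuousOn_primitive_interval'
    (intervalIntegrable_of_memLp (right_mem_Icc.2 hT) h.memLp) left_mem_uIcc
  rw [uIcc_of_le hT] at h1
  exact h1.congr h.eq_integral

lemma IsMode.memLp_self {T : ℝ} {d d' : ℝ → ℂ} (hT : 0 ≤ T) (h : IsMode T d d') :
    MemLp d 2 (volume.restrict (Ioo 0 T)) := by
  have hc := h.continuousOn hT
  obtain ⟨R, hR⟩ := isCompact_Icc.exists_bound_of_continuousOn hc
  refine MemLp.of_bound ((hc.mono Ioo_subset_Icc_self).aestronglyMeasurable measurableSet_Ioo) R ?_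
  filter_upwards [ae_restrict_mem measurableSet_Ioo] with t ht
  exact hR t (Ioo_subset_Icc_self ht)

/-- The energy estimate for one mode. -/
lemma IsMode.energy_le {T : ℝ} {d d' : ℝ → ℂ} (h : IsMode T d d') {c δ p q : ℝ}
    (hδ : 0 < δ) (hp : 0 ≤ p) (hq : 0 ≤ q) (hpq : p ≤ 2 * c - δ + q) {t : ℝ} (ht : t ∈ Icc 0 T) :
    ‖d t‖ₑ ^ 2 + ENNReal.ofReal p * ∫⁻ τ in Ioo 0 t, ‖d τ‖ₑ ^ 2 ≤
      ENNReal.ofReal q * (∫⁻ τ in Ioo 0 t, ‖d τ‖ₑ ^ 2) +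
        ENNReal.ofReal δ⁻¹ * ∫⁻ τ in Ioo 0 t, ‖d' τ + c * d τ‖ₑ ^ 2 := by
  have hT : 0 ≤ T := ht.1.trans ht.2
  have hle : volume.restrict (Ioo 0 t) ≤ volume.restrict (Ioo 0 T) :=
    Measure.restrict_mono (Ioo_subset_Ioo_right ht.2) le_rfl
  have hd : MemLp d 2 (volume.restrict (Ioo 0 t)) := (h.memLp_self hT).mono_measure hle
  have hd' : MemLp d' 2 (volume.restrict (Ioo 0 t)) := h.memLp.mono_measure hle
  have hN : MemLp (fun τ => d' τ + c * d τ) 2 (volume.restrict (Ioo 0 t)) :=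
    hd'.add (hd.const_mul (c : ℂ))
  have hdi := hd.integrable_norm_pow (p := 2) (by norm_num)
  have hNi := hN.integrable_norm_pow (p := 2) (by norm_num)
  rw [lintegral_enorm_sq_eq hd, lintegral_enorm_sq_eq hN, ← ofReal_norm,
    ← ENNReal.ofReal_pow (norm_nonneg _), ← ENNReal.ofReal_mul hp, ← ENNReal.ofReal_mul hq,
    ← ENNReal.ofReal_mul (inv_nonneg.2 hδ.le)]
  rw [← ENNReal.ofReal_add (sq_nonneg _)
      (mul_nonneg hp (integral_nonneg fun _ => sq_nonneg _)),
    ← ENNReal.ofReal_add (mul_nonneg hq (integral_nonneg fun _ => sq_nonneg _))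
      (mul_nonneg (inv_nonneg.2 hδ.le) (integral_nonneg fun _ => sq_nonneg _))]
  refine ENNReal.ofReal_le_ofReal ?_
  have hint : Integrable (fun τ => 2 * ((starRingEnd ℂ) (d τ) * d' τ).re)
      (volume.restrict (Ioo 0 t)) := by
    have h1 : MemLp (fun τ => (starRingEnd ℂ) (d τ)) 2 (volume.restrict (Ioo 0 t)) := hd.star
    exact (h1.integrable_mul hd').re.const_mul 2
  have h0 : ‖d t‖ ^ 2 = ∫ τ in Ioo 0 t, 2 * ((starRingEnd ℂ) (d τ) * d' τ).re := by
    rw [h.eq_integral t ht, norm_sq_intervalIntegral_eq ht.1 (intervalIntegrable_of_memLp ht h.memLp),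
      intervalIntegral.integral_of_le ht.1, integral_Ioc_eq_integral_Ioo]
    refine setIntegral_congr_fun measurableSet_Ioo fun τ hτ => ?_
    rw [h.eq_integral τ ⟨hτ.1.le, hτ.2.le.trans ht.2⟩]
  rw [h0, ← integral_const_mul, ← integral_const_mul, ← integral_const_mul,
    ← integral_add hint (hdi.const_mul _), ← integral_add (hdi.const_mul _) (hNi.const_mul _)]
  refine integral_mono (hint.add (hdi.const_mul _)) ((hdi.const_mul _).add (hNi.const_mul _))
    fun τ => ?_
  simp only
  -- With N = d' + c d one has 2 Re(conj(d) d') = 2 Re(conj(d) N) - 2c |d|². Young with parameter δ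
  -- leaves (δ - 2c) |d|², which `hpq` bounds by (q - p) |d|².
  have h2 := two_mul_re_conj_mul_le hδ (d τ) (d' τ + c * d τ)
  have h3 : ((starRingEnd ℂ) (d τ) * (d' τ + c * d τ)).re =
      ((starRingEnd ℂ) (d τ) * d' τ).re + c * ‖d τ‖ ^ 2 := by
    rw [mul_add, Complex.add_re, ← Complex.normSq_eq_norm_sq]
    congr 1
    simp only [Complex.mul_re, Complex.mul_im, Complex.conj_re, Complex.conj_im,
      Complex.ofReal_re, Complex.ofReal_im, Complex.normSq_apply]
    ring
  rw [h3] at h2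
  nlinarith [mul_le_mul_of_nonneg_right hpq (sq_nonneg ‖d τ‖)]

/-- The energy estimate for a family of modes. -/
lemma tsum_energy_le {T : ℝ} {d d' : ℝ → Coeffs}
    (h : ∀ k, IsMode T (fun t => d t k) (fun t => d' t k)) {w c δ p q : (Fin 2 → ℤ) → ℝ}
    (hδ : ∀ k, 0 < δ k) (hp : ∀ k, 0 ≤ p k) (hq : ∀ k, 0 ≤ q k) (hw : ∀ k, 0 ≤ w k)
    (hpq : ∀ k, p k ≤ 2 * c k - δ k + q k) {t : ℝ} (ht : t ∈ Icc 0 T) :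
    (∑' k, ENNReal.ofReal (w k) * ‖d t k‖ₑ ^ 2) +
        ∫⁻ τ in Ioo 0 t, ∑' k, ENNReal.ofReal (w k * p k) * ‖d τ k‖ₑ ^ 2 ≤
      (∫⁻ τ in Ioo 0 t, ∑' k, ENNReal.ofReal (w k * q k) * ‖d τ k‖ₑ ^ 2) +
        ∫⁻ τ in Ioo 0 t, ∑' k, ENNReal.ofReal (w k / δ k) * ‖d' τ k + c k * d τ k‖ₑ ^ 2 := by
  have hT : 0 ≤ T := ht.1.trans ht.2
  have hle : volume.restrict (Ioo 0 t) ≤ volume.restrict (Ioo 0 T) :=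
    Measure.restrict_mono (Ioo_subset_Ioo_right ht.2) le_rfl
  have hd : ∀ k, AEMeasurable (fun τ => ‖d τ k‖ₑ ^ 2) (volume.restrict (Ioo 0 t)) := fun k =>
    (((h k).memLp_self hT).mono_measure hle).1.enorm.pow_const _
  have hN : ∀ k, AEMeasurable (fun τ => ‖d' τ k + c k * d τ k‖ₑ ^ 2)
      (volume.restrict (Ioo 0 t)) := fun k =>
    ((((h k).memLp.mono_measure hle).add
      ((((h k).memLp_self hT).mono_measure hle).const_mul (c k : ℂ))).1).enorm.pow_const _
  -- Tonelli reduces the claim to single modes; since all terms live in [0,∞], no summability is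
  -- required.
  rw [lintegral_tsum fun k => (hd k).const_mul _, lintegral_tsum fun k => (hd k).const_mul _,
    lintegral_tsum fun k => (hN k).const_mul _, ← ENNReal.tsum_add, ← ENNReal.tsum_add]
  refine ENNReal.tsum_le_tsum fun k => ?_
  rw [lintegral_const_mul'' _ (hd k), lintegral_const_mul'' _ (hd k), lintegral_const_mul'' _ (hN k),
    ENNReal.ofReal_mul (hw k), ENNReal.ofReal_mul (hw k), div_eq_mul_inv, ENNReal.ofReal_mul (hw k)]
  have := mul_le_mul_right ((h k).energy_le (hδ k) (hp k) (hq k) (hpq k) ht) (ENNReal.ofReal (w k))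
  simpa only [mul_add, mul_assoc] using this

/-! ### Modes of the difference of two solutions -/

lemma TimeDerivL2H.memLp {s : ℤ} {T : ℝ} {f : ℝ → L2} {f' : ℝ → Coeffs}
    (h : TimeDerivL2H s T f f') (k : Fin 2 → ℤ) :
    MemLp (fun t => f' t k) 2 (volume.restrict (Ioo 0 T)) := by
  refine ⟨h.1 k, ?_⟩
  rw [eLpNorm_lt_top_iff_lintegral_rpow_enorm_lt_top (by norm_num) (by norm_num)]
  -- For a fixed k the weight is a positive constant, also for s = -1, so one term of the series
  -- already bounds the mode in L²(0,T).
  have hpos : 0 < om k ^ s := zpow_pos (om_pos k) s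
  have h1 : ENNReal.ofReal (om k ^ s) * ∫⁻ t in Ioo 0 T, ‖f' t k‖ₑ ^ 2 < ∞ := by
    rw [← lintegral_const_mul'' _ ((h.1 k).enorm.pow_const _)]
    refine (lintegral_mono fun t => ?_).trans_lt h.2.1
    refine le_trans (le_of_eq ?_) (ENNReal.le_tsum k)
    change _ = ENNReal.ofReal (om k ^ s * ‖f' t k‖ ^ 2)
    rw [ENNReal.ofReal_mul hpos.le, ENNReal.ofReal_pow (norm_nonneg _), ofReal_norm]
  have h2 := ENNReal.lt_top_of_mul_ne_top_right h1.ne (by simpa using hpos)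
  simpa using h2

/-- The orders may differ: Θ has its time derivative in L², θ only in H⁻¹. Equal data make the modes
vanish at time 0, so no initial term appears in the energy estimates. -/
lemma TimeDerivL2H.isMode_sub {s r : ℤ} {T : ℝ} {f g : ℝ → L2} {f' g' : ℝ → Coeffs}
    (hf : TimeDerivL2H s T f f') (hg : TimeDerivL2H r T g g') (h0 : f 0 = g 0)
    (k : Fin 2 → ℤ) :
    IsMode T (fun t => fc ⇑(f t - g t) k) (fun t => f' t k - g' t k) := by
  refine ⟨(hf.memLp k).sub (hg.memLp k), fun t ht => ?_⟩
  rw [intervalIntegral.integral_sub (intervalIntegrable_of_memLp ht (hf.memLp k))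
    (intervalIntegrable_of_memLp ht (hg.memLp k)), fc_L2_sub, hf.2.2 t ht k, hg.2.2 t ht k, h0]
  ring

/-! ## Estimates of the nonlinear terms -/

lemma vSq_sub_le (s : ℤ) (v w : VF) : vSq s (v - w) ≤ 2 * (vSq s v + vSq s w) := by
  simp only [vSq, Fin.sum_univ_two]
  refine (add_le_add (sSq_sub_le s (v 0) (w 0)) (sSq_sub_le s (v 1) (w 1))).trans_eq ?_
  ring

lemma vSq_lt_top {s : ℤ} {v : VF} (h : ∀ j, sSq s (v j) < ∞) : vSq s v < ∞ :=
  ENNReal.sum_lt_top.2 fun j _ => h j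

lemma sSq_one_lt_top {f : L2} (h : sSq 2 f < ∞) : sSq 1 f < ∞ :=
  (sSq_mono_exponent (by norm_num) f).trans_lt h

lemma exists_hSq_leray_adv_sub_le : ∃ C : ℝ≥0, 1 ≤ C ∧ ∀ (V v F f : VF),
    (∀ j, sSq 2 (F j) < ∞) → (∀ j, sSq 2 (f j) < ∞) → ∀ j,
    hSq 1 (fun k => leray (fun i => fc (adv V (F i))) j k - leray (fun i => fc (adv v (f i))) j k)
      ≤ C * (vSq 2 (V - v) * vSq 2 F + vSq 2 v * vSq 2 (F - f)) := by
  obtain ⟨C, hC1, hC⟩ := exists_hSq_fc_adv_le (s := 1) (by norm_num) le_rfl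
  refine ⟨16 * C, by nlinarith, fun V v F f hF hf j => ?_⟩
  have h1 : ∀ i, hSq 1 (fun k => fc (adv V (F i)) k - fc (adv v (f i)) k) ≤
      2 * (C * (vSq 2 (V - v) * sSq 2 (F i)) + C * (vSq 2 v * sSq 2 (F i - f i))) := by
    intro i
    have hFi := sSq_one_lt_top (hF i)
    have hfi := sSq_one_lt_top (hf i)
    simp only [fc_adv_sub v V hfi hFi]
    refine (hSq_add_le _ _ _).trans ?_
    gcongr
    · exact hC _ _ hFi
    · exact hC _ _ (sSq_sub_lt_top hFi hfi)
  have h2 : (fun k => leray (fun i => fc (adv V (F i))) j k - leray (fun i => fc (adv v (f i))) j k)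
      = leray (fun i k => fc (adv V (F i)) k - fc (adv v (f i)) k) j :=
    funext fun k => leray_sub _ _ j k
  rw [h2]
  refine (hSq_leray_le 1 _ j).trans ((mul_le_mul_right (add_le_add (h1 0) (h1 1)) _).trans_eq ?_)
  simp only [vSq, Fin.sum_univ_two, Pi.sub_apply]
  push_cast
  ring

lemma hSq_leray_buoyancy_sub_le (Θ θ : L2) (j : Fin 2) :
    hSq 1 (fun k => leray (fun i l => if i = 1 then fc Θ l else 0) j k -
      leray (fun i l => if i = 1 then fc θ l else 0) j k) ≤ 8 * sSq 1 (Θ - θ) := by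
  have h2 : (fun k => leray (fun i l => if i = 1 then fc Θ l else 0) j k -
      leray (fun i l => if i = 1 then fc θ l else 0) j k)
      = leray (fun i k => (if i = 1 then fc Θ k else 0) - (if i = 1 then fc θ k else 0)) j :=
    funext fun k => leray_sub _ _ j k
  rw [h2]
  refine (hSq_leray_le 1 _ j).trans_eq ?_
  have e0 : hSq 1 (fun k => (if (0 : Fin 2) = 1 then fc Θ k else 0) -
      (if (0 : Fin 2) = 1 then fc θ k else 0)) = 0 := by simp [hSq]
  have e1 : hSq 1 (fun k => (if (1 : Fin 2) = 1 then fc Θ k else 0) -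
      (if (1 : Fin 2) = 1 then fc θ k else 0)) = sSq 1 (Θ - θ) := by
    simp only [if_true, sSq, fc_L2_sub']
  rw [e0, e1, zero_add]

/-- The forcing of the differences of the velocities and of the magnetic fields is controlled in
`H¹`. -/
theorem exists_hSq_forcing_le (p : Params) : ∃ C : ℝ≥0, 1 ≤ C ∧ ∀ (Q q : ℝ → ℝ) (R : ℝ≥0∞)
    (U B u b : VF) (Θ θ : L2) (U' B' u' b' : Fin 2 → Coeffs) (Θ' θ' : Coeffs), R ≠ ∞ →
    vSq 2 U ≤ R → vSq 2 B ≤ R → vSq 2 u ≤ R → vSq 2 b ≤ R →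
    Equations p Q U B Θ U' B' Θ' → Equations p q u b θ u' b' θ' → ∀ j,
    hSq 1 (fun k => (U' j k - u' j k) + (p.ν * lam k : ℝ) * fc ⇑(U j - u j) k) ≤
        C * (R * (vSq 2 (U - u) + vSq 2 (B - b)) + sSq 1 (Θ - θ)) ∧
      hSq 1 (fun k => (B' j k - b' j k) + (p.μ * lam k : ℝ) * fc ⇑(B j - b j) k) ≤
        C * (R * (vSq 2 (U - u) + vSq 2 (B - b))) := by
  obtain ⟨C, hC1, hC⟩ := exists_hSq_leray_adv_sub_le
  -- The two quadratic terms contribute 2CR(X + Y) before two uses of ‖a ± b‖² ≤ 2(‖a‖² + ‖b‖²),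
  -- giving 8C; buoyancy is bounded with 8 and doubled once.
  refine ⟨8 * C + 16 * ‖(p.g : ℂ)‖₊ ^ 2, ?_, ?_⟩
  · have : 0 ≤ ‖(p.g : ℂ)‖₊ ^ 2 := zero_le
    nlinarith
  intro Q q R U B u b Θ θ U' B' u' b' Θ' θ' hR hU hB hu hb hE he j
  have fin : ∀ {v : VF}, vSq 2 v ≤ R → ∀ j, sSq 2 (v j) < ∞ := fun hv j =>
    (sSq_le_vSq 2 _ j).trans_lt (hv.trans_lt (lt_top_iff_ne_top.2 hR))
  have bound : ∀ {V v F f : VF}, vSq 2 F ≤ R → vSq 2 f ≤ R → vSq 2 v ≤ R →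
      hSq 1 (fun k => leray (fun i => fc (adv V (F i))) j k
        - leray (fun i => fc (adv v (f i))) j k) ≤
        C * (R * (vSq 2 (V - v) + vSq 2 (F - f))) := by
    intro V v F f hF hf hv
    refine (hC V v F f (fin hF) (fin hf) j).trans ?_
    rw [mul_add R, mul_comm R]
    gcongr
  set X := vSq 2 (U - u)
  set Y := vSq 2 (B - b)
  constructor
  · have e : ∀ k, (U' j k - u' j k) + (p.ν * lam k : ℝ) * fc ⇑(U j - u j) k =
        ((leray (fun i => fc (adv B (B i))) j k - leray (fun i => fc (adv b (b i))) j k)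
        - (leray (fun i => fc (adv U (U i))) j k - leray (fun i => fc (adv u (u i))) j k))
        + p.g * (leray (fun i l => if i = 1 then fc Θ l else 0) j k
          - leray (fun i l => if i = 1 then fc θ l else 0) j k) := by
      intro k
      have h1 := hE.1 j k
      have h2 := he.1 j k
      rw [fc_L2_sub]
      push_cast
      linear_combination h1 - h2
    simp only [e]
    have h1 := hSq_sub_le 1
      (fun k => leray (fun i => fc (adv B (B i))) j k - leray (fun i => fc (adv b (b i))) j k)
      (fun k => leray (fun i => fc (adv U (U i))) j k - leray (fun i => fc (adv u (u i))) j k)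
    have h2 := h1.trans (mul_le_mul_right (add_le_add (bound hB hb hb) (bound hU hu hu)) 2)
    have h3 : hSq 1 (fun k => p.g * (leray (fun i l => if i = 1 then fc Θ l else 0) j k
          - leray (fun i l => if i = 1 then fc θ l else 0) j k)) ≤
        ‖(p.g : ℂ)‖ₑ ^ 2 * (8 * sSq 1 (Θ - θ)) := by
      rw [hSq_const_mul]
      gcongr
      exact hSq_leray_buoyancy_sub_le Θ θ j
    refine (hSq_add_le 1 _ _).trans ((mul_le_mul_right (add_le_add h2 h3) 2).trans ?_)
    · have e2 : ((8 * C + 16 * ‖(p.g : ℂ)‖₊ ^ 2 : ℝ≥0) : ℝ≥0∞) = 8 * C + 16 * ‖(p.g : ℂ)‖ₑ ^ 2 := by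
        push_cast
        rfl
      rw [e2]
      calc _ = 8 * C * (R * (X + Y)) + 16 * ‖(p.g : ℂ)‖ₑ ^ 2 * sSq 1 (Θ - θ) := by ring
        _ ≤ (8 * C + 16 * ‖(p.g : ℂ)‖ₑ ^ 2) * (R * (X + Y)) +
            (8 * C + 16 * ‖(p.g : ℂ)‖ₑ ^ 2) * sSq 1 (Θ - θ) := by
          gcongr
          · exact le_self_add
          · exact le_add_self
        _ = _ := (mul_add _ _ _).symm
  · have e : ∀ k, (B' j k - b' j k) + (p.μ * lam k : ℝ) * fc ⇑(B j - b j) k =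
        ((leray (fun i => fc (adv B (U i))) j k - leray (fun i => fc (adv b (u i))) j k)
        - (leray (fun i => fc (adv U (B i))) j k - leray (fun i => fc (adv u (b i))) j k)) := by
      intro k
      have h1 := hE.2.1 j k
      have h2 := he.2.1 j k
      rw [fc_L2_sub]
      push_cast
      linear_combination h1 - h2
    simp only [e]
    have h1 := hSq_sub_le 1
      (fun k => leray (fun i => fc (adv B (U i))) j k - leray (fun i => fc (adv b (u i))) j k)
      (fun k => leray (fun i => fc (adv U (B i))) j k - leray (fun i => fc (adv u (b i))) j k)
    refine (h1.trans (mul_le_mul_right (add_le_add (bound hU hu hb) (bound hB hb hu)) 2)).trans ?_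
    push_cast
    calc _ = 4 * C * (R * (X + Y)) := by ring
      _ ≤ _ := by
        gcongr
        refine le_trans ?_ le_self_add
        gcongr
        norm_num

/-! ### The heating term -/

/-- The scalar curl, as a square integrable field. -/
def curlL2 (b : VF) : L2 := pd 0 (b 1) - pd 1 (b 0)

lemma curl_ae_eq (b : VF) : curl b =ᵐ[dx] curlL2 b := by
  filter_upwards [Lp.coeFn_sub (pd 0 (b 1)) (pd 1 (b 0))] with x hx
  exact hx.symm

lemma sSq_curlL2_le {b : VF} (hb : ∀ j, sSq 2 (b j) < ∞) : sSq 1 (curlL2 b) ≤ 2 * vSq 2 b := by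
  refine (sSq_sub_le _ _ _).trans ?_
  rw [vSq, Fin.sum_univ_two, add_comm (sSq 2 (b 0))]
  gcongr
  · exact sSq_pd_le (sSq_one_lt_top (hb 1)) 1 0
  · exact sSq_pd_le (sSq_one_lt_top (hb 0)) 1 1

lemma curlL2_sub {B b : VF} (hB : ∀ j, sSq 2 (B j) < ∞) (hb : ∀ j, sSq 2 (b j) < ∞) :
    curlL2 (B - b) = curlL2 B - curlL2 b := by
  unfold curlL2
  rw [Pi.sub_apply, Pi.sub_apply, pd_sub (sSq_one_lt_top (hB 1)) (sSq_one_lt_top (hb 1)),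
    pd_sub (sSq_one_lt_top (hB 0)) (sSq_one_lt_top (hb 0))]
  abel

/-- The error caused by a calming function that differs from the identity by `m |x|^β`. -/
lemma exists_calming_error_le {β : ℝ} (hβ : 1 ≤ β) : ∃ C : ℝ≥0, 1 ≤ C ∧
    ∀ (ζ : ℝ → ℝ) (m : ℝ), Continuous ζ → 0 ≤ m → (∀ x, |x - ζ x| ≤ m * |x| ^ β) →
    ∀ j : L2, sSq 1 j < ∞ → MemLp (fun x => j x * j x - ζ |j x| * |j x|) 2 dx ∧
      hSq 0 (fc (fun x => j x * j x - ζ |j x| * |j x|))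
        ≤ C * (ENNReal.ofReal m ^ 2 * sSq 1 j ^ (β + 1)) := by
  obtain ⟨C, hC⟩ := exists_lintegral_rpow_le (q := β + 1) (by linarith)
  refine ⟨max 1 C, le_max_left _ _, fun ζ m hζ hm h j hj => ?_⟩
  have hmeas : AEStronglyMeasurable (fun x => j x * j x - ζ |j x| * |j x|) dx := by
    have hcont : Continuous fun y : ℝ => y * y - ζ |y| * |y| := by fun_prop
    exact hcont.comp_aestronglyMeasurable (Lp.aestronglyMeasurable j)
  have hpt : ∀ x, ‖j x * j x - ζ |j x| * |j x|‖ₑ ≤ ENNReal.ofReal m * ‖j x‖ₑ ^ (β + 1) := by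
    intro x
    rw [← ofReal_norm, ← ofReal_norm, ENNReal.ofReal_rpow_of_nonneg (norm_nonneg _) (by linarith),
      ← ENNReal.ofReal_mul hm]
    refine ENNReal.ofReal_le_ofReal ?_
    have h1 := h |j x|
    rw [abs_abs] at h1
    have h2 : j x * j x - ζ |j x| * |j x| = (|j x| - ζ |j x|) * |j x| := by
      rw [← abs_mul_abs_self (j x)]; ring
    rw [h2, norm_mul, Real.norm_eq_abs, Real.norm_eq_abs, Real.norm_eq_abs, abs_abs,
      Real.rpow_add' (abs_nonneg _) (by linarith), Real.rpow_one, ← mul_assoc]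
    exact mul_le_mul_of_nonneg_right h1 (abs_nonneg _)
  have hint : ∫⁻ x, ‖j x * j x - ζ |j x| * |j x|‖ₑ ^ 2 ∂dx ≤
      max 1 C * (ENNReal.ofReal m ^ 2 * sSq 1 j ^ (β + 1)) := by
    calc ∫⁻ x, ‖j x * j x - ζ |j x| * |j x|‖ₑ ^ 2 ∂dx
        ≤ ∫⁻ x, ENNReal.ofReal m ^ 2 * (‖j x‖ₑ ^ (β + 1)) ^ 2 ∂dx := by
          refine lintegral_mono fun x => ?_
          rw [← mul_pow]
          gcongr
          exact hpt x
      _ = ENNReal.ofReal m ^ 2 * ∫⁻ x, (‖j x‖ₑ ^ (β + 1)) ^ 2 ∂dx :=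
          lintegral_const_mul' _ _ (by simp)
      _ ≤ ENNReal.ofReal m ^ 2 * (C * sSq 1 j ^ (β + 1)) := by gcongr; exact hC j
      _ = C * (ENNReal.ofReal m ^ 2 * sSq 1 j ^ (β + 1)) := by ring
      _ ≤ _ := by gcongr; exact le_max_right _ _
  have hmem : MemLp (fun x => j x * j x - ζ |j x| * |j x|) 2 dx := by
    refine ⟨hmeas, ?_⟩
    rw [eLpNorm_lt_top_iff_lintegral_rpow_enorm_lt_top (by norm_num) (by norm_num)]
    have : ∫⁻ x, ‖j x * j x - ζ |j x| * |j x|‖ₑ ^ 2 ∂dx < ∞ := by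
      refine hint.trans_lt (ENNReal.mul_lt_top (by simp) (ENNReal.mul_lt_top (by simp) ?_))
      exact ENNReal.rpow_lt_top_of_nonneg (by linarith) hj.ne
    simpa using this
  refine ⟨hmem, ?_⟩
  rw [hSq_eq_hR]
  refine le_trans (le_of_eq ?_) (hint.trans_eq (by push_cast; rfl))
  rw [← tsum_enorm_fc_sq hmem]
  refine tsum_congr fun k => ?_
  simp

/-- The difference is split as (J - j)(J + j) plus the calming error at j. The error sits at the
calmed curl, so the bound on b, not only that on B, is essential. -/
theorem exists_hSq_heating_sub_le {β : ℝ} (hβ : 1 ≤ β) : ∃ C : ℝ≥0, 1 ≤ C ∧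
    ∀ (ζ : ℝ → ℝ) (m : ℝ), Continuous ζ → 0 ≤ m → (∀ x, |x - ζ x| ≤ m * |x| ^ β) →
    ∀ (R : ℝ≥0∞) (B b : VF), R ≠ ∞ → vSq 2 B ≤ R → vSq 2 b ≤ R →
      hSq 0 (fun k => fc (fun x => |curl B x| ^ 2) k - fc (fun x => ζ |curl b x| * |curl b x|) k)
        ≤ C * (R * vSq 2 (B - b) + ENNReal.ofReal m ^ 2 * R ^ (β + 1)) := by
  obtain ⟨C₁, h1, hC₁⟩ := exists_calming_error_le hβ
  obtain ⟨C₂, h2, hC₂⟩ := exists_hSq_fc_mul_le (a := 1) (s := 1) (r := 0) le_rfl (by norm_num)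
    (by norm_num) (by norm_num)
  have hβ1 : 0 ≤ β + 1 := by linarith
  refine ⟨32 * C₂ + 2 * C₁ * 2 ^ (β + 1), ?_, fun ζ m hζ hm h R B b hR hB hb => ?_⟩
  · have : 0 ≤ 2 * C₁ * 2 ^ (β + 1) := zero_le
    nlinarith
  have fin : ∀ {v : VF}, vSq 2 v ≤ R → ∀ j, sSq 2 (v j) < ∞ := fun hv j =>
    (sSq_le_vSq 2 _ j).trans_lt (hv.trans_lt (lt_top_iff_ne_top.2 hR))
  set J := curlL2 B with hJ
  set j := curlL2 b with hj
  have hJR : sSq 1 J ≤ 2 * R := (sSq_curlL2_le (fin hB)).trans (by gcongr)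
  have hjR : sSq 1 j ≤ 2 * R := (sSq_curlL2_le (fin hb)).trans (by gcongr)
  have hRlt : 2 * R < ∞ := ENNReal.mul_lt_top (by simp) (lt_top_iff_ne_top.2 hR)
  obtain ⟨hmem, herr⟩ := hC₁ ζ m hζ hm h j (hjR.trans_lt hRlt)
  have hmemi := hmem.integrable (q := 2) (by norm_num)
  have e : ∀ k, fc (fun x => |curl B x| ^ 2) k - fc (fun x => ζ |curl b x| * |curl b x|) k =
      fc (fun x => (J - j : L2) x * (J + j : L2) x) k
        + fc (fun x => j x * j x - ζ |j x| * |j x|) k := by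
    intro k
    have eJ : fc (fun x => |curl B x| ^ 2) = fc (fun x => J x * J x) := by
      refine fc_congr ?_
      filter_upwards [curl_ae_eq B] with x hx
      rw [hx, sq_abs, sq]
    have ej : fc (fun x => ζ |curl b x| * |curl b x|) = fc (fun x => ζ |j x| * |j x|) := by
      refine fc_congr ?_
      filter_upwards [curl_ae_eq b] with x hx
      rw [hx]
    -- Additivity of Fourier coefficients requires integrability; here it follows from that of j²
    -- and of the calming error.
    have hi : Integrable (fun x => ζ |j x| * |j x|) dx := by
      refine ((integrable_mul_L2 j j).sub hmemi).congr (Eventually.of_forall fun x => ?_)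
      simp
    rw [eJ, ej, ← fc_sub (integrable_mul_L2 _ _) hi, ← fc_add (integrable_mul_L2 _ _) hmemi]
    refine congrFun (fc_congr ?_) k
    filter_upwards [Lp.coeFn_sub J j, Lp.coeFn_add J j] with x h1 h2
    rw [h1, h2]
    simp only [Pi.sub_apply, Pi.add_apply]
    ring
  simp only [e]
  have hsum : sSq 1 (J + j) ≤ 8 * R := by
    refine (sSq_add_le 1 J j).trans ((mul_le_mul_right (add_le_add hJR hjR) 2).trans_eq ?_)
    ring
  have hdiff : sSq 1 (J - j) ≤ 2 * vSq 2 (B - b) := by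
    rw [hJ, hj, ← curlL2_sub (fin hB) (fin hb)]
    exact sSq_curlL2_le fun i => sSq_sub_lt_top (fin hB i) (fin hb i)
  calc _ ≤ _ := hSq_add_le 0 _ _
    _ ≤ 2 * (C₂ * ((2 * vSq 2 (B - b)) * (8 * R)) +
        C₁ * (ENNReal.ofReal m ^ 2 * (2 * R) ^ (β + 1))) := by
      gcongr
      · exact (hC₂ _ _).trans (by gcongr)
      · exact herr.trans (by gcongr)
    _ = 32 * C₂ * (R * vSq 2 (B - b)) +
        2 * C₁ * 2 ^ (β + 1) * (ENNReal.ofReal m ^ 2 * R ^ (β + 1)) := by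
      rw [ENNReal.mul_rpow_of_nonneg _ _ hβ1]
      ring
    _ ≤ _ := by
      rw [mul_add]
      push_cast
      rw [ENNReal.coe_rpow_of_nonneg _ hβ1]
      push_cast
      gcongr
      · exact le_self_add
      · exact le_add_self

/-- The forcing of the difference of the temperatures is controlled in `L²`. -/
theorem exists_hSq_heat_forcing_le (p : Params) {β : ℝ} (hβ : 1 ≤ β) : ∃ C : ℝ≥0, 1 ≤ C ∧
    ∀ (ζ : ℝ → ℝ) (m : ℝ), Continuous ζ → 0 ≤ m → (∀ x, |x - ζ x| ≤ m * |x| ^ β) →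
    ∀ (R : ℝ≥0∞) (U B u b : VF) (Θ θ : L2) (U' B' u' b' : Fin 2 → Coeffs) (Θ' θ' : Coeffs), R ≠ ∞ →
    vSq 2 U ≤ R → vSq 2 B ≤ R → vSq 2 u ≤ R → vSq 2 b ≤ R → sSq 1 Θ ≤ R → sSq 1 θ < ∞ →
    Equations p (fun r => r ^ 2) U B Θ U' B' Θ' →
    Equations p (fun r => ζ r * r) u b θ u' b' θ' →
    hSq 0 (fun k => (Θ' k - θ' k) + (p.κ * lam k : ℝ) * fc ⇑(Θ - θ) k) ≤
      C * (R * (vSq 2 (U - u) + vSq 2 (B - b) + sSq 1 (Θ - θ))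
        + ENNReal.ofReal m ^ 2 * R ^ (β + 1)) := by
  obtain ⟨C₁, h1, hC₁⟩ := exists_hSq_heating_sub_le hβ
  obtain ⟨C₂, h2, hC₂⟩ := exists_hSq_fc_adv_le (s := 0) le_rfl (by norm_num)
  refine ⟨4 * C₂ + 2 * ‖(p.α * p.μ : ℂ)‖₊ ^ 2 * C₁, ?_, ?_⟩
  · have : 0 ≤ 2 * ‖(p.α * p.μ : ℂ)‖₊ ^ 2 * C₁ := zero_le
    nlinarith
  intro ζ m hζ hm h R U B u b Θ θ U' B' u' b' Θ' θ' hR hU hB hu hb hΘ hθ hE he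
  have hΘ1 : sSq 1 Θ < ∞ := hΘ.trans_lt (lt_top_iff_ne_top.2 hR)
  have e : ∀ k, (Θ' k - θ' k) + (p.κ * lam k : ℝ) * fc ⇑(Θ - θ) k =
      (p.α * p.μ : ℂ) *
        (fc (fun x => |curl B x| ^ 2) k - fc (fun x => ζ |curl b x| * |curl b x|) k)
      - (fc (adv (U - u) Θ) k + fc (adv u (Θ - θ)) k) := by
    intro k
    have h1 := hE.2.2 k
    have h2 := he.2.2 k
    -- The H¹ norm of θ enters only through its finiteness: the coefficients in this split are Θ and
    -- u.
    rw [fc_L2_sub, ← fc_adv_sub u U hθ hΘ1]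
    push_cast
    linear_combination h1 - h2
  simp only [e]
  have hadv : hSq 0 (fun k => fc (adv (U - u) Θ) k + fc (adv u (Θ - θ)) k) ≤
      2 * (C₂ * (vSq 2 (U - u) * R) + C₂ * (R * sSq 1 (Θ - θ))) := by
    refine (hSq_add_le 0 _ _).trans ?_
    gcongr
    · refine (hC₂ _ _ hΘ1).trans ?_
      rw [zero_add]
      gcongr
    · refine (hC₂ _ _ (sSq_sub_lt_top hΘ1 hθ)).trans ?_
      rw [zero_add]
      gcongr
  have hheat := hC₁ ζ m hζ hm h R B b hR hB hb
  set X := vSq 2 (U - u)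
  set Y := vSq 2 (B - b)
  set Z := sSq 1 (Θ - θ)
  set W := ENNReal.ofReal m ^ 2 * R ^ (β + 1)
  have e2 : ((4 * C₂ + 2 * ‖(p.α * p.μ : ℂ)‖₊ ^ 2 * C₁ : ℝ≥0) : ℝ≥0∞)
      = 4 * C₂ + 2 * ‖(p.α * p.μ : ℂ)‖ₑ ^ 2 * C₁ := by
    push_cast
    rfl
  rw [e2]
  calc _ ≤ _ := hSq_sub_le 0 _ _
    _ ≤ 2 * (‖(p.α * p.μ : ℂ)‖ₑ ^ 2 * (C₁ * (R * Y + W)) +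
        2 * (C₂ * (X * R) + C₂ * (R * Z))) := by
      rw [hSq_const_mul]
      gcongr
    _ = 4 * C₂ * (R * (X + Z)) + 2 * ‖(p.α * p.μ : ℂ)‖ₑ ^ 2 * C₁ * (R * Y + W) := by ring
    _ ≤ 4 * C₂ * (R * (X + Y + Z) + W) +
        2 * ‖(p.α * p.μ : ℂ)‖ₑ ^ 2 * C₁ * (R * (X + Y + Z) + W) := by
      gcongr
      · refine le_trans ?_ le_self_add
        gcongr
        exact le_self_add
      · exact le_add_self.trans le_self_add
    _ = _ := by ring

/-! ## Energy estimates in Sobolev norms and the bootstrap argument -/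

lemma aemeasurable_sSq {T : ℝ} (hT : 0 ≤ T) {h : ℝ → L2} {d' : ℝ → Coeffs}
    (hm : ∀ k, IsMode T (fun t => fc (h t) k) (fun t => d' t k)) (s : ℤ) {t : ℝ} (ht : t ≤ T) :
    AEMeasurable (fun τ => sSq s (h τ)) (volume.restrict (Ioo 0 t)) := by
  simp only [sSq, hSq_eq_hR, hR]
  refine AEMeasurable.tsum fun k => AEMeasurable.const_mul ?_ _
  exact (((hm k).memLp_self hT).1.enorm.pow_const 2).mono_measure
    (Measure.restrict_mono (Ioo_subset_Ioo_right ht) le_rfl)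

/-- With weight `om ^ 2`, Young's parameter ν `om` puts the forcing in H¹ and leaves ν `om` as
dissipation, that is, H³. The constant 2ν makes up for `om` = 1 + `lam`, as 2ν `lam` - ν `om` + 2ν =
ν `om`. -/
lemma sSq_two_energy_le {T : ℝ} {h : ℝ → L2} {d' : ℝ → Coeffs}
    (hm : ∀ k, IsMode T (fun t => fc (h t) k) (fun t => d' t k)) {ν : ℝ} (hν : 0 < ν) {t : ℝ}
    (ht : t ∈ Icc 0 T) :
    sSq 2 (h t) + ENNReal.ofReal ν * ∫⁻ τ in Ioo 0 t, sSq 3 (h τ) ≤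
      ENNReal.ofReal (2 * ν) * (∫⁻ τ in Ioo 0 t, sSq 2 (h τ)) + ENNReal.ofReal ν⁻¹ *
        ∫⁻ τ in Ioo 0 t, hSq 1 (fun k => d' τ k + (ν * lam k : ℝ) * fc (h τ) k) := by
  have key := tsum_energy_le hm (w := fun k => om k ^ (2 : ℝ)) (c := fun k => ν * lam k)
    (δ := fun k => ν * om k) (p := fun k => ν * om k) (q := fun _ => 2 * ν)
    (fun k => mul_pos hν (om_pos k)) (fun k => (mul_pos hν (om_pos k)).le)
    (fun _ => by linarith) (fun k => (Real.rpow_pos_of_pos (om_pos k) _).le)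
    (fun k => by unfold om; linarith) ht
  rw [← lintegral_const_mul' _ _ ENNReal.ofReal_ne_top,
    ← lintegral_const_mul' _ _ ENNReal.ofReal_ne_top,
    ← lintegral_const_mul' _ _ ENNReal.ofReal_ne_top]
  simp only [sSq, hSq_eq_hR, hR, ← ENNReal.tsum_mul_left]
  convert! key using 3
  · refine funext fun τ => tsum_congr fun k => ?_
    rw [← mul_assoc, ← ENNReal.ofReal_mul hν.le]
    congr 2
    rw [mul_left_comm]
    congr 1
    rw [← Real.rpow_add_one (om_pos k).ne']
    norm_num
  · refine funext fun τ => tsum_congr fun k => ?_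
    rw [← mul_assoc, ← ENNReal.ofReal_mul (by linarith)]
    congr 2
    rw [mul_comm]
    norm_num
  · refine funext fun τ => tsum_congr fun k => ?_
    rw [← mul_assoc, ← ENNReal.ofReal_mul (inv_nonneg.2 hν.le)]
    congr 2
    have := (om_pos k).ne'
    norm_num
    field_simp

/-- The Young parameter a is left free because the heat forcing contains R ‖η‖² in H¹, with R large:
a of size R allows this term to be absorbed, at the price of a ‖η‖² in L². -/
lemma sSq_zero_energy_le {T : ℝ} {h : ℝ → L2} {d' : ℝ → Coeffs}
    (hm : ∀ k, IsMode T (fun t => fc (h t) k) (fun t => d' t k)) {κ a : ℝ} (hκ : 0 < κ)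
    (ha : 0 < a) {t : ℝ} (ht : t ∈ Icc 0 T) :
    sSq 0 (h t) + ENNReal.ofReal κ * ∫⁻ τ in Ioo 0 t, sSq 1 (h τ) ≤
      ENNReal.ofReal (2 * κ + a) * (∫⁻ τ in Ioo 0 t, sSq 0 (h τ)) + ENNReal.ofReal a⁻¹ *
        ∫⁻ τ in Ioo 0 t, hSq 0 (fun k => d' τ k + (κ * lam k : ℝ) * fc (h τ) k) := by
  have key := tsum_energy_le hm (w := fun _ => 1) (c := fun k => κ * lam k)
    (δ := fun _ => a) (p := fun k => κ * om k) (q := fun _ => 2 * κ + a)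
    (fun _ => ha) (fun k => (mul_pos hκ (om_pos k)).le)
    (fun _ => by linarith) (fun _ => zero_le_one)
    (fun k => by
      have := mul_nonneg hκ.le (lam_nonneg k)
      unfold om; nlinarith) ht
  rw [← lintegral_const_mul' _ _ ENNReal.ofReal_ne_top,
    ← lintegral_const_mul' _ _ ENNReal.ofReal_ne_top,
    ← lintegral_const_mul' _ _ ENNReal.ofReal_ne_top]
  simp only [sSq, hSq_eq_hR, hR, ← ENNReal.tsum_mul_left]
  convert! key using 3
  · norm_num
  · refine funext fun τ => tsum_congr fun k => ?_
    rw [← mul_assoc, ← ENNReal.ofReal_mul hκ.le]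
    norm_num
  · refine funext fun τ => tsum_congr fun k => ?_
    rw [← mul_assoc, ← ENNReal.ofReal_mul (by linarith)]
    norm_num
  · refine funext fun τ => tsum_congr fun k => ?_
    rw [← mul_assoc, ← ENNReal.ofReal_mul (inv_nonneg.2 ha.le)]
    norm_num

/-! ### Grönwall's inequality and the continuation argument -/

lemma gronwall_integral_le {t a b : ℝ} (ha : 0 < a) {E : ℝ → ℝ} (hE : Continuous E)
    (h : ∀ s ∈ Icc 0 t, E s ≤ ∫ τ in (0 : ℝ)..s, (a * E τ + b)) :
    ∀ s ∈ Icc 0 t, ∫ τ in (0 : ℝ)..s, (a * E τ + b) ≤ b / a * (Real.exp (a * s) - 1) := by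
  have hc : Continuous fun τ => a * E τ + b := by fun_prop
  have hder : ∀ s, HasDerivAt (fun s => ∫ τ in (0 : ℝ)..s, (a * E τ + b)) (a * E s + b) s :=
    fun s => intervalIntegral.integral_hasDerivAt_right (hc.intervalIntegrable _ _)
      hc.aestronglyMeasurable.stronglyMeasurableAtFilter hc.continuousAt
  intro s hs
  -- The differential inequality is applied to the integral, which is differentiable, while E is
  -- merely continuous.
  have := le_gronwallBound_of_liminf_deriv_right_le (δ := 0) (K := a) (ε := b)
    (f' := fun s => a * E s + b)
    (fun s _ => (hder s).continuousAt.continuousWithinAt)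
    (fun s _ r hr => (hder s).hasDerivWithinAt.liminf_right_slope_le hr)
    (by simp) (fun s hs => by
      have := mul_le_mul_of_nonneg_left (h s ⟨hs.1, hs.2.le⟩) ha.le
      linarith) s hs
  rw [gronwallBound_of_K_ne_0 ha.ne'] at this
  simpa using this

/-- Grönwall's inequality for a quantity that satisfies the energy inequality as long as it has
stayed below `1`. -/
theorem gronwall_bootstrap {T a b : ℝ} (hT : 0 ≤ T) (ha : 0 < a) (hb : 0 ≤ b) {E D : ℝ → ℝ}
    (hE : ContinuousOn E (Icc 0 T)) (hE0 : E 0 = 0) (hD : ∀ t, 0 ≤ D t)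
    (h : ∀ t ∈ Icc 0 T, (∀ s ∈ Icc 0 t, E s ≤ 1) →
      E t + D t ≤ ∫ τ in (0 : ℝ)..t, (a * E τ + b))
    (hsmall : b / a * Real.exp (a * T) < 1) :
    ∀ t ∈ Icc 0 T, E t ≤ 1 ∧ E t + D t ≤ b / a * Real.exp (a * T) := by
  set E' : ℝ → ℝ := IccExtend hT ((Icc 0 T).domRestrict E) with hE'
  have hcont : Continuous E' := (continuousOn_iff_continuous_domRestrict.1 hE).Icc_extend'
  have heq : ∀ t ∈ Icc 0 T, E' t = E t := fun t ht => IccExtend_of_mem hT _ ht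
  have hint : ∀ t ∈ Icc 0 T, ∫ τ in (0 : ℝ)..t, (a * E τ + b) = ∫ τ in (0 : ℝ)..t, (a * E' τ + b) := by
    intro t ht
    refine intervalIntegral.integral_congr fun τ hτ => ?_
    rw [uIcc_of_le ht.1] at hτ
    simp only [heq τ ⟨hτ.1, hτ.2.trans ht.2⟩]
  have step : ∀ t ∈ Icc 0 T, (∀ s ∈ Icc 0 t, E s ≤ 1) → E t + D t ≤ b / a * Real.exp (a * T) := by
    intro t ht hle
    have h1 := gronwall_integral_le (t := t) (b := b) ha hcont (fun s hs => by
      have hsT : s ∈ Icc 0 T := ⟨hs.1, hs.2.trans ht.2⟩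
      have := h s hsT fun r hr => hle r ⟨hr.1, hr.2.trans hs.2⟩
      rw [hint s hsT] at this
      rw [heq s hsT]
      linarith [hD s]) t (right_mem_Icc.2 ht.1)
    have h2 := h t ht hle
    rw [hint t ht] at h2
    have h3 : b / a * (Real.exp (a * t) - 1) ≤ b / a * Real.exp (a * T) := by
      gcongr
      have : Real.exp (a * t) ≤ Real.exp (a * T) := by gcongr; exact ht.2
      linarith
    linarith
  have bound : ∀ t ∈ Icc 0 T, E t ≤ 1 := by
    by_contra! hcon
    obtain ⟨t, ht, hlt⟩ := hcon
    -- The infimum of S is the first time at which E reaches 1; it is positive because E vanishes at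
    -- 0.
    set S := Icc 0 t ∩ E' ⁻¹' Ici 1 with hS
    have hScl : IsClosed S := isClosed_Icc.inter (isClosed_Ici.preimage hcont)
    have hSne : S.Nonempty := ⟨t, right_mem_Icc.2 ht.1, by
      rw [mem_preimage, heq t ht]; exact hlt.le⟩
    have hSbdd : BddBelow S := ⟨0, fun s hs => hs.1.1⟩
    have hmem := hScl.csInf_mem hSne hSbdd
    set s₀ := sInf S
    have hs₀T : s₀ ∈ Icc 0 T := ⟨hmem.1.1, hmem.1.2.trans ht.2⟩
    have hge : 1 ≤ E' s₀ := hmem.2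
    have hpos : 0 < s₀ := by
      rcases hmem.1.1.eq_or_lt with h0 | h0
      · rw [← h0, heq 0 (left_mem_Icc.2 hT), hE0] at hge
        linarith
      · exact h0
    have hbefore : ∀ s ∈ Ico 0 s₀, E' s ≤ 1 := by
      intro s hs
      by_contra! hc
      exact absurd (csInf_le hSbdd (⟨⟨hs.1, hs.2.le.trans hmem.1.2⟩, hc.le⟩ : s ∈ S)) (not_le.2 hs.2)
    -- Before `s₀` the energy inequality is available, and its consequence passes to the left limit.
    -- By `hsmall` this contradicts E ≥ 1 at `s₀`.
    have hlim : E' s₀ ≤ b / a * Real.exp (a * T) := by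
      refine le_of_tendsto (hcont.continuousAt.continuousWithinAt (s := Iio s₀)) ?_
      filter_upwards [Ioo_mem_nhdsLT hpos] with s hs
      have hsT : s ∈ Icc 0 T := ⟨hs.1.le, hs.2.le.trans hs₀T.2⟩
      have := step s hsT fun r hr => by
        rw [← heq r ⟨hr.1, hr.2.trans hsT.2⟩]
        exact hbefore r ⟨hr.1, hr.2.trans_lt hs.2⟩
      rw [heq s hsT]
      linarith [hD s]
    linarith
  exact fun t ht => ⟨bound t ht, step t ht fun s hs => bound s ⟨hs.1, hs.2.trans ht.2⟩⟩

/-! ## The energy inequality for the difference of two solutions -/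

lemma vSq_two_energy_le {T : ℝ} (hT : 0 ≤ T) {h : ℝ → VF} {d' : ℝ → Fin 2 → Coeffs}
    (hm : ∀ j k, IsMode T (fun t => fc (h t j) k) (fun t => d' t j k)) {ν : ℝ} (hν : 0 < ν)
    {G : ℝ → ℝ≥0∞} (hG : ∀ j, ∀ᵐ τ ∂(volume.restrict (Ioo 0 T)),
      hSq 1 (fun k => d' τ j k + (ν * lam k : ℝ) * fc (h τ j) k) ≤ G τ)
    {t : ℝ} (ht : t ∈ Icc 0 T) :
    vSq 2 (h t) + ENNReal.ofReal ν * ∫⁻ τ in Ioo 0 t, vSq 3 (h τ) ≤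
      ENNReal.ofReal (2 * ν) * (∫⁻ τ in Ioo 0 t, vSq 2 (h τ)) + ENNReal.ofReal ν⁻¹ *
        (2 * ∫⁻ τ in Ioo 0 t, G τ) := by
  have hG' : ∀ j, ∫⁻ τ in Ioo 0 t, hSq 1 (fun k => d' τ j k + (ν * lam k : ℝ) * fc (h τ j) k) ≤
      ∫⁻ τ in Ioo 0 t, G τ := fun j =>
    lintegral_mono_ae (ae_mono (Measure.restrict_mono (Ioo_subset_Ioo_right ht.2) le_rfl) (hG j))
  have h0 := sSq_two_energy_le (hm 0) hν ht
  have h1 := sSq_two_energy_le (hm 1) hν ht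
  have hsum : ∀ s : ℤ, ∫⁻ τ in Ioo 0 t, vSq s (h τ) =
      (∫⁻ τ in Ioo 0 t, sSq s (h τ 0)) + ∫⁻ τ in Ioo 0 t, sSq s (h τ 1) := by
    intro s
    simp only [vSq, Fin.sum_univ_two]
    exact lintegral_add_left' (aemeasurable_sSq hT (hm 0) s ht.2) _
  rw [hsum, hsum, vSq, Fin.sum_univ_two]
  calc _ = (sSq 2 (h t 0) + ENNReal.ofReal ν * ∫⁻ τ in Ioo 0 t, sSq 3 (h τ 0)) +
        (sSq 2 (h t 1) + ENNReal.ofReal ν * ∫⁻ τ in Ioo 0 t, sSq 3 (h τ 1)) := by ring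
    _ ≤ _ := add_le_add (h0.trans (add_le_add le_rfl (mul_le_mul_right (hG' 0) _)))
        (h1.trans (add_le_add le_rfl (mul_le_mul_right (hG' 1) _)))
    _ = _ := by ring

/-- Here `idy` is the integral of ‖η‖² in H¹. The Young parameter 2C₃r/κ turns C₃r into κ/2, so the
heat estimate loses half of its dissipation. Buoyancy costs C₅ `idy` in the other two estimates.
With A κ/2 = C₅ + 1 the weighted heat estimate supplies 2(C₅ + 1) `idy` and spends C₅ + 1; after the
C₅ of buoyancy, exactly one `idy` remains, whence the 1 in c. -/
lemma combine_energy_le {ν μ κ C₁ C₃ : ℝ} (hν : 0 < ν) (hμ : 0 < μ) (hκ : 0 < κ) (h1 : 0 < C₁)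
    (h3 : 0 < C₃) : ∃ A > 0, ∃ C > 0, ∃ c > 0, ∀ vt wt yt iv3 iw3 idy iv2 iw2 iy r F : ℝ,
      1 ≤ r → 0 ≤ iv3 → 0 ≤ iw3 → 0 ≤ idy → 0 ≤ iv2 → 0 ≤ iw2 → 0 ≤ iy → 0 ≤ F →
      vt + ν * iv3 ≤ 2 * ν * iv2 + ν⁻¹ * (2 * (C₁ * (r * (iv2 + iw2) + idy))) →
      wt + μ * iw3 ≤ 2 * μ * iw2 + μ⁻¹ * (2 * (C₁ * (r * (iv2 + iw2) + idy))) →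
      yt + κ * idy ≤ (2 * κ + 2 * C₃ * r / κ) * iy
        + (2 * C₃ * r / κ)⁻¹ * (C₃ * (r * (iv2 + iw2 + idy) + F)) →
      vt + wt + A * yt + c * (iv3 + iw3 + idy) ≤ C * (r * (iv2 + iw2 + A * iy) + F) := by
  set C₅ := 2 * ν + 2 * μ + 2 * (ν⁻¹ + μ⁻¹) * C₁ with hC₅
  have hC₅0 : 0 < C₅ := by positivity
  refine ⟨2 * (C₅ + 1) / κ, by positivity, 2 * C₅ + 1 + 2 * κ + 2 * C₃ / κ, by positivity,
    min ν (min μ 1), by positivity, ?_⟩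
  intro vt wt yt iv3 iw3 idy iv2 iw2 iy r F hr hiv3 hiw3 hidy hiv2 hiw2 hiy hF hv hw hy
  set A := 2 * (C₅ + 1) / κ with hA
  have hA0 : 0 < A := by positivity
  have hAκ : A * (κ / 2) = C₅ + 1 := by rw [hA]; field_simp
  have hr0 : 0 < r := by linarith
  have hrx : iv2 + iw2 ≤ r * (iv2 + iw2) := le_mul_of_one_le_left (by positivity) hr
  have hX : vt + wt + ν * iv3 + μ * iw3 ≤ C₅ * (r * (iv2 + iw2) + idy) := by
    have e1 : 2 * ν * iv2 ≤ 2 * ν * (r * (iv2 + iw2) + idy) := by gcongr; linarith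
    have e2 : 2 * μ * iw2 ≤ 2 * μ * (r * (iv2 + iw2) + idy) := by gcongr; linarith
    rw [hC₅]
    linarith
  have hy' : yt + κ * idy ≤ (2 * κ + 2 * C₃ / κ) * (r * iy) + κ / 2 * (iv2 + iw2 + idy + F) := by
    have e1 : (2 * C₃ * r / κ)⁻¹ * (C₃ * (r * (iv2 + iw2 + idy) + F)) =
        κ / 2 * (iv2 + iw2 + idy + F / r) := by field_simp
    have e2 : F / r ≤ F := div_le_self hF hr
    have e3 : κ / 2 * (iv2 + iw2 + idy + F / r) ≤ κ / 2 * (iv2 + iw2 + idy + F) := by gcongr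
    have e4 : (2 * κ + 2 * C₃ * r / κ) * iy ≤ (2 * κ + 2 * C₃ / κ) * (r * iy) := by
      have : (2 * κ + 2 * C₃ / κ) * (r * iy) = (2 * κ * r + 2 * C₃ * r / κ) * iy := by ring
      rw [this]
      refine mul_le_mul_of_nonneg_right ?_ hiy
      have : 2 * κ ≤ 2 * κ * r := le_mul_of_one_le_right (by positivity) hr
      linarith
    linarith
  have hyA := mul_le_mul_of_nonneg_left hy' hA0.le
  have e5 : A * ((2 * κ + 2 * C₃ / κ) * (r * iy) + κ / 2 * (iv2 + iw2 + idy + F)) =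
      (2 * κ + 2 * C₃ / κ) * (r * (A * iy)) + (C₅ + 1) * (iv2 + iw2 + idy + F) := by
    rw [← hAκ]; ring
  have e6 : A * (yt + κ * idy) = A * yt + 2 * (C₅ + 1) * idy := by
    rw [← hAκ]; ring
  rw [e5, e6] at hyA
  have c1 : min ν (min μ 1) * iv3 ≤ ν * iv3 := by gcongr; exact min_le_left _ _
  have c2 : min ν (min μ 1) * iw3 ≤ μ * iw3 := by
    gcongr; exact (min_le_right _ _).trans (min_le_left _ _)
  have c3 : min ν (min μ 1) * idy ≤ 1 * idy := by
    gcongr; exact (min_le_right _ _).trans (min_le_right _ _)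
  have k1 : 0 ≤ r * (iv2 + iw2) := by positivity
  have k2 : 0 ≤ r * (A * iy) := by positivity
  have k4 : 0 ≤ 2 * C₃ / κ := by positivity
  have f1 : (C₅ + 1) * (iv2 + iw2) ≤ (C₅ + 1) * (r * (iv2 + iw2)) := by gcongr
  have f2 : 0 ≤ (2 * κ + 2 * C₃ / κ) * (r * (iv2 + iw2)) := by positivity
  have f3 : 0 ≤ (2 * C₅ + 1) * (r * (A * iy)) := by positivity
  have f4 : 0 ≤ (C₅ + 2 * κ + 2 * C₃ / κ) * F := by positivity
  have e7 : (2 * C₅ + 1 + 2 * κ + 2 * C₃ / κ) * (r * (iv2 + iw2 + A * iy) + F) =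
      (C₅ * (r * (iv2 + iw2)) + (C₅ + 1) * (r * (iv2 + iw2))
        + (2 * κ + 2 * C₃ / κ) * (r * (iv2 + iw2))) + ((2 * C₅ + 1) * (r * (A * iy))
        + (2 * κ + 2 * C₃ / κ) * (r * (A * iy))) + ((C₅ + 1) * F
        + (C₅ + 2 * κ + 2 * C₃ / κ) * F) := by ring
  rw [e7]
  have e8 : (C₅ + 1) * (iv2 + iw2 + idy + F) =
      (C₅ + 1) * (iv2 + iw2) + (C₅ + 1) * idy + (C₅ + 1) * F := by ring
  rw [e8] at hyA
  linarith

/-- The square of the `H²` norm of the differences of the velocities and the magnetic fields. -/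
def diffSq (U B u b : ℝ → VF) (t : ℝ) : ℝ≥0∞ := vSq 2 (U t - u t) + vSq 2 (B t - b t)

/-- The dissipation of the difference of two solutions. -/
def dissSq (U B u b : ℝ → VF) (Θ θ : ℝ → L2) (t : ℝ) : ℝ≥0∞ :=
  vSq 3 (U t - u t) + vSq 3 (B t - b t) + sSq 1 (Θ t - θ t)

/-! ### From norms to squares, and from [0,∞] to the reals -/

lemma vSq_le_of_vNorm_le {s : ℤ} {v : VF} {M : ℝ} (hM : 0 ≤ M)
    (h : vNorm s v ≤ ENNReal.ofReal M) : vSq s v ≤ ENNReal.ofReal (M ^ 2) := by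
  have := ENNReal.rpow_le_rpow h (z := 2) (by norm_num)
  rw [vNorm, ← ENNReal.rpow_mul, ENNReal.ofReal_rpow_of_nonneg hM (by norm_num)] at this
  norm_num at this
  exact this

lemma sSq_le_of_sNorm_le {s : ℤ} {f : L2} {M : ℝ} (hM : 0 ≤ M)
    (h : sNorm s f ≤ ENNReal.ofReal M) : sSq s f ≤ ENNReal.ofReal (M ^ 2) := by
  have := ENNReal.rpow_le_rpow h (z := 2) (by norm_num)
  rw [sNorm, ← ENNReal.rpow_mul, ENNReal.ofReal_rpow_of_nonneg hM (by norm_num)] at this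
  norm_num at this
  exact this

/-- Rests on 2(M² + 1) ≤ 4M². It turns closeness in H² into a bound on the calmed solution and is
the source of `r = 4 * M ^ 2`. -/
lemma vSq_le_of_sub {s : ℤ} {V v : VF} {M : ℝ} (hM : 1 ≤ M)
    (hV : vSq s V ≤ ENNReal.ofReal (M ^ 2)) (h : vSq s (V - v) ≤ 1) :
    vSq s v ≤ ENNReal.ofReal (4 * M ^ 2) := by
  have h1 := vSq_sub_le s V (V - v)
  rw [sub_sub_cancel] at h1
  refine (h1.trans (mul_le_mul_right (add_le_add hV h) 2)).trans ?_
  rw [← ENNReal.ofReal_one, ← ENNReal.ofReal_add (by positivity) zero_le_one,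
    ← ENNReal.ofReal_ofNat 2, ← ENNReal.ofReal_mul (by norm_num)]
  refine ENNReal.ofReal_le_ofReal ?_
  nlinarith

lemma IsMode.mono {T t : ℝ} {d d' : ℝ → ℂ} (h : IsMode T d d') (ht : t ≤ T) : IsMode t d d' :=
  ⟨h.memLp.mono_measure (Measure.restrict_mono (Ioo_subset_Ioo_right ht) le_rfl),
    fun s hs => h.eq_integral s ⟨hs.1, hs.2.trans ht⟩⟩

/-- A finite right-hand side forces the dissipation integral to be finite; only then can terms be
moved across the inequality. -/
lemma toReal_energy_le {x i j G : ℝ≥0∞} {a b c : ℝ} (ha : 0 < a) (hb : 0 ≤ b) (hc : 0 ≤ c)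
    (hj : j ≠ ∞) (hG : G ≠ ∞)
    (h : x + ENNReal.ofReal a * i ≤ ENNReal.ofReal b * j + ENNReal.ofReal c * G) :
    i ≠ ∞ ∧ x.toReal + a * i.toReal ≤ b * j.toReal + c * G.toReal := by
  have hR : ENNReal.ofReal b * j + ENNReal.ofReal c * G ≠ ∞ :=
    ENNReal.add_ne_top.2 ⟨ENNReal.mul_ne_top ENNReal.ofReal_ne_top hj,
      ENNReal.mul_ne_top ENNReal.ofReal_ne_top hG⟩
  have hL := (h.trans_lt (lt_top_iff_ne_top.2 hR)).ne
  obtain ⟨hx, hai⟩ := ENNReal.add_ne_top.1 hL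
  have hi : i ≠ ∞ := (ENNReal.lt_top_of_mul_ne_top_right hai (by simpa using ha)).ne
  refine ⟨hi, ?_⟩
  have := ENNReal.toReal_mono hR h
  rw [ENNReal.toReal_add hx hai, ENNReal.toReal_add (ENNReal.mul_ne_top ENNReal.ofReal_ne_top hj)
    (ENNReal.mul_ne_top ENNReal.ofReal_ne_top hG), ENNReal.toReal_mul, ENNReal.toReal_mul,
    ENNReal.toReal_mul, ENNReal.toReal_ofReal ha.le, ENNReal.toReal_ofReal hb,
    ENNReal.toReal_ofReal hc] at this
  exact this

lemma continuousOn_toReal {f : ℝ → ℝ≥0∞} {S : Set ℝ} (h : ContinuousOn f S)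
    (hf : ∀ t ∈ S, f t ≠ ∞) : ContinuousOn (fun t => (f t).toReal) S := fun t ht =>
  (ENNReal.tendsto_toReal (hf t ht)).comp (h t ht)

lemma continuousOn_toReal_diffSq {T : ℝ} {U B u b : ℝ → VF} (hU : ∀ j, ContH 2 T (fun t => U t j))
    (hu : ∀ j, ContH 2 T (fun t => u t j)) (hB : ∀ j, ContH 2 T (fun t => B t j))
    (hb : ∀ j, ContH 2 T (fun t => b t j)) :
    (∀ t ∈ Icc 0 T, diffSq U B u b t ≠ ∞) ∧
      ContinuousOn (fun t => (diffSq U B u b t).toReal) (Icc 0 T) := by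
  have hv : ∀ j, ContH 2 T (fun t => U t j - u t j) := fun j => (hU j).sub (hu j)
  have hw : ∀ j, ContH 2 T (fun t => B t j - b t j) := fun j => (hB j).sub (hb j)
  have hfin : ∀ t ∈ Icc 0 T, diffSq U B u b t ≠ ∞ := fun t ht =>
    ENNReal.add_ne_top.2 ⟨(vSq_lt_top fun j => (hv j).1 t ht).ne,
      (vSq_lt_top fun j => (hw j).1 t ht).ne⟩
  refine ⟨hfin, continuousOn_toReal ?_ hfin⟩
  have h2 := ((continuousOn_sSq (hv 0)).add (continuousOn_sSq (hv 1))).add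
    ((continuousOn_sSq (hw 0)).add (continuousOn_sSq (hw 1)))
  refine h2.congr fun t _ => ?_
  simp only [diffSq, vSq, Fin.sum_univ_two]
  rfl

/-- The energy inequality for the difference of a solution of the original system and a strong
solution of the calmed system, as long as the difference is at most `1` in `H²`. -/
theorem exists_energy_inequality (p : Params) (hν : 0 < p.ν) (hμ : 0 < p.μ) (hκ : 0 < p.κ)
    {β : ℝ} (hβ : 1 ≤ β) : ∃ A > 0, ∃ C > 0, ∃ c > 0, ∀ (T M m : ℝ) (ζ : ℝ → ℝ) (U₀ B₀ : VF)
      (Θ₀ : L2) (U B : ℝ → VF) (Θ : ℝ → L2) (u b : ℝ → VF) (θ : ℝ → L2), 0 < T → 1 ≤ M → 0 ≤ m →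
      Continuous ζ → (∀ x, |x - ζ x| ≤ m * |x| ^ β) →
      IsOriginalSolution p T U₀ B₀ Θ₀ U B Θ →
      (∀ t ∈ Icc 0 T, vSq 2 (U t) ≤ ENNReal.ofReal (M ^ 2) ∧ vSq 2 (B t) ≤ ENNReal.ofReal (M ^ 2) ∧
        sSq 1 (Θ t) ≤ ENNReal.ofReal (M ^ 2)) →
      IsStrongSolution p ζ T U₀ B₀ Θ₀ u b θ →
      ∀ t ∈ Icc 0 T, (∀ s ∈ Icc 0 t, diffSq U B u b s ≤ 1) →
        (∫⁻ τ in Ioo 0 t, dissSq U B u b Θ θ τ) ≠ ∞ ∧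
        (diffSq U B u b t).toReal + A * (sSq 0 (Θ t - θ t)).toReal
            + c * (∫⁻ τ in Ioo 0 t, dissSq U B u b Θ θ τ).toReal ≤
          ∫ τ in (0 : ℝ)..t, (C * M ^ 2 * ((diffSq U B u b τ).toReal
            + A * (sSq 0 (Θ τ - θ τ)).toReal) + C * (m ^ 2 * M ^ (2 + 2 * β))) := by
  obtain ⟨C₁, hC₁1, hC₁⟩ := exists_hSq_forcing_le p
  obtain ⟨C₃, hC₃1, hC₃⟩ := exists_hSq_heat_forcing_le p hβ
  have hC₁0 : (0 : ℝ) < C₁ := zero_lt_one.trans_le (by exact_mod_cast hC₁1)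
  have hC₃0 : (0 : ℝ) < C₃ := zero_lt_one.trans_le (by exact_mod_cast hC₃1)
  obtain ⟨A, hA, C, hC, c, hc, hcomb⟩ := combine_energy_le hν hμ hκ hC₁0 hC₃0
  -- With r = 4M², the source has r^(β+1) = 4^(β+1) M^(2+2β), and the 4 in front of M² is also at
  -- most 4^(β+1).
  refine ⟨A, hA, C * 4 ^ (β + 1), by positivity, c, hc, ?_⟩
  intro T M m ζ U₀ B₀ Θ₀ U B Θ u b θ hT hM hm hζ happ hO hbd hS t ht hboot
  obtain ⟨U', B', Θ', hU', hB', hΘ', hE⟩ := hO.solves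
  obtain ⟨u', b', θ', hu', hb', hθ', he⟩ := hS.solves
  have ht0 : 0 ≤ t := ht.1
  have htt : t ∈ Icc 0 t := right_mem_Icc.2 ht0
  have hle : volume.restrict (Ioo 0 t) ≤ volume.restrict (Ioo 0 T) :=
    Measure.restrict_mono (Ioo_subset_Ioo_right ht.2) le_rfl
  have mv : ∀ j k, IsMode t (fun t => fc ⇑((U t - u t) j) k) (fun t => U' t j k - u' t j k) :=
    fun j k => ((hU' j).isMode_sub (hu' j) (by rw [hO.init_U, hS.init_u]) k).mono ht.2
  have mw : ∀ j k, IsMode t (fun t => fc ⇑((B t - b t) j) k) (fun t => B' t j k - b' t j k) :=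
    fun j k => ((hB' j).isMode_sub (hb' j) (by rw [hO.init_B, hS.init_b]) k).mono ht.2
  have mη : ∀ k, IsMode t (fun t => fc ⇑(Θ t - θ t) k) (fun t => Θ' t k - θ' t k) :=
    fun k => (hΘ'.isMode_sub hθ' (by rw [hO.init_Θ, hS.init_θ]) k).mono ht.2
  have meas_v : ∀ s, AEMeasurable (fun τ => vSq s (U τ - u τ)) (volume.restrict (Ioo 0 t)) := by
    intro s
    simp only [vSq, Fin.sum_univ_two]
    exact (aemeasurable_sSq ht0 (mv 0) s le_rfl).add (aemeasurable_sSq ht0 (mv 1) s le_rfl)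
  have meas_w : ∀ s, AEMeasurable (fun τ => vSq s (B τ - b τ)) (volume.restrict (Ioo 0 t)) := by
    intro s
    simp only [vSq, Fin.sum_univ_two]
    exact (aemeasurable_sSq ht0 (mw 0) s le_rfl).add (aemeasurable_sSq ht0 (mw 1) s le_rfl)
  have meas_η : ∀ s, AEMeasurable (fun τ => sSq s (Θ τ - θ τ)) (volume.restrict (Ioo 0 t)) :=
    fun s => aemeasurable_sSq ht0 mη s le_rfl
  obtain ⟨-, Rθ, hRθ⟩ := hS.θ_LinfH2
  have hθfin : ∀ᵐ τ ∂(volume.restrict (Ioo 0 t)), sSq 1 (θ τ) ≤ Rθ := by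
    filter_upwards [ae_mono hle hRθ] with τ h
    exact (sSq_mono_exponent (by norm_num) _).trans h
  set r : ℝ := 4 * M ^ 2 with hr
  have hr1 : 1 ≤ r := by nlinarith
  have hr0 : 0 ≤ r := by linarith
  set R : ℝ≥0∞ := ENNReal.ofReal r with hR
  have hMr : ENNReal.ofReal (M ^ 2) ≤ R := ENNReal.ofReal_le_ofReal (by rw [hr]; nlinarith [sq_nonneg M])
  have bds : ∀ τ ∈ Ioo 0 t, vSq 2 (U τ) ≤ R ∧ vSq 2 (B τ) ≤ R ∧ vSq 2 (u τ) ≤ R ∧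
      vSq 2 (b τ) ≤ R ∧ sSq 1 (Θ τ) ≤ R := by
    intro τ hτ
    obtain ⟨h1, h2, h3⟩ := hbd τ ⟨hτ.1.le, hτ.2.le.trans ht.2⟩
    have h4 := hboot τ ⟨hτ.1.le, hτ.2.le⟩
    exact ⟨h1.trans hMr, h2.trans hMr, vSq_le_of_sub hM h1 (le_self_add.trans h4),
      vSq_le_of_sub hM h2 (le_add_self.trans h4), h3.trans hMr⟩
  set iv2 := ∫⁻ τ in Ioo 0 t, vSq 2 (U τ - u τ) with hiv2
  set iw2 := ∫⁻ τ in Ioo 0 t, vSq 2 (B τ - b τ) with hiw2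
  set iv3 := ∫⁻ τ in Ioo 0 t, vSq 3 (U τ - u τ) with hiv3
  set iw3 := ∫⁻ τ in Ioo 0 t, vSq 3 (B τ - b τ) with hiw3
  set iy := ∫⁻ τ in Ioo 0 t, sSq 0 (Θ τ - θ τ) with hiy
  set idy := ∫⁻ τ in Ioo 0 t, sSq 1 (Θ τ - θ τ) with hidy
  have const_fin : ∀ c : ℝ≥0∞, c ≠ ∞ → ∫⁻ _ in Ioo 0 t, c ≠ ∞ := fun c hc => by
    rw [setLIntegral_const]
    exact ENNReal.mul_ne_top hc (by simp)
  have fv2 : iv2 ≠ ∞ := ((setLIntegral_mono' measurableSet_Ioo fun τ hτ =>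
    le_self_add.trans (hboot τ ⟨hτ.1.le, hτ.2.le⟩)).trans_lt
      (lt_top_iff_ne_top.2 (const_fin 1 (by simp)))).ne
  have fw2 : iw2 ≠ ∞ := ((setLIntegral_mono' measurableSet_Ioo fun τ hτ =>
    le_add_self.trans (hboot τ ⟨hτ.1.le, hτ.2.le⟩)).trans_lt
      (lt_top_iff_ne_top.2 (const_fin 1 (by simp)))).ne
  -- This integral stands on both sides of the heat estimate, so its absorption needs finiteness
  -- beforehand; it comes from the bound on Θ and from θ ∈ L^∞(0,T; H²).
  have fdy : idy ≠ ∞ := by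
    have : idy ≤ ∫⁻ _ in Ioo 0 t, 2 * (R + Rθ) := by
      refine lintegral_mono_ae ?_
      filter_upwards [hθfin, ae_restrict_mem measurableSet_Ioo] with τ h1 h2
      refine (sSq_sub_le _ _ _).trans ?_
      gcongr
      exact (bds τ h2).2.2.2.2
    refine (this.trans_lt (lt_top_iff_ne_top.2 (const_fin _ ?_))).ne
    exact ENNReal.mul_ne_top (by simp) (by simp [hR])
  have fy : iy ≠ ∞ :=
    ((lintegral_mono fun τ => sSq_mono_exponent (by norm_num) _).trans_lt
      (lt_top_iff_ne_top.2 fdy)).ne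
  set F : ℝ≥0∞ := ENNReal.ofReal m ^ 2 * R ^ (β + 1) with hF
  have hFreal : F = ENNReal.ofReal (m ^ 2 * r ^ (β + 1)) := by
    rw [hF, hR, ENNReal.ofReal_rpow_of_nonneg hr0 (by linarith), ← ENNReal.ofReal_pow hm,
      ← ENNReal.ofReal_mul (sq_nonneg m)]
  set G : ℝ → ℝ≥0∞ := fun τ =>
    C₁ * (R * (vSq 2 (U τ - u τ) + vSq 2 (B τ - b τ)) + sSq 1 (Θ τ - θ τ)) with hG
  have hforce : ∀ᵐ τ ∂(volume.restrict (Ioo 0 t)), ∀ j,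
      hSq 1 (fun k => (U' τ j k - u' τ j k) + (p.ν * lam k : ℝ) * fc ⇑((U τ - u τ) j) k) ≤ G τ ∧
      hSq 1 (fun k => (B' τ j k - b' τ j k) + (p.μ * lam k : ℝ) * fc ⇑((B τ - b τ) j) k) ≤ G τ := by
    filter_upwards [ae_mono hle hE, ae_mono hle he, ae_restrict_mem measurableSet_Ioo]
      with τ h1 h2 h3 j
    obtain ⟨b1, b2, b3, b4, -⟩ := bds τ h3
    have h4 := hC₁ _ _ R (U τ) (B τ) (u τ) (b τ) (Θ τ) (θ τ) _ _ _ _ _ _ ENNReal.ofReal_ne_top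
      b1 b2 b3 b4 h1.2.2 h2.2.2 j
    refine ⟨h4.1, h4.2.trans ?_⟩
    simp only [hG]
    gcongr
    exact le_self_add
  have hheat : ∀ᵐ τ ∂(volume.restrict (Ioo 0 t)),
      hSq 0 (fun k => (Θ' τ k - θ' τ k) + (p.κ * lam k : ℝ) * fc ⇑(Θ τ - θ τ) k) ≤
        C₃ * (R * (vSq 2 (U τ - u τ) + vSq 2 (B τ - b τ) + sSq 1 (Θ τ - θ τ)) + F) := by
    filter_upwards [ae_mono hle hE, ae_mono hle he, ae_restrict_mem measurableSet_Ioo, hθfin]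
      with τ h1 h2 h3 h4
    obtain ⟨b1, b2, b3, b4, b5⟩ := bds τ h3
    exact hC₃ ζ m hζ hm happ R (U τ) (B τ) (u τ) (b τ) (Θ τ) (θ τ) _ _ _ _ _ _
      ENNReal.ofReal_ne_top b1 b2 b3 b4 b5 (h4.trans_lt (by simp)) h1.2.2 h2.2.2
  have hGint : ∫⁻ τ in Ioo 0 t, G τ = C₁ * (R * (iv2 + iw2) + idy) := by
    simp only [hG]
    rw [lintegral_const_mul' _ _ (by simp), lintegral_add_right' _ (meas_η 1),
      lintegral_const_mul' _ _ (by simp [hR]), lintegral_add_left' (meas_v 2)]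
  have hHint : ∫⁻ τ in Ioo 0 t,
      (C₃ * (R * (vSq 2 (U τ - u τ) + vSq 2 (B τ - b τ) + sSq 1 (Θ τ - θ τ)) + F) : ℝ≥0∞) =
      C₃ * (R * (iv2 + iw2 + idy) + F * ENNReal.ofReal t) := by
    rw [lintegral_const_mul' _ _ (by simp), lintegral_add_right' _ aemeasurable_const,
      lintegral_const_mul' _ _ (by simp [hR]), lintegral_add_right' _ (meas_η 1),
      lintegral_add_left' (meas_v 2), setLIntegral_const, Real.volume_Ioo, sub_zero]
  have hGfin : (2 * (C₁ * (R * (iv2 + iw2) + idy)) : ℝ≥0∞) ≠ ∞ := by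
    refine ENNReal.mul_ne_top (by simp) (ENNReal.mul_ne_top (by simp) (ENNReal.add_ne_top.2
      ⟨ENNReal.mul_ne_top (by simp [hR]) (ENNReal.add_ne_top.2 ⟨fv2, fw2⟩), fdy⟩))
  have hHfin : (C₃ * (R * (iv2 + iw2 + idy) + F * ENNReal.ofReal t) : ℝ≥0∞) ≠ ∞ := by
    refine ENNReal.mul_ne_top (by simp) (ENNReal.add_ne_top.2
      ⟨ENNReal.mul_ne_top (by simp [hR]) (ENNReal.add_ne_top.2
        ⟨ENNReal.add_ne_top.2 ⟨fv2, fw2⟩, fdy⟩), ?_⟩)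
    rw [hFreal]
    exact ENNReal.mul_ne_top (by simp) (by simp)
  have hGreal : (2 * (C₁ * (R * (iv2 + iw2) + idy)) : ℝ≥0∞).toReal =
      2 * (C₁ * (r * (iv2.toReal + iw2.toReal) + idy.toReal)) := by
    rw [ENNReal.toReal_mul, ENNReal.toReal_mul, ENNReal.toReal_add (ENNReal.mul_ne_top (by simp [hR])
      (ENNReal.add_ne_top.2 ⟨fv2, fw2⟩)) fdy, ENNReal.toReal_mul, ENNReal.toReal_add fv2 fw2, hR,
      ENNReal.toReal_ofReal hr0]
    simp
  have hHreal : (C₃ * (R * (iv2 + iw2 + idy) + F * ENNReal.ofReal t) : ℝ≥0∞).toReal =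
      C₃ * (r * (iv2.toReal + iw2.toReal + idy.toReal) + m ^ 2 * r ^ (β + 1) * t) := by
    have hFnn : 0 ≤ m ^ 2 * r ^ (β + 1) := by positivity
    rw [ENNReal.toReal_mul, ENNReal.toReal_add (ENNReal.mul_ne_top (by simp [hR])
      (ENNReal.add_ne_top.2 ⟨ENNReal.add_ne_top.2 ⟨fv2, fw2⟩, fdy⟩))
      (ENNReal.mul_ne_top (by simp [hFreal]) (by simp)), ENNReal.toReal_mul,
      ENNReal.toReal_add (ENNReal.add_ne_top.2 ⟨fv2, fw2⟩) fdy, ENNReal.toReal_add fv2 fw2, hR,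
      ENNReal.toReal_ofReal hr0, ENNReal.toReal_mul, hFreal, ENNReal.toReal_ofReal hFnn,
      ENNReal.toReal_ofReal ht0]
    simp
  have env := vSq_two_energy_le ht0 mv hν (G := G)
    (fun j => hforce.mono fun τ h => (h j).1) htt
  have enw := vSq_two_energy_le ht0 mw hμ (G := G)
    (fun j => hforce.mono fun τ h => (h j).2) htt
  -- The Young parameter expected by `combine_energy_le`.
  have ha : 0 < 2 * C₃ * r / p.κ := by positivity
  have enη := (sSq_zero_energy_le mη hκ ha htt).trans
    (add_le_add le_rfl (mul_le_mul_right ((lintegral_mono_ae hheat).trans_eq hHint) _))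
  rw [hGint] at env enw
  obtain ⟨fv3, rv⟩ := toReal_energy_le hν (by positivity) (by positivity) fv2 hGfin env
  obtain ⟨fw3, rw'⟩ := toReal_energy_le hμ (by positivity) (by positivity) fw2 hGfin enw
  obtain ⟨-, rη⟩ := toReal_energy_le hκ (by positivity) (by positivity) fy hHfin enη
  rw [hGreal] at rv rw'
  rw [hHreal] at rη
  have hfinal := hcomb _ _ _ _ _ _ _ _ _ r (m ^ 2 * r ^ (β + 1) * t) hr1 ENNReal.toReal_nonneg
    ENNReal.toReal_nonneg ENNReal.toReal_nonneg ENNReal.toReal_nonneg ENNReal.toReal_nonneg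
    ENNReal.toReal_nonneg (by positivity) rv rw' rη
  have hdiss : ∫⁻ τ in Ioo 0 t, dissSq U B u b Θ θ τ = iv3 + iw3 + idy := by
    simp only [dissSq]
    rw [lintegral_add_right' _ (meas_η 1), lintegral_add_left' (meas_v 3)]
  have hdfin : iv3 + iw3 + idy ≠ ∞ :=
    ENNReal.add_ne_top.2 ⟨ENNReal.add_ne_top.2 ⟨fv3, fw3⟩, fdy⟩
  rw [hdiss]
  refine ⟨hdfin, ?_⟩
  obtain ⟨hXfin, hXc⟩ := continuousOn_toReal_diffSq hO.U_contH2 hS.u_contH2 hO.B_contH2 hS.b_contH2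
  have hdX : (∫⁻ τ in Ioo 0 t, diffSq U B u b τ) = iv2 + iw2 := by
    simp only [diffSq]
    rw [lintegral_add_left' (meas_v 2)]
  have meas_X : AEMeasurable (diffSq U B u b) (volume.restrict (Ioo 0 t)) :=
    (meas_v 2).add (meas_w 2)
  have ix : ∫ τ in (0 : ℝ)..t, (diffSq U B u b τ).toReal = iv2.toReal + iw2.toReal := by
    rw [intervalIntegral.integral_of_le ht0, integral_Ioc_eq_integral_Ioo,
      integral_toReal meas_X, ← ENNReal.toReal_add fv2 fw2, ← hdX]
    · filter_upwards [ae_restrict_mem measurableSet_Ioo] with τ hτ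
      exact lt_top_iff_ne_top.2 (hXfin τ ⟨hτ.1.le, hτ.2.le.trans ht.2⟩)
  have iyr : ∫ τ in (0 : ℝ)..t, (sSq 0 (Θ τ - θ τ)).toReal = iy.toReal := by
    rw [intervalIntegral.integral_of_le ht0, integral_Ioc_eq_integral_Ioo,
      integral_toReal (meas_η 0) (ae_lt_top' (meas_η 0) fy)]
  have intX : IntervalIntegrable (fun τ => (diffSq U B u b τ).toReal) volume 0 t :=
    (hXc.mono (by rw [uIcc_of_le ht0]; exact Icc_subset_Icc_right ht.2)).intervalIntegrable
  have intY : IntervalIntegrable (fun τ => (sSq 0 (Θ τ - θ τ)).toReal) volume 0 t := by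
    rw [intervalIntegrable_iff_integrableOn_Ioo_of_le ht0]
    exact integrable_toReal_of_lintegral_ne_top (meas_η 0) fy
  rw [intervalIntegral.integral_add ((intX.add (intY.const_mul A)).const_mul _) (by simp),
    intervalIntegral.integral_const_mul, intervalIntegral.integral_add intX (intY.const_mul A),
    intervalIntegral.integral_const_mul, ix, iyr, intervalIntegral.integral_const, smul_eq_mul,
    sub_zero]
  rw [ENNReal.toReal_add (ENNReal.add_ne_top.2 ⟨fv3, fw3⟩) fdy, ENNReal.toReal_add fv3 fw3]
  have hXt : (diffSq U B u b t).toReal =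
      (vSq 2 (U t - u t)).toReal + (vSq 2 (B t - b t)).toReal := by
    obtain ⟨h1, h2⟩ := ENNReal.add_ne_top.1 (hXfin t ht)
    exact ENNReal.toReal_add h1 h2
  rw [hXt]
  refine hfinal.trans ?_
  have hM0 : 0 ≤ M := by linarith
  have hrpow : r ^ (β + 1) = 4 ^ (β + 1) * M ^ (2 + 2 * β) := by
    rw [hr, Real.mul_rpow (by norm_num) (sq_nonneg M), ← Real.rpow_natCast, ← Real.rpow_mul hM0]
    congr 2
    push_cast; ring
  have h4 : (4 : ℝ) ≤ 4 ^ (β + 1) := by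
    calc (4 : ℝ) = 4 ^ (1 : ℝ) := by norm_num
      _ ≤ _ := Real.rpow_le_rpow_of_exponent_le (by norm_num) (by linarith)
  have hS0 : 0 ≤ M ^ 2 * (iv2.toReal + iw2.toReal + A * iy.toReal) := by
    have := @ENNReal.toReal_nonneg
    have h1 : 0 ≤ iv2.toReal := this
    have h2 : 0 ≤ iw2.toReal := this
    have h3 : 0 ≤ iy.toReal := this
    positivity
  calc C * (r * (iv2.toReal + iw2.toReal + A * iy.toReal) + m ^ 2 * r ^ (β + 1) * t)
      = C * (4 * (M ^ 2 * (iv2.toReal + iw2.toReal + A * iy.toReal))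
        + m ^ 2 * (4 ^ (β + 1) * M ^ (2 + 2 * β)) * t) := by rw [hrpow, hr]; ring
    _ ≤ C * (4 ^ (β + 1) * (M ^ 2 * (iv2.toReal + iw2.toReal + A * iy.toReal))
        + m ^ 2 * (4 ^ (β + 1) * M ^ (2 + 2 * β)) * t) := by gcongr
    _ = _ := by ring

/-! ## Convergence of the calmed system -/

/-- The error estimate in the strong norms, with the constants of the energy inequality. -/
theorem exists_error_bound (p : Params) (hν : 0 < p.ν) (hμ : 0 < p.μ) (hκ : 0 < p.κ)
    {β : ℝ} (hβ : 1 ≤ β) : ∃ K > 0, ∀ (T M m : ℝ) (ζ : ℝ → ℝ) (U₀ B₀ : VF)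
      (Θ₀ : L2) (U B : ℝ → VF) (Θ : ℝ → L2) (u b : ℝ → VF) (θ : ℝ → L2), 0 < T → 1 ≤ M → 0 ≤ m →
      Continuous ζ → (∀ x, |x - ζ x| ≤ m * |x| ^ β) →
      IsOriginalSolution p T U₀ B₀ Θ₀ U B Θ →
      (∀ t ∈ Icc 0 T, vNorm 2 (U t) + vNorm 2 (B t) + sNorm 1 (Θ t) ≤ ENNReal.ofReal M) →
      IsStrongSolution p ζ T U₀ B₀ Θ₀ u b θ →
      m ^ 2 * M ^ (2 * β) * Real.exp (K * M ^ 2 * T) < 1 →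
      (∀ t ∈ Icc 0 T, vSq 2 (U t - u t) + vSq 2 (B t - b t) + sSq 0 (Θ t - θ t) ≤
        ENNReal.ofReal (K * (m ^ 2 * M ^ (2 * β) * Real.exp (K * M ^ 2 * T)))) ∧
      ∫⁻ t in Icc 0 T, (vSq 3 (U t - u t) + vSq 3 (B t - b t) + sSq 1 (Θ t - θ t)) ≤
        ENNReal.ofReal (K * (m ^ 2 * M ^ (2 * β) * Real.exp (K * M ^ 2 * T))) := by
  obtain ⟨A, hA, C, hC, c, hc, hen⟩ := exists_energy_inequality p hν hμ hκ hβ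
  -- C dominates the Grönwall exponent; 1, A⁻¹ and c⁻¹ recover v and w, η, and the dissipation from
  -- E + D.
  set K := C + 1 + A⁻¹ + c⁻¹ with hK
  have hA' : 0 < A⁻¹ := inv_pos.2 hA
  have hc' : 0 < c⁻¹ := inv_pos.2 hc
  refine ⟨K, by positivity, ?_⟩
  intro T M m ζ U₀ B₀ Θ₀ U B Θ u b θ hT hM hm hζ happ hO hbd hS hsmall
  have hM0 : 0 < M := by linarith
  have hbd' : ∀ t ∈ Icc 0 T, vSq 2 (U t) ≤ ENNReal.ofReal (M ^ 2) ∧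
      vSq 2 (B t) ≤ ENNReal.ofReal (M ^ 2) ∧ sSq 1 (Θ t) ≤ ENNReal.ofReal (M ^ 2) := fun t ht =>
    ⟨vSq_le_of_vNorm_le hM0.le ((le_self_add.trans le_self_add).trans (hbd t ht)),
      vSq_le_of_vNorm_le hM0.le ((le_add_self.trans le_self_add).trans (hbd t ht)),
      sSq_le_of_sNorm_le hM0.le (le_add_self.trans (hbd t ht))⟩
  have hineq := hen T M m ζ U₀ B₀ Θ₀ U B Θ u b θ hT hM hm hζ happ hO hbd' hS
  obtain ⟨hXfin, hXc⟩ := continuousOn_toReal_diffSq hO.U_contH2 hS.u_contH2 hO.B_contH2 hS.b_contH2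
  have hΘ0 : ContH 0 T Θ := by
    refine ⟨fun t ht => (sSq_mono_exponent (by norm_num) _).trans_lt (hO.Θ_contH2.1 t ht),
      fun t₀ ht₀ => ?_⟩
    exact tendsto_of_tendsto_of_tendsto_of_le_of_le tendsto_const_nhds (hO.Θ_contH2.2 t₀ ht₀)
      (fun _ => zero_le) fun t => sSq_mono_exponent (by norm_num) _
  have hη : ContH 0 T (fun t => Θ t - θ t) := hΘ0.sub hS.θ_cont
  have hYfin : ∀ t ∈ Icc 0 T, sSq 0 (Θ t - θ t) ≠ ∞ := fun t ht => (hη.1 t ht).ne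
  have hYc := continuousOn_toReal (continuousOn_sSq hη) hYfin
  set E : ℝ → ℝ := fun t => (diffSq U B u b t).toReal + A * (sSq 0 (Θ t - θ t)).toReal with hE
  have hEc : ContinuousOn E (Icc 0 T) := hXc.add (continuousOn_const.mul hYc)
  have hzero : ∀ s, sSq s (0 : L2) = 0 := by
    intro s
    have : fc ⇑(0 : L2) = fun _ => 0 := by
      funext k
      have := fc_L2_sub 0 0 k
      rwa [sub_self, sub_self] at this
    unfold sSq
    rw [this]
    simp [hSq]
  have hE0 : E 0 = 0 := by
    have h1 : diffSq U B u b 0 = 0 := by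
      simp only [diffSq, vSq, hO.init_U, hS.init_u, hO.init_B, hS.init_b, sub_self, Pi.zero_apply,
        hzero, Finset.sum_const_zero, add_zero]
    simp only [hE, h1, hO.init_Θ, hS.init_θ, sub_self, hzero, ENNReal.toReal_zero, mul_zero,
      add_zero]
  set D : ℝ → ℝ := fun t => c * (∫⁻ τ in Ioo 0 t, dissSq U B u b Θ θ τ).toReal with hD
  have hM2 : M ^ (2 + 2 * β) = M ^ 2 * M ^ (2 * β) := by
    rw [Real.rpow_add hM0]; norm_num
  -- The ratio b/a in Grönwall: C and a factor M² cancel.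
  have hba : C * (m ^ 2 * M ^ (2 + 2 * β)) / (C * M ^ 2) = m ^ 2 * M ^ (2 * β) := by
    rw [hM2]; field_simp
  have hCK : C ≤ K := by rw [hK]; linarith
  have hexp : m ^ 2 * M ^ (2 * β) * Real.exp (C * M ^ 2 * T) ≤
      m ^ 2 * M ^ (2 * β) * Real.exp (K * M ^ 2 * T) := by gcongr
  have hXle : ∀ s ∈ Icc 0 T, E s ≤ 1 → diffSq U B u b s ≤ 1 := by
    intro s hs h1
    have h2 : (diffSq U B u b s).toReal ≤ 1 := by
      refine le_trans ?_ h1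
      exact le_add_of_nonneg_right (mul_nonneg hA.le ENNReal.toReal_nonneg)
    rw [← ENNReal.ofReal_toReal (hXfin s hs)]
    exact ENNReal.ofReal_le_one.2 h2
  have hboot := gronwall_bootstrap (a := C * M ^ 2) (b := C * (m ^ 2 * M ^ (2 + 2 * β))) hT.le
    (by positivity) (by positivity) hEc hE0
    (D := D) (fun t => mul_nonneg hc.le ENNReal.toReal_nonneg)
    (fun t ht h => (hineq t ht fun s hs =>
      hXle s ⟨hs.1, hs.2.trans ht.2⟩ (h s hs)).2)
    (by rw [hba]; linarith)
  rw [hba] at hboot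
  set W := m ^ 2 * M ^ (2 * β) * Real.exp (K * M ^ 2 * T) with hW
  have hW0 : 0 ≤ W := by positivity
  have hall : ∀ t ∈ Icc 0 T, E t + D t ≤ W := fun t ht => (hboot t ht).2.trans hexp
  have hE0' : ∀ t, 0 ≤ E t := fun t =>
    add_nonneg ENNReal.toReal_nonneg (mul_nonneg hA.le ENNReal.toReal_nonneg)
  have hD0' : ∀ t, 0 ≤ D t := fun t => mul_nonneg hc.le ENNReal.toReal_nonneg
  constructor
  · intro t ht
    have h1 : E t ≤ W := by linarith [hall t ht, hD0' t]
    change diffSq U B u b t + sSq 0 (Θ t - θ t) ≤ _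
    rw [← ENNReal.ofReal_toReal (hXfin t ht), ← ENNReal.ofReal_toReal (hYfin t ht),
      ← ENNReal.ofReal_add ENNReal.toReal_nonneg ENNReal.toReal_nonneg]
    refine ENNReal.ofReal_le_ofReal ?_
    have hx : 0 ≤ (diffSq U B u b t).toReal := ENNReal.toReal_nonneg
    have hy : 0 ≤ (sSq 0 (Θ t - θ t)).toReal := ENNReal.toReal_nonneg
    have hy2 : (sSq 0 (Θ t - θ t)).toReal ≤ A⁻¹ * W := by
      rw [← div_eq_inv_mul, le_div_iff₀ hA]
      simp only [hE] at h1
      linarith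
    have hx2 : (diffSq U B u b t).toReal ≤ W := by
      have := mul_nonneg hA.le hy
      simp only [hE] at h1
      linarith
    have : 0 ≤ C * W := by positivity
    have : 0 ≤ c⁻¹ * W := by positivity
    rw [hK]
    linarith
  · have hTT : T ∈ Icc 0 T := right_mem_Icc.2 hT.le
    -- The bootstrap has removed the smallness condition on all of [0,T], so the energy inequality
    -- applies at T.
    obtain ⟨hdfin, -⟩ := hineq T hTT fun s hs => hXle s hs (hboot s hs).1
    have h1 : D T ≤ W := by linarith [hall T hTT, hE0' T]
    rw [← setLIntegral_congr (Ioo_ae_eq_Icc (a := (0 : ℝ)) (b := T))]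
    change ∫⁻ τ in Ioo 0 T, dissSq U B u b Θ θ τ ≤ _
    rw [← ENNReal.ofReal_toReal hdfin]
    refine ENNReal.ofReal_le_ofReal ?_
    have h2 : (∫⁻ τ in Ioo 0 T, dissSq U B u b Θ θ τ).toReal ≤ c⁻¹ * W := by
      rw [← div_eq_inv_mul, le_div_iff₀ hc]
      simp only [hD] at h1
      linarith
    have : 0 ≤ C * W := by positivity
    have : 0 ≤ A⁻¹ * W := by positivity
    rw [hK]
    linarith

theorem exists_convergence_rate (p : Params) (hν : 0 < p.ν) (hμ : 0 < p.μ)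
    (hκ : 0 < p.κ) (C γ β : ℝ) (hC : 0 < C) (hγ : 0 < γ) (hβ : 1 ≤ β) :
    ∃ K : ℝ, 0 < K ∧ ∀ (T M : ℝ), 0 < T → 1 ≤ M → ∃ ε₀ : ℝ, 0 < ε₀ ∧
      ∀ (ζ : ℝ → ℝ → ℝ), IsCalmingFamily C γ β ζ →
      ∀ (U₀ B₀ : VF) (Θ₀ : L2) (U B : ℝ → VF) (Θ : ℝ → L2),
        IsOriginalSolution p T U₀ B₀ Θ₀ U B Θ →
        (∀ t ∈ Icc 0 T, vNorm 2 (U t) + vNorm 2 (B t) + sNorm 1 (Θ t) ≤ ENNReal.ofReal M) →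
      ∀ ε : ℝ, 0 < ε → ε < ε₀ →
      ∀ (u b : ℝ → VF) (θ : ℝ → L2), IsStrongSolution p (ζ ε) T U₀ B₀ Θ₀ u b θ →
        (∀ t ∈ Icc 0 T,
          vSq 1 (U t - u t) + vSq 1 (B t - b t) + sSq 0 (Θ t - θ t)
            ≤ ENNReal.ofReal
              (K * M ^ (2 + 2 * β) * Real.exp (K * (M ^ (4 / 3 : ℝ) + M ^ 2) * T)
                * ε ^ (2 * γ))) ∧
        ∫⁻ t in Icc 0 T,
          (vSq 2 (U t - u t) + vSq 2 (B t - b t) + sSq 1 (Θ t - θ t))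
            ≤ ENNReal.ofReal
              (K * M ^ (2 + 2 * β) * (Real.exp (K * (M ^ (4 / 3 : ℝ) + M ^ 2) * T) + T)
                * ε ^ (2 * γ)) := by
  obtain ⟨K₁, hK₁, hmain⟩ := exists_error_bound p hν hμ hκ hβ
  -- K has to dominate K₁ in the exponent and K₁ C² in front, the C² coming from m = C ε^γ.
  set K := K₁ * (1 + C ^ 2) with hK
  have hK0 : 0 < K := by positivity
  refine ⟨K, hK0, fun T M hT hM => ?_⟩
  have hM0 : 0 < M := by linarith
  set L := C ^ 2 * M ^ (2 * β) * Real.exp (K₁ * M ^ 2 * T) with hL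
  have hL0 : 0 < L := by positivity
  -- The value of ε at which L ε^(2γ) = 1, the limit of the smallness condition of the bootstrap.
  refine ⟨(L⁻¹) ^ (1 / (2 * γ)), by positivity, ?_⟩
  intro ζ hζ U₀ B₀ Θ₀ U B Θ hO hbd ε hε hεε₀ u b θ hS
  obtain ⟨Lip, hLip⟩ := hζ.lipschitz ε hε
  have hsq : (C * ε ^ γ) ^ 2 = C ^ 2 * ε ^ (2 * γ) := by
    rw [mul_pow, ← Real.rpow_natCast (ε ^ γ), ← Real.rpow_mul hε.le]
    congr 2
    push_cast; ring
  have heq : (C * ε ^ γ) ^ 2 * M ^ (2 * β) * Real.exp (K₁ * M ^ 2 * T) = L * ε ^ (2 * γ) := by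
    rw [hsq, hL]; ring
  have hsmall : L * ε ^ (2 * γ) < 1 := by
    have h1 := Real.rpow_lt_rpow hε.le hεε₀ (by positivity : 0 < 2 * γ)
    rw [← Real.rpow_mul (by positivity), one_div_mul_cancel (by positivity), Real.rpow_one] at h1
    calc L * ε ^ (2 * γ) < L * L⁻¹ := by gcongr
      _ = 1 := mul_inv_cancel₀ hL0.ne'
  obtain ⟨h1, h2⟩ := hmain T M (C * ε ^ γ) (ζ ε) U₀ B₀ Θ₀ U B Θ u b θ hT hM (by positivity)
    hLip.continuous (hζ.approx ε hε) hO hbd hS (by rw [heq]; exact hsmall)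
  rw [heq] at h1 h2
  have hfin : K₁ * (L * ε ^ (2 * γ)) ≤
      K * M ^ (2 + 2 * β) * Real.exp (K * (M ^ (4 / 3 : ℝ) + M ^ 2) * T) * ε ^ (2 * γ) := by
    -- The bound obtained is stronger than the one claimed: M ≥ 1 gives the extra M², and M^(4/3) is
    -- added in the exponent.
    have e1 : M ^ (2 * β) ≤ M ^ (2 + 2 * β) := Real.rpow_le_rpow_of_exponent_le hM (by linarith)
    have hKK : K₁ ≤ K := by rw [hK]; nlinarith [sq_nonneg C]
    have e2 : K₁ * M ^ 2 * T ≤ K * (M ^ (4 / 3 : ℝ) + M ^ 2) * T := by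
      gcongr
      exact le_add_of_nonneg_left (by positivity)
    have e3 : K₁ * C ^ 2 ≤ K := by rw [hK]; nlinarith
    calc K₁ * (L * ε ^ (2 * γ))
        = (K₁ * C ^ 2) * M ^ (2 * β) * Real.exp (K₁ * M ^ 2 * T) * ε ^ (2 * γ) := by
          rw [hL]; ring
      _ ≤ _ := by gcongr
  constructor
  · intro t ht
    refine le_trans ?_ ((h1 t ht).trans (ENNReal.ofReal_le_ofReal hfin))
    gcongr
    · exact vSq_mono_exponent (by norm_num) _
    · exact vSq_mono_exponent (by norm_num) _
  · refine le_trans (lintegral_mono fun t => ?_) (h2.trans (ENNReal.ofReal_le_ofReal (hfin.trans ?_)))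
    · gcongr
      · exact vSq_mono_exponent (by norm_num) _
      · exact vSq_mono_exponent (by norm_num) _
    · gcongr
      exact le_add_of_nonneg_right hT.le

/-! ### Convergence for a fixed solution of the original system -/

lemma IsOriginalSolution.exists_bound {p : Params} {T : ℝ} (hT : 0 < T) {U₀ B₀ : VF} {Θ₀ : L2}
    {U B : ℝ → VF} {Θ : ℝ → L2} (h : IsOriginalSolution p T U₀ B₀ Θ₀ U B Θ) : ∃ M : ℝ, 1 ≤ M ∧
      ∀ t ∈ Icc 0 T, vNorm 2 (U t) + vNorm 2 (B t) + sNorm 1 (Θ t) ≤ ENNReal.ofReal M := by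
  -- Θ is measured in H², where its continuity is given; a continuous function attains its maximum
  -- on [0,T], and the H¹ norm is smaller.
  set f : ℝ → ℝ≥0∞ := fun t => vNorm 2 (U t) + vNorm 2 (B t) + sNorm 2 (Θ t) with hf
  have hr : Continuous fun x : ℝ≥0∞ => x ^ (1 / 2 : ℝ) := ENNReal.continuous_rpow_const
  have hv : ∀ {V : ℝ → VF}, (∀ j, ContH 2 T (fun t => V t j)) →
      ContinuousOn (fun t => vNorm 2 (V t)) (Icc 0 T) := by
    intro V hV
    simp only [vNorm, vSq, Fin.sum_univ_two]
    exact hr.comp_continuousOn ((continuousOn_sSq (hV 0)).add (continuousOn_sSq (hV 1)))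
  have hfc : ContinuousOn f (Icc 0 T) :=
    ((hv h.U_contH2).add (hv h.B_contH2)).add (hr.comp_continuousOn (continuousOn_sSq h.Θ_contH2))
  obtain ⟨t₀, ht₀, hmax⟩ := isCompact_Icc.exists_isMaxOn (nonempty_Icc.2 hT.le) hfc
  have hfin : f t₀ ≠ ∞ := by
    refine ENNReal.add_ne_top.2 ⟨ENNReal.add_ne_top.2 ⟨?_, ?_⟩, ?_⟩
    · exact ENNReal.rpow_ne_top_of_nonneg (by norm_num) (vSq_lt_top fun j => (h.U_contH2 j).1 t₀ ht₀).ne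
    · exact ENNReal.rpow_ne_top_of_nonneg (by norm_num) (vSq_lt_top fun j => (h.B_contH2 j).1 t₀ ht₀).ne
    · exact ENNReal.rpow_ne_top_of_nonneg (by norm_num) (h.Θ_contH2.1 t₀ ht₀).ne
  refine ⟨max 1 (f t₀).toReal, le_max_left _ _, fun t ht => ?_⟩
  calc vNorm 2 (U t) + vNorm 2 (B t) + sNorm 1 (Θ t) ≤ f t := by
        simp only [hf, sNorm]
        gcongr
        exact sSq_mono_exponent (by norm_num) _
    _ ≤ f t₀ := hmax ht
    _ = ENNReal.ofReal (f t₀).toReal := (ENNReal.ofReal_toReal hfin).symm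
    _ ≤ _ := ENNReal.ofReal_le_ofReal (le_max_right _ _)

/-- Compactness supplies some M, hence a rate; each of the three norms is at most the square root of
the bound on the sum of squares, which gives the factor 3. -/
theorem tendsto_iSup_norm_sub (p : Params) (hν : 0 < p.ν) (hμ : 0 < p.μ)
    (hκ : 0 < p.κ) (C γ β : ℝ) (hC : 0 < C) (hγ : 0 < γ) (hβ : 1 ≤ β) (T : ℝ) (hT : 0 < T)
    (ζ : ℝ → ℝ → ℝ) (hζ : IsCalmingFamily C γ β ζ) (U₀ B₀ : VF) (Θ₀ : L2)
    (U B : ℝ → VF) (Θ : ℝ → L2) (hO : IsOriginalSolution p T U₀ B₀ Θ₀ U B Θ)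
    (u b : ℝ → ℝ → VF) (θ : ℝ → ℝ → L2)
    (hS : ∀ ε > 0, IsStrongSolution p (ζ ε) T U₀ B₀ Θ₀ (u ε) (b ε) (θ ε)) :
    Tendsto (fun ε : ℝ => ⨆ t ∈ Icc 0 T,
        (vNorm 1 (U t - u ε t) + vNorm 1 (B t - b ε t) + sNorm 0 (Θ t - θ ε t)))
      (𝓝[>] 0) (𝓝 0) := by
  obtain ⟨K, -, hrate⟩ := exists_convergence_rate p hν hμ hκ C γ β hC hγ hβ
  obtain ⟨M, hM, hbd⟩ := hO.exists_bound hT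
  obtain ⟨ε₀, hε₀, hrate⟩ := hrate T M hT hM
  set K' := K * M ^ (2 + 2 * β) * Real.exp (K * (M ^ (4 / 3 : ℝ) + M ^ 2) * T) with hK'
  have hlim : Tendsto (fun ε : ℝ => 3 * ENNReal.ofReal (K' * ε ^ (2 * γ)) ^ (1 / 2 : ℝ))
      (𝓝[>] 0) (𝓝 0) := by
    have hcont : Continuous fun ε : ℝ => 3 * ENNReal.ofReal (K' * ε ^ (2 * γ)) ^ (1 / 2 : ℝ) := by
      refine (ENNReal.continuous_const_mul (by simp)).comp
        (ENNReal.continuous_rpow_const.comp (ENNReal.continuous_ofReal.comp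
          (continuous_const.mul (Real.continuous_rpow_const (by positivity)))))
    have h0 := hcont.tendsto 0
    rw [Real.zero_rpow (by positivity), mul_zero, ENNReal.ofReal_zero,
      ENNReal.zero_rpow_of_pos (by norm_num), mul_zero] at h0
    exact h0.mono_left nhdsWithin_le_nhds
  refine tendsto_of_tendsto_of_tendsto_of_le_of_le' tendsto_const_nhds hlim
    (Eventually.of_forall fun _ => zero_le) ?_
  filter_upwards [Ioo_mem_nhdsGT hε₀] with ε hε
  refine iSup₂_le fun t ht => ?_
  have h := (hrate ζ hζ U₀ B₀ Θ₀ U B Θ hO hbd ε hε.1 hε.2 _ _ _ (hS ε hε.1)).1 t ht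
  have h1 : vNorm 1 (U t - u ε t) ≤ ENNReal.ofReal (K' * ε ^ (2 * γ)) ^ (1 / 2 : ℝ) :=
    ENNReal.rpow_le_rpow ((le_self_add.trans le_self_add).trans h) (by norm_num)
  have h2 : vNorm 1 (B t - b ε t) ≤ ENNReal.ofReal (K' * ε ^ (2 * γ)) ^ (1 / 2 : ℝ) :=
    ENNReal.rpow_le_rpow ((le_add_self.trans le_self_add).trans h) (by norm_num)
  have h3 : sNorm 0 (Θ t - θ ε t) ≤ ENNReal.ofReal (K' * ε ^ (2 * γ)) ^ (1 / 2 : ℝ) :=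
    ENNReal.rpow_le_rpow (le_add_self.trans h) (by norm_num)
  refine (add_le_add (add_le_add h1 h2) h3).trans_eq ?_
  ring

end MHDB

end

theorem mainTheorem4 (p : MHDB.Params) (hg : 0 < p.g) (hν : 0 < p.ν) (hμ : 0 < p.μ)
    (hκ : 0 < p.κ) (C γ β : ℝ) (hC : 0 < C) (hγ : 0 < γ) (hβ : 1 ≤ β) :
    (∃ K : ℝ, 0 < K ∧ ∀ (T M : ℝ), 0 < T → 1 ≤ M → ∃ ε₀ : ℝ, 0 < ε₀ ∧
      ∀ (ζ : ℝ → ℝ → ℝ), MHDB.IsCalmingFamily C γ β ζ →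
      ∀ (U₀ B₀ : MHDB.VF) (Θ₀ : MHDB.L2),
        MHDB.InH U₀ → MHDB.vSq 2 U₀ < ∞ → MHDB.InH B₀ → MHDB.vSq 2 B₀ < ∞ →
        MHDB.sSq 2 Θ₀ < ∞ →
      ∀ (U B : ℝ → MHDB.VF) (Θ : ℝ → MHDB.L2),
        MHDB.IsOriginalSolution p T U₀ B₀ Θ₀ U B Θ →
        (∀ t ∈ Icc 0 T, MHDB.vNorm 2 (U t) + MHDB.vNorm 2 (B t) + MHDB.sNorm 1 (Θ t)
          ≤ ENNReal.ofReal M) →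
      ∀ ε : ℝ, 0 < ε → ε < ε₀ →
      ∀ (u b : ℝ → MHDB.VF) (θ : ℝ → MHDB.L2),
        MHDB.IsStrongSolution p (ζ ε) T U₀ B₀ Θ₀ u b θ →
        (∀ t ∈ Icc 0 T,
          MHDB.vSq 1 (U t - u t) + MHDB.vSq 1 (B t - b t) + MHDB.sSq 0 (Θ t - θ t)
            ≤ ENNReal.ofReal
              (K * M ^ (2 + 2 * β) * Real.exp (K * (M ^ (4 / 3 : ℝ) + M ^ 2) * T)
                * ε ^ (2 * γ))) ∧
        ∫⁻ t in Icc 0 T,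
          (MHDB.vSq 2 (U t - u t) + MHDB.vSq 2 (B t - b t) + MHDB.sSq 1 (Θ t - θ t))
            ≤ ENNReal.ofReal
              (K * M ^ (2 + 2 * β) * (Real.exp (K * (M ^ (4 / 3 : ℝ) + M ^ 2) * T) + T)
                * ε ^ (2 * γ))) ∧
    (∀ (T : ℝ), 0 < T →
      ∀ (ζ : ℝ → ℝ → ℝ), MHDB.IsCalmingFamily C γ β ζ →
      ∀ (U₀ B₀ : MHDB.VF) (Θ₀ : MHDB.L2),
        MHDB.InH U₀ → MHDB.vSq 2 U₀ < ∞ → MHDB.InH B₀ → MHDB.vSq 2 B₀ < ∞ →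
        MHDB.sSq 2 Θ₀ < ∞ →
      ∀ (U B : ℝ → MHDB.VF) (Θ : ℝ → MHDB.L2),
        MHDB.IsOriginalSolution p T U₀ B₀ Θ₀ U B Θ →
      ∀ (u b : ℝ → ℝ → MHDB.VF) (θ : ℝ → ℝ → MHDB.L2),
        (∀ ε > 0, MHDB.IsStrongSolution p (ζ ε) T U₀ B₀ Θ₀ (u ε) (b ε) (θ ε)) →
        Tendsto
          (fun ε : ℝ => ⨆ t ∈ Icc 0 T,
            (MHDB.vNorm 1 (U t - u ε t) + MHDB.vNorm 1 (B t - b ε t)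
              + MHDB.sNorm 0 (Θ t - θ ε t)))
          (𝓝[>] 0) (𝓝 0)) := by
  obtain ⟨K, hK, hrate⟩ := MHDB.exists_convergence_rate p hν hμ hκ C γ β hC hγ hβ
  refine ⟨⟨K, hK, fun T M hT hM => ?_⟩, ?_⟩
  · obtain ⟨ε₀, hε₀, h⟩ := hrate T M hT hM
    exact ⟨ε₀, hε₀, fun ζ hζ U₀ B₀ Θ₀ _ _ _ _ _ => h ζ hζ U₀ B₀ Θ₀⟩
  · exact fun T hT ζ hζ U₀ B₀ Θ₀ _ _ _ _ _ => MHDB.tendsto_iSup_norm_sub p hν hμ hκ C γ β hC hγ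
      hβ T hT ζ hζ U₀ B₀ Θ₀
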